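/- All graphs are finite and simple. The claw $K_{1,3}$ is the star with three leaves, and the bull $B_{1,1}$ is the graph obtained from a triangle by attaching one pendant vertex to each of two of its vertices. A graph is $\{K_{1,3},B_{1,1}\}$-free if it has no induced subgraph isomorphic to $K_{1,3}$ or to $B_{1,1}$. A graph is $3$-connected if it has more than three vertices and remains connected after the deletion of any set of at most two vertices. A Halin graph is a plane graph $H=T\cup C$ consisting of a tree $T$ without vertices of degree $2$ and a cycle $C$ whose vertices are exactly the leaves of $T$. **Theorem.** Every $3$-connected $\{K_{1,3},B_{1,1}\}$-free graph $G$ has a spanning Halin subgraph, that is, a Halin graph $H$ with $V(H)=V(G)$ and $E(H)\subseteq E(G)$. -/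

import Mathlib

namespace HalinSpanning

/-- The claw `K_{1,3}`: the star with three leaves. -/
abbrev claw : SimpleGraph (Fin 1 ⊕ Fin 3) := completeBipartiteGraph (Fin 1) (Fin 3)

/-- The bull `B_{1,1}`: a triangle `0, 1, 2` together with a pendant vertex `3` attached to `0`
and a pendant vertex `4` attached to `1`. -/
def bull : SimpleGraph (Fin 5) :=
  SimpleGraph.fromEdgeSet {s(0, 1), s(1, 2), s(0, 2), s(0, 3), s(1, 4)}

/-- `G` is `F`-free: no induced subgraph of `G` is isomorphic to `F`. -/
def IsInducedFree {V W : Type*} (F : SimpleGraph W) (G : SimpleGraph V) : Prop :=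
  ¬ F.IsIndContained G

/-- `G` is `k`-connected: it has more than `k` vertices, and deleting any set of fewer than `k`
vertices leaves a connected graph. -/
def IsKConnected {V : Type*} [Fintype V] (k : ℕ) (G : SimpleGraph V) : Prop :=
  k < Fintype.card V ∧
    ∀ X : Finset V, X.card < k → (G.induce ((X : Set V)ᶜ)).Connected

/-- A drawing of `G` in the plane without edge crossings. Vertices are distinct points, each edge
is drawn as an arc (the image of an injective path) joining its two ends, and apart from its ends
an edge meets neither a vertex nor another edge. -/
structure PlaneDrawing {V : Type*} (G : SimpleGraph V) where
  /-- the point representing a vertex -/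
  point : V → ℝ × ℝ
  /-- the point set representing an edge -/
  arc : Sym2 V → Set (ℝ × ℝ)
  point_injective : Function.Injective point
  isArc : ∀ u v, G.Adj u v →
    ∃ γ : Path (point u) (point v), Function.Injective γ ∧ Set.range γ = arc s(u, v)
  arc_inter_points : ∀ e ∈ G.edgeSet, arc e ∩ Set.range point ⊆ point '' {v | v ∈ e}
  arc_inter_arc : ∀ e ∈ G.edgeSet, ∀ f ∈ G.edgeSet, e ≠ f →
    arc e ∩ arc f ⊆ point '' {v | v ∈ e}

/-- `G` is planar: it can be drawn in the plane without edge crossings. -/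
def IsPlanar {V : Type*} (G : SimpleGraph V) : Prop := Nonempty (PlaneDrawing G)

/-- The leaves (vertices of degree one) of a graph. -/
def leaves {V : Type*} (T : SimpleGraph V) : Set V := {v | (T.neighborSet v).encard = 1}

/-- `C` is a cycle with vertex set `S` (the vertices outside `S` are isolated in `C`). -/
def IsCycleOn {V : Type*} (C : SimpleGraph V) (S : Set V) : Prop :=
  (∀ u v, C.Adj u v → u ∈ S ∧ v ∈ S) ∧
    ∃ n, 3 ≤ n ∧ Nonempty (C.induce S ≃g SimpleGraph.cycleGraph n)

/-- `H` is a Halin graph: it is planar, and it is the union of a tree `T` without vertices of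
degree two and a cycle `C` whose vertex set is the set of leaves of `T`. In any drawing of such a
graph, `C` is a closed curve with the rest of `T` on one side, so that `C` visits the leaves in
the cyclic order given by the drawing of `T`. -/
def IsHalin {V : Type*} (H : SimpleGraph V) : Prop :=
  IsPlanar H ∧ ∃ T C : SimpleGraph V, H = T ⊔ C ∧ T.IsTree ∧
    (∀ v, (T.neighborSet v).encard ≠ 2) ∧ IsCycleOn C (leaves T)

/-- `G` has a spanning Halin subgraph: some Halin graph on the vertex set of `G` has all its edges
in `G`. -/
def HasSpanningHalinSubgraph {V : Type*} (G : SimpleGraph V) : Prop :=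
  ∃ H : SimpleGraph V, H ≤ G ∧ IsHalin H

end HalinSpanning

/-!
The Halin graphs found here are strips: the tree is a caterpillar, whose spine is drawn as a
horizontal line with its two ends as leaves and with all other leaves pendant above or below it,
and the cycle runs through the upper leaves from left to right and back through the lower ones.
A spanning strip of `G` thus amounts to three paths with common ends `l` and `r`, namely the spine,
the upper and the lower side, where each vertex on a side has a neighbour on the spine and these
neighbours do not go back along the spine (`hasSpanningHalinSubgraph_of_strip`). The drawing in
three horizontal layers by straight segments shows planarity. Only `K₄`, which has too few vertices
for a strip, is treated separately.

If `G` has three pairwise nonadjacent vertices, then it contains an induced path with five vertices,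
and a longest induced path `p 1, …, p k` determines `G` up to multiplicities: as there are no claws
and no bulls, each vertex either sees the path just as some `p i` does, or it sees precisely the two
ends of the path. These classes are cliques, and two of them are completely joined if they are
consecutive, with the last kind of vertices forming a class between the two ends, and not joined at
all otherwise (`IsLongestPath.exists_classes`). If the last kind does not occur, 3-connectedness
gives each inner class three vertices, one for each of the three paths of the strip
(`hasSpanningHalinSubgraph_of_thick_path`). Otherwise the classes form a ring in which any two that
are not consecutive form a cut, so that at most two classes, consecutive ones, are singletons; the
spine then runs through the other classes and the leaf cycle goes once around the ring
(`hasSpanningHalinSubgraph_of_thick_cycle`).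

If there are no three pairwise nonadjacent vertices, take a vertex with the largest number of
nonneighbours. These form a clique `Q`, the vertices with exactly these nonneighbours form a clique
`X`, and `X` is completely joined to the set `N` of all remaining vertices, each of which has a
neighbour in `Q` (`AntipodalPartition`). A longest path in `N` either covers `N`, or `N` consists of
two cliques with no edges between them (`exists_isHamPath_or_split`). In the first case the spine
starts in `X`, passes through one vertex of `N` and enters `Q`; what is needed is a Hamiltonian path
of `N` whose first two vertices and whose last one have different neighbours in `Q`
(`hasGoodPath_of_isHamPath`), and small `Q` are handled separately. In the second case, either `X`
has a second vertex, which can link the two cliques to a path, or the spine can be an edge between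
`N` and `Q`, or `G` is a ring of five cliques.
-/

namespace HalinSpanning

/-! ### Straight-line drawings -/

/-- A drawing with straight edges is crossing-free as soon as no edge passes through a foreign
vertex and two different edges only ever meet in a vertex. -/
theorem isPlanar_of_segments {V : Type*} {G : SimpleGraph V} (p : V → ℝ × ℝ)
    (hp : Function.Injective p)
    (h1 : ∀ u v w, G.Adj u v → p w ∈ segment ℝ (p u) (p v) → w = u ∨ w = v)
    (h2 : ∀ u v u' v', G.Adj u v → G.Adj u' v' → s(u, v) ≠ s(u', v') →
      ∀ z ∈ segment ℝ (p u) (p v), z ∈ segment ℝ (p u') (p v') → ∃ w, p w = z) :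
    IsPlanar G := by
  refine ⟨{
    point := p
    arc := Sym2.lift ⟨fun u v => segment ℝ (p u) (p v), fun u v => segment_symm ℝ _ _⟩
    point_injective := hp
    isArc := ?_
    arc_inter_points := ?_
    arc_inter_arc := ?_ }⟩
  · intro u v huv
    refine ⟨Path.segment (p u) (p v), ?_, by simp [Path.range_segment]⟩
    intro s t hst
    have hne : p u ≠ p v := fun h => huv.ne (hp h)
    simp only [Path.segment_apply] at hst
    exact Subtype.ext (AffineMap.lineMap_injective ℝ hne hst)
  · intro e
    induction e with
    | h u v =>
      rintro he _ ⟨hz, w, rfl⟩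
      rcases h1 u v w he hz with h | h <;> exact ⟨w, by simp [h], rfl⟩
  · intro e he f hf hef z
    induction e with
    | h u v =>
    induction f with
    | h u' v' =>
      rintro ⟨hz, hz'⟩
      obtain ⟨w, rfl⟩ := h2 u v u' v' he hf hef z hz hz'
      rcases h1 u v w he hz with h | h <;> exact ⟨w, by simp [h], rfl⟩

/-- A graph whose vertices sit on integer points is planar if every edge joins horizontal
neighbours or neighbouring levels, and no two edges between the same two levels are inverted. -/
theorem isPlanar_of_layers {V : Type*} {G : SimpleGraph V} (x y : V → ℤ)
    (hinj : ∀ u v, x u = x v → y u = y v → u = v)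
    (hedge : ∀ u v, G.Adj u v →
      (y u = y v ∧ (x v = x u + 1 ∨ x u = x v + 1)) ∨ y v = y u + 1 ∨ y u = y v + 1)
    (hcross : ∀ u v u' v', G.Adj u v → G.Adj u' v' → y v = y u + 1 → y v' = y u' + 1 →
      y u = y u' → x u < x u' → x v ≤ x v') : IsPlanar G := by
  let p : V → ℝ × ℝ := fun v => ((x v : ℝ), (y v : ℝ))
  have hp : Function.Injective p := by
    intro u v h
    simp only [p, Prod.mk.injEq, Int.cast_inj] at h
    exact hinj u v h.1 h.2
  -- A point of a slanted edge whose height is an integer is one of its ends.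
  have slant : ∀ u v, y v = y u + 1 → ∀ z ∈ segment ℝ (p u) (p v), ∀ k : ℤ, z.2 = k →
      z = p u ∨ z = p v := by
    rintro u v huv z ⟨a, b, ha, hb, hab, rfl⟩ k hk
    simp only [p, Prod.smul_mk, smul_eq_mul, Prod.mk_add_mk, huv, Int.cast_add, Int.cast_one] at hk
    have hbk : b = ((k - y u : ℤ) : ℝ) := by
      have : a = 1 - b := by linarith
      subst this; push_cast; linarith
    have h0 : (0 : ℤ) ≤ k - y u := by rw [hbk] at hb; exact_mod_cast hb
    have h1 : k - y u ≤ 1 := by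
      have : b ≤ 1 := by linarith
      rw [hbk] at this; exact_mod_cast this
    rcases (by omega : k - y u = 0 ∨ k - y u = 1) with h | h
    · left
      rw [h] at hbk
      have : a = 1 := by rw [hbk] at hab; simpa using hab
      simp [hbk, this]
    · right
      rw [h] at hbk
      have : a = 0 := by rw [hbk] at hab; simpa using hab
      simp [hbk, this]
  have flat : ∀ u v, y u = y v → x v = x u + 1 → ∀ z ∈ segment ℝ (p u) (p v),
      z.2 = y u ∧ (x u : ℝ) ≤ z.1 ∧ z.1 ≤ x u + 1 := by
    rintro u v huv hx z ⟨a, b, ha, hb, hab, rfl⟩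
    have : a = 1 - b := by linarith
    subst this
    simp only [p, Prod.smul_mk, smul_eq_mul, Prod.mk_add_mk, ← huv, hx, Int.cast_add, Int.cast_one]
    refine ⟨by ring, by linarith, by linarith⟩
  have h1 : ∀ u v w, G.Adj u v → p w ∈ segment ℝ (p u) (p v) → w = u ∨ w = v := by
    have key : ∀ u v w, G.Adj u v →
        ((y u = y v ∧ x v = x u + 1) ∨ y v = y u + 1) →
        p w ∈ segment ℝ (p u) (p v) → w = u ∨ w = v := by
      intro u v w huv hc hw
      rcases hc with ⟨hy, hx⟩ | hy
      · obtain ⟨h, h', h''⟩ := flat u v hy hx _ hw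
        have e : y w = y u := by have h : (y w : ℝ) = y u := h; exact_mod_cast h
        have e1 : x u ≤ x w := by have h' : (x u : ℝ) ≤ x w := h'; exact_mod_cast h'
        have e2 : x w ≤ x u + 1 := by have h'' : (x w : ℝ) ≤ x u + 1 := h''; exact_mod_cast h''
        rcases (by omega : x w = x u ∨ x w = x v) with h | h
        · exact Or.inl (hinj _ _ h e)
        · exact Or.inr (hinj _ _ h (e.trans hy))
      · rcases slant u v hy _ hw (y w) rfl with h | h
        · exact Or.inl (hp h)
        · exact Or.inr (hp h)
    intro u v w huv hw
    rcases hedge u v huv with ⟨hy, hx | hx⟩ | hy | hy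
    · exact key u v w huv (Or.inl ⟨hy, hx⟩) hw
    · exact (key v u w huv.symm (Or.inl ⟨hy.symm, hx⟩) (segment_symm ℝ (p u) (p v) ▸ hw)).symm
    · exact key u v w huv (Or.inr hy) hw
    · exact (key v u w huv.symm (Or.inr hy) (segment_symm ℝ (p u) (p v) ▸ hw)).symm
  have key2 : ∀ u v u' v', G.Adj u v → G.Adj u' v' → s(u, v) ≠ s(u', v') →
      ((y u = y v ∧ x v = x u + 1) ∨ y v = y u + 1) →
      ((y u' = y v' ∧ x v' = x u' + 1) ∨ y v' = y u' + 1) →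
      ∀ z ∈ segment ℝ (p u) (p v), z ∈ segment ℝ (p u') (p v') → ∃ w, p w = z := by
    intro u v u' v' huv huv' hne hc hc' z hz hz'
    rcases hc with ⟨hy, hx⟩ | hy <;> rcases hc' with ⟨hy', hx'⟩ | hy'
    · obtain ⟨a, a', a''⟩ := flat u v hy hx _ hz
      obtain ⟨b, b', b''⟩ := flat u' v' hy' hx' _ hz'
      have e : y u = y u' := by have := a.symm.trans b; exact_mod_cast this
      have e1 : x u ≤ x u' + 1 := by
        have : (x u : ℝ) ≤ x u' + 1 := by linarith
        exact_mod_cast this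
      have e2 : x u' ≤ x u + 1 := by
        have : (x u' : ℝ) ≤ x u + 1 := by linarith
        exact_mod_cast this
      rcases (by omega : x u' = x u + 1 ∨ x u = x u' + 1 ∨ x u = x u') with h | h | h
      · refine ⟨u', ?_⟩
        have : (x u' : ℝ) = x u + 1 := by exact_mod_cast h
        exact Prod.ext (show (x u' : ℝ) = z.1 by linarith) b.symm
      · refine ⟨u, ?_⟩
        have : (x u : ℝ) = x u' + 1 := by exact_mod_cast h
        exact Prod.ext (show (x u : ℝ) = z.1 by linarith) a.symm
      · have : u = u' := hinj _ _ h e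
        have h' : v = v' := hinj _ _ (by omega) (by omega)
        exact absurd (by rw [this, h']) hne
    · obtain ⟨a, -, -⟩ := flat u v hy hx _ hz
      rcases slant u' v' hy' _ hz' _ a with h | h <;> exact ⟨_, h.symm⟩
    · obtain ⟨a, -, -⟩ := flat u' v' hy' hx' _ hz'
      rcases slant u v hy _ hz _ a with h | h <;> exact ⟨_, h.symm⟩
    · by_cases hk : ∃ k : ℤ, z.2 = k
      · obtain ⟨k, hk⟩ := hk
        rcases slant u v hy _ hz _ hk with h | h <;> exact ⟨_, h.symm⟩
      exfalso
      obtain ⟨a, b, ha, hb, hab, rfl⟩ := hz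
      obtain ⟨a', b', ha', hb', hab', he⟩ := hz'
      have ea : a = 1 - b := by linarith
      have ea' : a' = 1 - b' := by linarith
      subst ea ea'
      simp only [p, Prod.smul_mk, smul_eq_mul, Prod.mk_add_mk, hy, hy', Int.cast_add, Int.cast_one,
        Prod.mk.injEq] at he hk
      obtain ⟨he1, he2⟩ := he
      have hb0 : 0 < b := lt_of_le_of_ne hb (fun h => hk ⟨y u, by rw [← h]; ring⟩)
      have hb1 : b < 1 := lt_of_le_of_ne (by linarith)
        (fun h => hk ⟨y u + 1, by rw [h]; push_cast; ring⟩)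
      have hyy : y u = y u' := by
        have e1 : (y u : ℝ) < y u' + 2 := by nlinarith
        have e2 : (y u' : ℝ) < y u + 1 := by nlinarith
        have e3 : (y u : ℝ) < y u' + 1 := by nlinarith
        have e2 : y u' < y u + 1 := by exact_mod_cast e2
        have e3 : y u < y u' + 1 := by exact_mod_cast e3
        omega
      have hbb : b' = b := by rw [hyy] at he2; linarith
      subst hbb
      have hlin : ((x u' : ℝ) - x u) * (1 - b') = ((x v : ℝ) - x v') * b' := by linarith
      rcases lt_trichotomy (x u) (x u') with h | h | h
      · have h3 := hcross u v u' v' huv huv' hy hy' hyy h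
        have h4 : (x u : ℝ) < x u' := by exact_mod_cast h
        have h5 : (x v : ℝ) ≤ x v' := by exact_mod_cast h3
        nlinarith
      · have e1 : u = u' := hinj _ _ h hyy
        have h4 : (x v : ℝ) = x v' := by
          rw [h, sub_self, zero_mul] at hlin
          rcases mul_eq_zero.1 hlin.symm with h | h <;> linarith
        have e2 : v = v' := hinj _ _ (by exact_mod_cast h4) (by omega)
        exact hne (by rw [e1, e2])
      · have h3 := hcross u' v' u v huv' huv hy' hy hyy.symm h
        have h4 : (x u' : ℝ) < x u := by exact_mod_cast h
        have h5 : (x v' : ℝ) ≤ x v := by exact_mod_cast h3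
        nlinarith
  refine isPlanar_of_segments p hp h1 ?_
  intro u v u' v' huv huv' hne z hz hz'
  have key3 : ∀ u' v', G.Adj u v → G.Adj u' v' → s(u, v) ≠ s(u', v') →
      ((y u' = y v' ∧ x v' = x u' + 1) ∨ y v' = y u' + 1) →
      z ∈ segment ℝ (p u') (p v') → ∃ w, p w = z := by
    intro u' v' huv huv' hne hc hz'
    have sw := segment_symm ℝ (p u) (p v)
    rcases hedge u v huv with ⟨hy, hx | hx⟩ | hy | hy
    · exact key2 u v u' v' huv huv' hne (Or.inl ⟨hy, hx⟩) hc z hz hz'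
    · exact key2 v u u' v' huv.symm huv' (Sym2.eq_swap ▸ hne) (Or.inl ⟨hy.symm, hx⟩) hc z
        (sw ▸ hz) hz'
    · exact key2 u v u' v' huv huv' hne (Or.inr hy) hc z hz hz'
    · exact key2 v u u' v' huv.symm huv' (Sym2.eq_swap ▸ hne) (Or.inr hy) hc z (sw ▸ hz) hz'
  have sw := segment_symm ℝ (p u') (p v')
  rcases hedge u' v' huv' with ⟨hy, hx | hx⟩ | hy | hy
  · exact key3 u' v' huv huv' hne (Or.inl ⟨hy, hx⟩) hz'
  · exact key3 v' u' huv huv'.symm (Sym2.eq_swap (a := u') ▸ hne) (Or.inl ⟨hy.symm, hx⟩) (sw ▸ hz')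
  · exact key3 u' v' huv huv' hne (Or.inr hy) hz'
  · exact key3 v' u' huv huv'.symm (Sym2.eq_swap (a := u') ▸ hne) (Or.inr hy) (sw ▸ hz')

/-- A triangle with a point inside it: a straight-line drawing of `K₄`. -/
def tetraPoint : Fin 4 → ℝ × ℝ := ![(0, 0), (3, 0), (0, 3), (1, 1)]

theorem isPlanar_of_equiv_fin_four {V : Type*} (G : SimpleGraph V) (f : V ≃ Fin 4) :
    IsPlanar G := by
  have fan : ∀ i j k : Fin 4, i ≠ j → i ≠ k → j ≠ k → ∀ z,
      z ∈ segment ℝ (tetraPoint i) (tetraPoint j) → z ∈ segment ℝ (tetraPoint i) (tetraPoint k) →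
      z = tetraPoint i := by
    intro i j k hij hik hjk z
    rintro ⟨a, b, ha, hb, hab, rfl⟩ ⟨a', b', ha', hb', hab', he⟩
    have ea : a = 1 - b := by linarith
    have ea' : a' = 1 - b' := by linarith
    subst ea ea'
    have hb : b = 0 := by
      fin_cases i <;> fin_cases j <;> try (exact absurd rfl hij)
      all_goals fin_cases k <;> first
        | exact absurd rfl hik
        | exact absurd rfl hjk
        | (simp [tetraPoint] at he; obtain ⟨e1, e2⟩ := he; linarith)
    simp [hb]
  have opp : ∀ i j k l : Fin 4, i ≠ j → i ≠ k → i ≠ l → j ≠ k → j ≠ l → k ≠ l → ∀ z,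
      z ∈ segment ℝ (tetraPoint i) (tetraPoint j) →
      z ∉ segment ℝ (tetraPoint k) (tetraPoint l) := by
    intro i j k l hij hik hil hjk hjl hkl z
    rintro ⟨a, b, ha, hb, hab, rfl⟩ ⟨a', b', ha', hb', hab', he⟩
    fin_cases i <;> fin_cases j <;> try (exact absurd rfl hij)
    all_goals fin_cases k <;> try first | exact absurd rfl hik | exact absurd rfl hjk
    all_goals fin_cases l <;> first
      | exact absurd rfl hil
      | exact absurd rfl hjl
      | exact absurd rfl hkl
      | (simp [tetraPoint] at he; obtain ⟨e1, e2⟩ := he; linarith)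
  have inj : ∀ i j, tetraPoint i = tetraPoint j → i = j := by
    intro i j h
    fin_cases i <;> fin_cases j <;> simp_all [tetraPoint]
  have left : ∀ i j, tetraPoint i ∈ segment ℝ (tetraPoint i) (tetraPoint j) :=
    fun i j => left_mem_segment ℝ _ _
  refine isPlanar_of_segments (fun v => tetraPoint (f v)) (fun u v h => f.injective (inj _ _ h))
    ?_ ?_
  · intro u v w huv hw
    by_contra! hne
    have a : f u ≠ f v := fun h => huv.ne (f.injective h)
    have b : f w ≠ f u := fun h => hne.1 (f.injective h)
    have c : f w ≠ f v := fun h => hne.2 (f.injective h)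
    exact b (inj _ _ (fan _ _ _ a b.symm c.symm _ hw (right_mem_segment ℝ _ _)))
  · intro u v u' v' huv huv' hne z hz hz'
    have ne : ∀ {a b}, a ≠ b → f a ≠ f b := fun h h' => h (f.injective h')
    have sw := segment_symm ℝ (tetraPoint (f u)) (tetraPoint (f v))
    have sw' := segment_symm ℝ (tetraPoint (f u')) (tetraPoint (f v'))
    by_cases h1 : u = u'
    · subst h1
      have : v ≠ v' := by rintro rfl; exact hne rfl
      exact ⟨u, (fan _ _ _ (ne huv.ne) (ne huv'.ne) (ne this) z hz hz').symm⟩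
    by_cases h2 : u = v'
    · subst h2
      have : v ≠ u' := by rintro rfl; exact hne Sym2.eq_swap
      exact ⟨u, (fan _ _ _ (ne huv.ne) (ne huv'.ne.symm) (ne this) z hz (sw' ▸ hz')).symm⟩
    by_cases h3 : v = u'
    · subst h3
      exact ⟨v, (fan _ _ _ (ne huv.ne.symm) (ne huv'.ne) (ne h2) z (sw ▸ hz) hz').symm⟩
    by_cases h4 : v = v'
    · subst h4
      exact ⟨v, (fan _ _ _ (ne huv.ne.symm) (ne huv'.ne.symm) (ne h1) z (sw ▸ hz)
        (sw' ▸ hz')).symm⟩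
    exact absurd hz' (opp _ _ _ _ (ne huv.ne) (ne h1) (ne h2) (ne h3) (ne h4) (ne huv'.ne) z hz)

/-! ### Trees from parent maps and cycles from lists -/

/-- The graph joining every vertex other than `root` to its parent. -/
def parentGraph {V : Type*} (root : V) (P : V → V) : SimpleGraph V :=
  SimpleGraph.fromRel (fun u v => u ≠ root ∧ P u = v)

theorem parentGraph_isTree {V : Type*} [Fintype V] (root : V) (P : V → V) (rank : V → ℕ)
    (h : ∀ v, v ≠ root → rank (P v) < rank v) : (parentGraph root P).IsTree := by
  classical
  have hne : ∀ v, v ≠ root → v ≠ P v := fun v hv he => by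
    have := h v hv; rw [← he] at this; exact lt_irrefl _ this
  have hconn : (parentGraph root P).Connected := by
    have : Nonempty V := ⟨root⟩
    have key : ∀ n v, rank v < n → (parentGraph root P).Reachable v root := by
      intro n
      induction n with
      | zero => intro v hv; omega
      | succ n ih =>
        intro v hv
        by_cases hr : v = root
        · subst hr; rfl
        · have h1 : (parentGraph root P).Adj v (P v) := by
            rw [parentGraph, SimpleGraph.fromRel_adj]
            exact ⟨hne v hr, Or.inl ⟨hr, rfl⟩⟩
          exact h1.reachable.trans (ih (P v) (by have := h v hr; omega))
    exact ⟨fun u v => (key _ u (Nat.lt_succ_self _)).trans (key _ v (Nat.lt_succ_self _)).symm⟩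
  rw [SimpleGraph.isTree_iff_connected_and_card]
  refine ⟨hconn, le_antisymm ?_ hconn.card_vert_le_card_edgeSet_add_one⟩
  have hsub : (parentGraph root P).edgeSet ⊆ (fun v => s(v, P v)) '' {v | v ≠ root} := by
    intro e
    induction e with
    | h u v =>
      intro he
      rw [SimpleGraph.mem_edgeSet, parentGraph, SimpleGraph.fromRel_adj] at he
      rcases he.2 with ⟨h1, rfl⟩ | ⟨h1, rfl⟩
      · exact ⟨u, h1, rfl⟩
      · exact ⟨v, h1, Sym2.eq_swap⟩
  have h1 : (parentGraph root P).edgeSet.ncard ≤ {v : V | v ≠ root}.ncard :=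
    (Set.ncard_le_ncard hsub (Set.toFinite _)).trans (Set.ncard_image_le (Set.toFinite _))
  have h2 : {v : V | v ≠ root}.ncard + 1 = Nat.card V := by
    have := Set.ncard_sdiff_singleton_add_one (s := (Set.univ : Set V)) (Set.mem_univ root)
      (Set.toFinite _)
    rw [Set.ncard_univ] at this
    rw [← this]; congr 2; ext; simp
  rw [← h2]
  exact Nat.add_le_add_right h1 1

theorem isCycleOn_map {V : Type*} {n : ℕ} (hn : 3 ≤ n) (e : Fin n ↪ V) :
    IsCycleOn ((SimpleGraph.cycleGraph n).map e) (Set.range e) := by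
  refine ⟨?_, n, hn, ⟨SimpleGraph.Iso.symm ⟨Equiv.ofInjective e e.injective, ?_⟩⟩⟩
  · intro u v h
    rw [SimpleGraph.map_adj] at h
    obtain ⟨a, b, -, rfl, rfl⟩ := h
    exact ⟨⟨a, rfl⟩, ⟨b, rfl⟩⟩
  · intro a b
    simp

/-- A relation that holds along a list and from its last to its first entry holds along the
cycle that the list describes. -/
theorem rel_of_cycle_adj {V : Type*} {R : V → V → Prop} (hsymm : ∀ u v, R u v → R v u)
    (c : List V) (e : Fin c.length ↪ V)
    (he : ∀ i, e i = c.get i) (hchain : c.IsChain R) (hne : c ≠ [])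
    (hclose : R (c.getLast hne) (c.head hne)) {u v : V}
    (h : ((SimpleGraph.cycleGraph c.length).map e).Adj u v) : R u v := by
  rw [SimpleGraph.map_adj] at h
  obtain ⟨a, b, hab, rfl, rfl⟩ := h
  rw [he, he]
  rw [SimpleGraph.cycleGraph_adj'] at hab
  rw [List.isChain_iff_getElem] at hchain
  have key : ∀ a b : Fin c.length, (b - a).val = 1 → R (c.get a) (c.get b) := by
    intro a b h
    rw [Fin.sub_def] at h
    simp only at h
    have ha := a.2
    have hb := b.2
    rcases lt_or_ge (a.1 + 1) c.length with h1 | h1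
    · have : b.1 = a.1 + 1 := by
        rcases lt_or_ge (c.length - a.1 + b.1) c.length with h2 | h2
        · rw [Nat.mod_eq_of_lt h2] at h; omega
        · rw [Nat.mod_eq_sub_mod h2, Nat.mod_eq_of_lt (by omega)] at h; omega
      have e : b = ⟨a.1 + 1, h1⟩ := Fin.ext this
      subst e
      exact hchain a.1 h1
    · have : b.1 = 0 := by
        rcases lt_or_ge (c.length - a.1 + b.1) c.length with h2 | h2
        · rw [Nat.mod_eq_of_lt h2] at h; omega
        · rw [Nat.mod_eq_sub_mod h2, Nat.mod_eq_of_lt (by omega)] at h; omega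
      have e1 : c.get a = c.getLast hne := by
        rw [List.getLast_eq_getElem]; simp only [List.get_eq_getElem]; congr 1; omega
      have e2 : c.get b = c.head hne := by
        rw [List.head_eq_getElem]; simp only [List.get_eq_getElem]; congr 1
      rw [e1, e2]; exact hclose
  rcases hab with h | h
  · exact hsymm _ _ (key b a h)
  · exact key a b h

/-! ### Strips -/

set_option maxHeartbeats 1000000 in
/-- A strip: the tree is the path `l, S, r` together with pendant edges to the vertices of `T` and
of `B`, and the cycle runs from `l` through `T` to `r` and back through `B`. -/
theorem hasSpanningHalinSubgraph_of_strip {V : Type*} [Fintype V] (G : SimpleGraph V)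
    (l r : V) (S T B : List V) (par : V → V)
    (hnd : (l :: r :: (S ++ (T ++ B))).Nodup)
    (hcov : ∀ v, v ∈ l :: r :: (S ++ (T ++ B)))
    (hS : (l :: (S ++ [r])).IsChain G.Adj)
    (hT : (l :: (T ++ [r])).IsChain G.Adj)
    (hB : (l :: (B ++ [r])).IsChain G.Adj)
    (hT0 : T ≠ []) (hB0 : B ≠ [])
    (hpar : ∀ t, t ∈ T ∨ t ∈ B → par t ∈ S ∧ G.Adj (par t) t)
    (hmonoT : T.Pairwise fun a b => ∃ i j : ℕ, S[i]? = some (par a) ∧ S[j]? = some (par b) ∧ i ≤ j)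
    (hmonoB : B.Pairwise fun a b => ∃ i j : ℕ, S[i]? = some (par a) ∧ S[j]? = some (par b) ∧ i ≤ j)
    (hdeg : ∀ s ∈ S, ∃ t, (t ∈ T ∨ t ∈ B) ∧ par t = s) :
    HasSpanningHalinSubgraph G := by
  classical
  obtain ⟨L, hLdef⟩ : ∃ L, L = l :: (S ++ [r]) := ⟨_, rfl⟩
  rw [← hLdef] at hS
  have hLn : L.Nodup := by subst hLdef; simp at hnd ⊢; grind
  have hTn : T.Nodup := by simp at hnd; grind
  have hBn : B.Nodup := by simp at hnd; grind
  have hSn : S.Nodup := by simp at hnd; grind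
  have hLT : ∀ v ∈ L, v ∉ T := by subst hLdef; simp at hnd ⊢; grind
  have hLB : ∀ v ∈ L, v ∉ B := by subst hLdef; simp at hnd ⊢; grind
  have hTB : ∀ v ∈ T, v ∉ B := by simp at hnd; grind
  have hlS : l ∉ S := by simp at hnd; grind
  have hrS : r ∉ S := by simp at hnd; grind
  have hcov' : ∀ v, v ∈ L ∨ v ∈ T ∨ v ∈ B := by
    intro v; have := hcov v; subst hLdef; simp at this ⊢; grind
  have hSL : ∀ s ∈ S, s ∈ L := by subst hLdef; simp; grind
  have hlL : l ∈ L := by simp [hLdef]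
  have hrL : r ∈ L := by simp [hLdef]
  have hLlen : L.length = S.length + 2 := by simp [hLdef]
  have hL0 : L[0]'(by omega) = l := by simp [hLdef]
  have hLS : ∀ i (h : i < S.length), L[i + 1]'(by omega) = S[i] := by
    intro i h; subst hLdef; simp [h]
  have hLr : L[S.length + 1]'(by omega) = r := by subst hLdef; simp
  have hidx : ∀ i (h : i < L.length), L.idxOf L[i] = i := fun i h => hLn.idxOf_getElem i h
  have hget : ∀ v ∈ L, ∃ i, ∃ h : i < L.length, L[i] = v := fun v hv => List.getElem_of_mem hv
  let P : V → V := fun v => if v ∈ T ∨ v ∈ B then par v else L.getD (L.idxOf v - 1) l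
  let rank : V → ℕ := fun v => if v ∈ T ∨ v ∈ B then L.length else L.idxOf v
  have hP1 : ∀ t, t ∈ T ∨ t ∈ B → P t = par t := fun t ht => if_pos ht
  have hP2 : ∀ i (h : i + 1 < L.length), P L[i + 1] = L[i] := by
    intro i h
    have hm : L[i + 1] ∈ L := List.getElem_mem h
    have : ¬ (L[i + 1] ∈ T ∨ L[i + 1] ∈ B) := by
      rintro (h1 | h1)
      · exact hLT _ hm h1
      · exact hLB _ hm h1
    simp only [P, if_neg this, hidx _ h, Nat.add_sub_cancel]
    rw [List.getD_eq_getElem]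
  have hlt : ∀ t, t ∈ T ∨ t ∈ B → t ∉ L := fun t ht h => ht.elim (hLT t h) (hLB t h)
  have hparL : ∀ t, t ∈ T ∨ t ∈ B → par t ∈ L := fun t ht => hSL _ (hpar t ht).1
  have htree : (parentGraph l P).IsTree := by
    refine parentGraph_isTree l P rank ?_
    intro v hv
    rcases hcov' v with h | h
    · obtain ⟨i, hi, rfl⟩ := hget v h
      cases i with
      | zero => exact absurd hL0 hv
      | succ i =>
        have hm : L[i] ∈ L := List.getElem_mem _
        have h1 : ¬ (L[i] ∈ T ∨ L[i] ∈ B) := fun h' => hlt _ h' hm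
        have h2 : ¬ (L[i + 1] ∈ T ∨ L[i + 1] ∈ B) := fun h' => hlt _ h' h
        simp only [hP2, rank, if_neg h1, if_neg h2, hidx]
        omega
    · have h1 : ¬ (par v ∈ T ∨ par v ∈ B) := fun h' => hlt _ h' (hparL v h)
      simp only [hP1 v h, rank, if_pos h, if_neg h1]
      exact List.idxOf_lt_length_iff.2 (hparL v h)
  -- The neighbours in the tree.
  have hadj : ∀ u v, (parentGraph l P).Adj u v ↔ u ≠ v ∧ ((u ≠ l ∧ P u = v) ∨ (v ≠ l ∧ P v = u)) :=
    fun u v => by rw [parentGraph, SimpleGraph.fromRel_adj]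
  have hTadj : ∀ u v, (parentGraph l P).Adj u v →
      (∃ i, ∃ h : i + 1 < L.length, (L[i] = u ∧ L[i + 1] = v) ∨ (L[i] = v ∧ L[i + 1] = u)) ∨
      ((u ∈ T ∨ u ∈ B) ∧ par u = v) ∨ ((v ∈ T ∨ v ∈ B) ∧ par v = u) := by
    have key : ∀ u v, u ≠ l → P u = v → (∃ i, ∃ h : i + 1 < L.length,
        (L[i] = v ∧ L[i + 1] = u)) ∨ ((u ∈ T ∨ u ∈ B) ∧ par u = v) := by
      intro u v h1 h2
      rcases hcov' u with h | h
      · obtain ⟨i, hi, rfl⟩ := hget u h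
        cases i with
        | zero => exact absurd hL0 h1
        | succ i => exact Or.inl ⟨i, hi, by rw [← h2, hP2], rfl⟩
      · exact Or.inr ⟨h, by rw [← h2, hP1 u h]⟩
    intro u v h
    rcases ((hadj u v).1 h).2 with ⟨h1, h2⟩ | ⟨h1, h2⟩
    · rcases key u v h1 h2 with ⟨i, hi, h⟩ | h
      · exact Or.inl ⟨i, hi, Or.inr h⟩
      · exact Or.inr (Or.inl h)
    · rcases key v u h1 h2 with ⟨i, hi, h⟩ | h
      · exact Or.inl ⟨i, hi, Or.inl h⟩
      · exact Or.inr (Or.inr h)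
  have hpathadj : ∀ i (h : i + 1 < L.length), (parentGraph l P).Adj L[i] L[i + 1] := by
    intro i h
    rw [hadj]
    refine ⟨fun e => ?_, Or.inr ⟨fun e => ?_, hP2 i h⟩⟩
    · have := hLn.getElem_inj_iff.1 e; omega
    · have := hLn.getElem_inj_iff.1 (e.trans hL0.symm); omega
  have hpend : ∀ t, t ∈ T ∨ t ∈ B → (parentGraph l P).Adj t (par t) := by
    intro t ht
    rw [hadj]
    refine ⟨fun e => hlt t ht (e ▸ hparL t ht), Or.inl ⟨?_, hP1 t ht⟩⟩
    rintro rfl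
    exact hlt _ ht hlL
  have hnb_pend : ∀ t, t ∈ T ∨ t ∈ B → (parentGraph l P).neighborSet t = {par t} := by
    intro t ht
    ext w
    simp only [SimpleGraph.mem_neighborSet, Set.mem_singleton_iff]
    constructor
    · intro h
      rcases hTadj t w h with ⟨i, hi, h⟩ | h | h
      · exfalso
        rcases h with ⟨h, -⟩ | ⟨-, h⟩
        · exact hlt t ht (h ▸ List.getElem_mem _)
        · exact hlt t ht (h ▸ List.getElem_mem _)
      · exact h.2.symm
      · exact absurd (h.2 ▸ hparL w h.1) (hlt t ht)
    · rintro rfl; exact hpend t ht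
  have hparlr : ∀ t, t ∈ T ∨ t ∈ B → par t ≠ l ∧ par t ≠ r := by
    intro t ht
    have := (hpar t ht).1
    exact ⟨fun h => hlS (h ▸ this), fun h => hrS (h ▸ this)⟩
  have hnb_l : (parentGraph l P).neighborSet l = {L[1]} := by
    ext w
    simp only [SimpleGraph.mem_neighborSet, Set.mem_singleton_iff]
    constructor
    · intro h
      rcases hTadj l w h with ⟨i, hi, h⟩ | h | h
      · rcases h with ⟨h, h'⟩ | ⟨-, h⟩
        · have := hLn.getElem_inj_iff.1 (h.trans hL0.symm)
          subst this; exact h'.symm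
        · have := hLn.getElem_inj_iff.1 (h.trans hL0.symm)
          omega
      · exact absurd hlL (hlt l h.1)
      · exact absurd h.2 (hparlr w h.1).1
    · rintro rfl
      have := hpathadj 0 (by omega)
      rwa [hL0] at this
  have hnb_r : (parentGraph l P).neighborSet r = {L[S.length]} := by
    ext w
    simp only [SimpleGraph.mem_neighborSet, Set.mem_singleton_iff]
    constructor
    · intro h
      rcases hTadj r w h with ⟨i, hi, h⟩ | h | h
      · rcases h with ⟨h, h'⟩ | ⟨h', h⟩
        · have := hLn.getElem_inj_iff.1 (h.trans hLr.symm)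
          omega
        · have := hLn.getElem_inj_iff.1 (h.trans hLr.symm)
          have : i = S.length := by omega
          subst this; exact h'.symm
      · exact absurd hrL (hlt r h.1)
      · exact absurd h.2 (hparlr w h.1).2
    · rintro rfl
      have := hpathadj S.length (by omega)
      rw [hLr] at this
      exact this.symm
  have hnb_S : ∀ s ∈ S, 3 ≤ ((parentGraph l P).neighborSet s).encard := by
    intro s hs
    obtain ⟨i, hi, rfl⟩ := List.getElem_of_mem hs
    obtain ⟨t, ht, hts⟩ := hdeg _ hs
    have h1 := hpathadj i (by omega)
    have h2 := hpathadj (i + 1) (by omega)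
    rw [hLS i hi] at h1 h2
    have h3 : ({L[i], L[i + 1 + 1], t} : Set V) ⊆ (parentGraph l P).neighborSet S[i] := by
      rintro w (rfl | rfl | rfl)
      · exact h1.symm
      · exact h2
      · exact hts ▸ (hpend _ ht).symm
    refine le_trans (le_of_eq ?_) (Set.encard_le_encard h3)
    rw [Set.encard_insert_of_notMem, Set.encard_pair]
    · norm_num
    · intro h; exact hlt t ht (h ▸ List.getElem_mem _)
    · rintro (h | h)
      · have := hLn.getElem_inj_iff.1 h; omega
      · exact hlt t ht (h ▸ List.getElem_mem _)
  obtain ⟨c, hcdef⟩ : ∃ c, c = (l :: T) ++ (r :: B.reverse) := ⟨_, rfl⟩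
  have hcn : c.Nodup := by subst hcdef; simp [List.nodup_append] at hnd ⊢; grind
  have hleaves : leaves (parentGraph l P) = Set.range c.get := by
    have hc : ∀ v, v ∈ Set.range c.get ↔ v = l ∨ v = r ∨ v ∈ T ∨ v ∈ B := by
      clear * - hcdef
      intro v
      rw [Set.range_list_get]
      simp [hcdef]
      tauto
    ext v
    rw [hc, leaves, Set.mem_ofPred_eq]
    constructor
    · intro h
      have := hcov v
      simp at this
      rcases this with h1 | h1 | h1 | h1
      · exact Or.inl h1
      · exact Or.inr (Or.inl h1)
      · have := hnb_S v h1
        rw [h] at this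
        norm_num at this
      · exact Or.inr (Or.inr h1)
    · rintro (rfl | rfl | h)
      · rw [hnb_l, Set.encard_singleton]
      · rw [hnb_r, Set.encard_singleton]
      · rw [hnb_pend v h, Set.encard_singleton]
  have hcne : c ≠ [] := by simp [hcdef]
  have hclen : 3 ≤ c.length := by
    have := List.length_pos_of_ne_nil hT0
    simp [hcdef]; omega
  -- Coordinates of a drawing in three rows.
  let x : V → ℤ := fun v =>
    if v ∈ T then T.idxOf v else if v ∈ B then B.idxOf v else L.idxOf v
  let y : V → ℤ := fun v => if v ∈ T then 1 else if v ∈ B then -1 else 0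
  have hxT : ∀ v ∈ T, x v = T.idxOf v ∧ y v = 1 := fun v h => by simp [x, y, h]
  have hxB : ∀ v ∈ B, x v = B.idxOf v ∧ y v = -1 := fun v h => by
    have : v ∉ T := fun h' => hTB v h' h
    simp [x, y, h, this]
  have hxL : ∀ v ∈ L, x v = L.idxOf v ∧ y v = 0 := fun v h => by
    simp [x, y, hLT v h, hLB v h]
  -- `Slant W t w`: the slanted edges between the row `W` and the middle row.
  let Slant : List V → V → V → Prop := fun W t w => t ∈ W ∧ w ∈ L ∧
    (w = par t ∨ (w = l ∧ W.idxOf t = 0) ∨ (w = r ∧ W.idxOf t + 1 = W.length))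
  have hslant : ∀ W : List V, (∀ t ∈ W, t ∈ T ∨ t ∈ B) → W.Nodup →
      (W.Pairwise fun a b => ∃ i j : ℕ, S[i]? = some (par a) ∧ S[j]? = some (par b) ∧ i ≤ j) →
      ∀ t w t' w', Slant W t w → Slant W t' w' → W.idxOf t < W.idxOf t' →
      L.idxOf w ≤ L.idxOf w' := by
    rintro W hW hWn hmono t w t' w' ⟨ht, hw, h⟩ ⟨ht', hw', h'⟩ hlt'
    have hl0 : L.idxOf l = 0 := by rw [← hL0]; exact hidx 0 _
    have hr0 : L.idxOf r = S.length + 1 := by rw [← hLr]; exact hidx _ _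
    have hwlt := List.idxOf_lt_length_iff.2 hw
    have hwlt' := List.idxOf_lt_length_iff.2 hw'
    have htlt := List.idxOf_lt_length_iff.2 ht
    have htlt' := List.idxOf_lt_length_iff.2 ht'
    rcases h with rfl | ⟨rfl, h⟩ | ⟨rfl, h⟩
    · rcases h' with rfl | ⟨rfl, h'⟩ | ⟨rfl, h'⟩
      · obtain ⟨i, j, hi, hj, hij⟩ := List.pairwise_iff_getElem.1 hmono _ _ htlt htlt' hlt'
        rw [List.getElem_idxOf] at hi hj
        obtain ⟨hi1, hi2⟩ := List.getElem?_eq_some_iff.1 hi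
        obtain ⟨hj1, hj2⟩ := List.getElem?_eq_some_iff.1 hj
        rw [← hi2, ← hj2, ← hLS i hi1, ← hLS j hj1, hidx, hidx]
        omega
      · omega
      · omega
    · omega
    · omega
  let E : V → V → Prop := fun u v => (y u = y v ∧ x v = x u + 1) ∨ Slant T u v ∨ Slant B u v
  let R : V → V → Prop := fun u v => G.Adj u v ∧ (E u v ∨ E v u)
  have hRsymm : ∀ u v, R u v → R v u := fun u v h => ⟨h.1.symm, h.2.symm⟩
  have hRrow : ∀ W : List V, (W = T ∨ W = B) → (l :: (W ++ [r])).IsChain R := by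
    intro W hW
    have hWn : W.Nodup := by rcases hW with rfl | rfl <;> assumption
    have hWadj : (l :: (W ++ [r])).IsChain G.Adj := by rcases hW with rfl | rfl <;> assumption
    have hW0 : W ≠ [] := by rcases hW with rfl | rfl <;> assumption
    have hSl : ∀ t w, Slant W t w → E t w := by
      intro t w h
      rcases hW with rfl | rfl
      · exact Or.inr (Or.inl h)
      · exact Or.inr (Or.inr h)
    rw [List.isChain_iff_getElem] at hWadj ⊢
    intro i hi
    refine ⟨hWadj i hi, ?_⟩
    have hlen : 0 < W.length := List.length_pos_of_ne_nil hW0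
    simp only [List.length_cons, List.length_append, List.length_nil] at hi
    cases i with
    | zero =>
      right
      apply hSl
      have : (l :: (W ++ [r]))[0 + 1] = W[0] := by simp [hlen]
      rw [this]
      exact ⟨List.getElem_mem _, hlL, Or.inr (Or.inl ⟨rfl, hWn.idxOf_getElem 0 _⟩)⟩
    | succ i =>
      have e1 : (l :: (W ++ [r]))[i + 1] = W[i] := by
        have : i < W.length := by omega
        simp [this]
      rw [e1]
      rcases lt_or_ge (i + 1) W.length with h | h
      · have e2 : (l :: (W ++ [r]))[i + 1 + 1] = W[i + 1] := by
          simp [h]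
        rw [e2]
        left; left
        have m1 : W[i] ∈ W := List.getElem_mem _
        have m2 : W[i + 1] ∈ W := List.getElem_mem _
        have i1 := hWn.idxOf_getElem i (by omega)
        have i2 := hWn.idxOf_getElem (i + 1) h
        rcases hW with rfl | rfl
        · rw [(hxT _ m1).1, (hxT _ m2).1, (hxT _ m1).2, (hxT _ m2).2, i1, i2]
          exact ⟨rfl, by push_cast; ring⟩
        · rw [(hxB _ m1).1, (hxB _ m2).1, (hxB _ m1).2, (hxB _ m2).2, i1, i2]
          exact ⟨rfl, by push_cast; ring⟩
      · have e2 : (l :: (W ++ [r]))[i + 1 + 1] = r := by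
          have : i + 1 = W.length := by omega
          simp [this]
        rw [e2]
        left
        apply hSl
        refine ⟨List.getElem_mem _, hrL, Or.inr (Or.inr ⟨rfl, ?_⟩)⟩
        rw [hWn.idxOf_getElem]; omega
  have hcR : c.IsChain R := by
    have h1 := hRrow T (Or.inl rfl)
    have h2 := hRrow B (Or.inr rfl)
    rw [← List.cons_append] at h1
    have h2' : (r :: B.reverse).IsChain R := by
      have : (B ++ [r]).reverse = r :: B.reverse := by simp
      rw [← this, List.isChain_reverse]
      exact h2.tail.imp (fun _ _ h => hRsymm _ _ h)
    rw [hcdef]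
    refine h1.left_of_append.append h2' ?_
    intro u hu v hv
    simp at hv
    subst hv
    exact (List.isChain_append.1 h1).2.2 u hu r (by simp)
  have hclose : R (c.getLast hcne) (c.head hcne) := by
    have h2 := hRrow B (Or.inr rfl)
    have : c.head hcne = l := by simp [hcdef]
    rw [this]
    apply hRsymm
    have e : c.getLast hcne = B.head hB0 := by
      subst hcdef
      simp [List.getLast_cons, hB0]
    rw [e]
    have := h2.rel_head? (y := B.head hB0)
    apply this
    cases B with
    | nil => exact absurd rfl hB0
    | cons b B => simp
  let e : Fin c.length ↪ V := ⟨c.get, List.nodup_iff_injective_get.1 hcn⟩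
  have hcycle := fun u v =>
    rel_of_cycle_adj hRsymm c e (fun _ => rfl) hcR hcne hclose (u := u) (v := v)
  have hTR : ∀ u v, (parentGraph l P).Adj u v → R u v := by
    intro u v h
    have hp : ∀ t, t ∈ T ∨ t ∈ B → R t (par t) := by
      intro t ht
      refine ⟨(hpar t ht).2.symm, Or.inl ?_⟩
      rcases ht with ht | ht
      · exact Or.inr (Or.inl ⟨ht, hparL t (Or.inl ht), Or.inl rfl⟩)
      · exact Or.inr (Or.inr ⟨ht, hparL t (Or.inr ht), Or.inl rfl⟩)
    have hq : ∀ i (h : i + 1 < L.length), R L[i] L[i + 1] := by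
      intro i h
      refine ⟨hS.getElem i h, Or.inl (Or.inl ?_)⟩
      have m1 := hxL L[i] (List.getElem_mem _)
      have m2 := hxL L[i + 1] (List.getElem_mem _)
      rw [m1.1, m1.2, m2.1, m2.2, hidx, hidx]
      exact ⟨rfl, by push_cast; ring⟩
    rcases hTadj u v h with ⟨i, hi, ⟨rfl, rfl⟩ | ⟨rfl, rfl⟩⟩ | ⟨h1, rfl⟩ | ⟨h1, rfl⟩
    · exact hq i hi
    · exact hRsymm _ _ (hq i hi)
    · exact hp u h1
    · exact hRsymm _ _ (hp v h1)
  obtain ⟨C, hC⟩ : ∃ C, C = (SimpleGraph.cycleGraph c.length).map e := ⟨_, rfl⟩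
  have hHR : ∀ u v, (parentGraph l P ⊔ C).Adj u v → R u v := by
    intro u v h
    rcases h with h | h
    · exact hTR u v h
    · subst hC; exact hcycle u v h
  refine ⟨parentGraph l P ⊔ C, fun u v h => (hHR u v h).1, ?_, parentGraph l P, C, rfl, htree,
    ?_, ?_⟩
  · refine isPlanar_of_layers x y ?_ ?_ ?_
    · intro u v hx hy
      have hinj : ∀ W : List V, u ∈ W → v ∈ W → (W.idxOf u : ℤ) = W.idxOf v → u = v :=
        fun W hu hv h => (List.idxOf_inj hu).1 (by exact_mod_cast h)
      rcases hcov' u with hu | hu | hu <;> rcases hcov' v with hv | hv | hv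
      all_goals first
        | (rw [(hxL u hu).2] at hy; rw [(hxL u hu).1] at hx)
        | (rw [(hxT u hu).2] at hy; rw [(hxT u hu).1] at hx)
        | (rw [(hxB u hu).2] at hy; rw [(hxB u hu).1] at hx)
      all_goals first
        | (rw [(hxL v hv).2] at hy; rw [(hxL v hv).1] at hx)
        | (rw [(hxT v hv).2] at hy; rw [(hxT v hv).1] at hx)
        | (rw [(hxB v hv).2] at hy; rw [(hxB v hv).1] at hx)
      all_goals first
        | (exfalso; omega)
        | exact hinj _ hu hv hx
    · intro u v h
      rcases (hHR u v h).2 with h | h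
      · rcases h with ⟨h1, h2⟩ | h | h
        · exact Or.inl ⟨h1, Or.inl h2⟩
        · have := (hxT u h.1).2; have := (hxL v h.2.1).2; omega
        · have := (hxB u h.1).2; have := (hxL v h.2.1).2; omega
      · rcases h with ⟨h1, h2⟩ | h | h
        · exact Or.inl ⟨h1.symm, Or.inr h2⟩
        · have := (hxT v h.1).2; have := (hxL u h.2.1).2; omega
        · have := (hxB v h.1).2; have := (hxL u h.2.1).2; omega
    · have hup : ∀ u v, (parentGraph l P ⊔ C).Adj u v → y v = y u + 1 →
          (y u = 0 ∧ Slant T v u) ∨ (y u = -1 ∧ Slant B u v) := by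
        intro u v h hy
        rcases (hHR u v h).2 with h | h
        · rcases h with ⟨h1, h2⟩ | h | h
          · omega
          · have := (hxT u h.1).2; have := (hxL v h.2.1).2; omega
          · exact Or.inr ⟨(hxB u h.1).2, h⟩
        · rcases h with ⟨h1, h2⟩ | h | h
          · omega
          · exact Or.inl ⟨(hxL u h.2.1).2, h⟩
          · have := (hxB v h.1).2; have := (hxL u h.2.1).2; omega
      intro u v u' v' h h' hy hy' hyy hx
      rcases hup u v h hy with ⟨h0, h1⟩ | ⟨h0, h1⟩ <;>
        rcases hup u' v' h' hy' with ⟨h0', h1'⟩ | ⟨h0', h1'⟩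
      · rw [(hxT v h1.1).1, (hxT v' h1'.1).1]
        rw [(hxL u h1.2.1).1, (hxL u' h1'.2.1).1] at hx
        by_contra hlt'
        have := hslant T (fun t => Or.inl) hTn hmonoT _ _ _ _ h1' h1 (by omega)
        omega
      · omega
      · omega
      · rw [(hxL v h1.2.1).1, (hxL v' h1'.2.1).1]
        rw [(hxB u h1.1).1, (hxB u' h1'.1).1] at hx
        have := hslant B (fun t => Or.inr) hBn hmonoB _ _ _ _ h1 h1' (by omega)
        omega
  · intro v h
    have h1 : ((parentGraph l P).neighborSet v).encard = 1 ∨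
        3 ≤ ((parentGraph l P).neighborSet v).encard := by
      have := hcov v
      simp at this
      rcases this with rfl | rfl | h1 | h1
      · left; rw [hnb_l, Set.encard_singleton]
      · left; rw [hnb_r, Set.encard_singleton]
      · exact Or.inr (hnb_S v h1)
      · left; rw [hnb_pend v h1, Set.encard_singleton]
    rw [h] at h1
    norm_num at h1
  · rw [hleaves, hC]
    exact isCycleOn_map hclen e

/-- A strip given spine vertex by spine vertex: each entry of `bl` lists a spine vertex, its
pendant vertices on one side of the spine and those on the other side. -/
theorem hasSpanningHalinSubgraph_of_blocks {V : Type*} [Fintype V] (G : SimpleGraph V)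
    (l r : V) (bl : List (V × List V × List V))
    (hnd : (l :: r :: (bl.map (·.1) ++ (bl.flatMap (·.2.1) ++ bl.flatMap (·.2.2)))).Nodup)
    (hcov : ∀ v, v ∈ l :: r :: (bl.map (·.1) ++ (bl.flatMap (·.2.1) ++ bl.flatMap (·.2.2))))
    (hS : (l :: (bl.map (·.1) ++ [r])).IsChain G.Adj)
    (hT : (l :: (bl.flatMap (·.2.1) ++ [r])).IsChain G.Adj)
    (hB : (l :: (bl.flatMap (·.2.2) ++ [r])).IsChain G.Adj)
    (hT0 : bl.flatMap (·.2.1) ≠ []) (hB0 : bl.flatMap (·.2.2) ≠ [])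
    (hadj : ∀ b ∈ bl, ∀ t, t ∈ b.2.1 ∨ t ∈ b.2.2 → G.Adj b.1 t)
    (hdeg : ∀ b ∈ bl, b.2.1 ≠ [] ∨ b.2.2 ≠ []) :
    HasSpanningHalinSubgraph G := by
  classical
  have hex : ∀ bl : List (V × List V × List V),
      (bl.flatMap (·.2.1) ++ bl.flatMap (·.2.2)).Nodup →
      ∃ par : V → V, ∀ b ∈ bl, ∀ t, t ∈ b.2.1 ∨ t ∈ b.2.2 → par t = b.1 := by
    intro bl
    induction bl with
    | nil => exact fun _ => ⟨fun _ => l, by simp⟩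
    | cons b bl ih =>
      intro h
      have h' : (bl.flatMap (·.2.1) ++ bl.flatMap (·.2.2)).Nodup := by
        refine h.sublist ?_
        simp only [List.flatMap_cons]
        exact (List.sublist_append_right _ _).append (List.sublist_append_right _ _)
      obtain ⟨par, hpar⟩ := ih h'
      refine ⟨fun t => if t ∈ b.2.1 ∨ t ∈ b.2.2 then b.1 else par t, ?_⟩
      intro b' hb' t ht
      rcases List.mem_cons.1 hb' with rfl | hb'
      · exact if_pos ht
      · have : ¬ (t ∈ b.2.1 ∨ t ∈ b.2.2) := by
          have hm : t ∈ bl.flatMap (·.2.1) ∨ t ∈ bl.flatMap (·.2.2) := by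
            rcases ht with ht | ht
            · exact Or.inl (List.mem_flatMap.2 ⟨b', hb', ht⟩)
            · exact Or.inr (List.mem_flatMap.2 ⟨b', hb', ht⟩)
          clear * - h hm
          simp only [List.flatMap_cons] at h
          grind
        simp only [if_neg this]
        exact hpar b' hb' t ht
  have hnd' : (bl.flatMap (·.2.1) ++ bl.flatMap (·.2.2)).Nodup := by
    refine hnd.sublist ?_
    exact ((List.sublist_append_right _ _).cons _).cons _
  obtain ⟨par, hpar⟩ := hex bl hnd'
  have hmem : ∀ t, t ∈ bl.flatMap (·.2.1) ∨ t ∈ bl.flatMap (·.2.2) →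
      ∃ b ∈ bl, t ∈ b.2.1 ∨ t ∈ b.2.2 := by
    rintro t (h | h) <;> obtain ⟨b, hb, h⟩ := List.mem_flatMap.1 h
    · exact ⟨b, hb, Or.inl h⟩
    · exact ⟨b, hb, Or.inr h⟩
  have hmono : ∀ f : V × List V × List V → List V,
      (∀ b t, t ∈ f b → t ∈ b.2.1 ∨ t ∈ b.2.2) →
      (bl.flatMap f).Pairwise fun a b => ∃ i j : ℕ, (bl.map (·.1))[i]? = some (par a) ∧
        (bl.map (·.1))[j]? = some (par b) ∧ i ≤ j := by
    intro f hf
    rw [List.pairwise_flatMap]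
    constructor
    · intro b hb
      obtain ⟨i, hi, rfl⟩ := List.getElem_of_mem hb
      refine List.pairwise_iff_forall_sublist.2 ?_
      intro u v huv
      have hu : u ∈ f bl[i] := huv.subset (by simp)
      have hv : v ∈ f bl[i] := huv.subset (by simp)
      refine ⟨i, i, ?_, ?_, le_rfl⟩
      · rw [hpar _ hb u (hf _ _ hu)]; simp [List.getElem?_eq_getElem hi]
      · rw [hpar _ hb v (hf _ _ hv)]; simp [List.getElem?_eq_getElem hi]
    · rw [List.pairwise_iff_getElem]
      intro i j hi hj hij u hu v hv
      refine ⟨i, j, ?_, ?_, hij.le⟩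
      · rw [hpar _ (List.getElem_mem hi) u (hf _ _ hu)]; simp [List.getElem?_eq_getElem hi]
      · rw [hpar _ (List.getElem_mem hj) v (hf _ _ hv)]; simp [List.getElem?_eq_getElem hj]
  refine hasSpanningHalinSubgraph_of_strip G l r (bl.map (·.1)) (bl.flatMap (·.2.1))
    (bl.flatMap (·.2.2)) par hnd hcov hS hT hB hT0 hB0 ?_ (hmono _ fun _ _ => Or.inl)
    (hmono _ fun _ _ => Or.inr) ?_
  · intro t ht
    obtain ⟨b, hb, h⟩ := hmem t ht
    rw [hpar b hb t h]
    exact ⟨List.mem_map_of_mem hb, hadj b hb t h⟩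
  · intro s hs
    obtain ⟨b, hb, rfl⟩ := List.mem_map.1 hs
    rcases hdeg b hb with h | h
    · obtain ⟨t, ht⟩ := List.exists_mem_of_ne_nil _ h
      exact ⟨t, Or.inl (List.mem_flatMap.2 ⟨b, hb, ht⟩), hpar b hb t (Or.inl ht)⟩
    · obtain ⟨t, ht⟩ := List.exists_mem_of_ne_nil _ h
      exact ⟨t, Or.inr (List.mem_flatMap.2 ⟨b, hb, ht⟩), hpar b hb t (Or.inr ht)⟩

/-! ### Complete graphs -/

/-- `K₄` is a Halin graph: a star with three leaves and the triangle on them. -/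
theorem hasSpanningHalinSubgraph_of_card_four {V : Type*} [Fintype V] (G : SimpleGraph V)
    (hV : Fintype.card V = 4) (hG : ∀ u v, u ≠ v → G.Adj u v) : HasSpanningHalinSubgraph G := by
  classical
  let f : V ≃ Fin 4 := Fintype.equivFinOfCardEq hV
  let s := f.symm 3
  let e : Fin 3 ↪ V := ⟨fun i => f.symm i.castSucc, fun i j h => by
    have := f.symm.injective h
    exact Fin.castSucc_injective _ this⟩
  have hs : ∀ v, v ≠ s ↔ v ∈ Set.range e := by
    intro v
    obtain ⟨i, rfl⟩ := f.symm.surjective v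
    change f.symm i ≠ f.symm 3 ↔ ∃ j : Fin 3, f.symm j.castSucc = f.symm i
    simp only [f.symm.injective.ne_iff, f.symm.injective.eq_iff]
    revert i; decide
  have hadj : ∀ u v, (parentGraph s fun _ => s).Adj u v ↔ u ≠ v ∧ (u = s ∨ v = s) := by
    intro u v
    rw [parentGraph, SimpleGraph.fromRel_adj]
    constructor
    · rintro ⟨h, ⟨-, h'⟩ | ⟨-, h'⟩⟩
      · exact ⟨h, Or.inr h'.symm⟩
      · exact ⟨h, Or.inl h'.symm⟩
    · rintro ⟨h, rfl | rfl⟩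
      · exact ⟨h, Or.inr ⟨h.symm, rfl⟩⟩
      · exact ⟨h, Or.inl ⟨h, rfl⟩⟩
  have h1 : ∀ v, v ≠ s → (parentGraph s fun _ => s).neighborSet v = {s} := by
    intro v hv
    ext w
    simp only [SimpleGraph.mem_neighborSet, hadj, Set.mem_singleton_iff]
    constructor
    · rintro ⟨-, h | h⟩
      · exact absurd h hv
      · exact h
    · rintro rfl; exact ⟨hv, Or.inr rfl⟩
  have h2 : ((parentGraph s fun _ => s).neighborSet s).encard = 3 := by
    have : (parentGraph s fun _ => s).neighborSet s = Set.range e := by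
      ext w
      rw [← hs, SimpleGraph.mem_neighborSet, hadj]
      exact ⟨fun h => h.1.symm, fun h => ⟨h.symm, Or.inl rfl⟩⟩
    rw [this, ← Set.image_univ, e.injective.encard_image, Set.encard_univ]
    simp
  refine ⟨(parentGraph s fun _ => s) ⊔ (SimpleGraph.cycleGraph 3).map e, ?_,
    isPlanar_of_equiv_fin_four _ f, _, _, rfl,
    parentGraph_isTree s _ (fun v => if v = s then 0 else 1) ?_, ?_, ?_⟩
  · intro u v h
    exact hG u v h.ne
  · intro v hv
    simp [hv]
  · intro v
    by_cases hv : v = s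
    · rw [hv, h2]; norm_num
    · rw [h1 v hv, Set.encard_singleton]; norm_num
  · have : leaves (parentGraph s fun _ => s) = Set.range e := by
      ext v
      rw [← hs, leaves, Set.mem_ofPred_eq]
      by_cases hv : v = s
      · rw [hv, h2]; norm_num
      · rw [h1 v hv, Set.encard_singleton]; simp [hv]
    rw [this]
    exact isCycleOn_map le_rfl e

/-- A vertex joined to all others together with a Hamiltonian cycle `a, b, c, B` of the rest is a
spanning wheel. -/
theorem hasSpanningHalinSubgraph_of_wheel {V : Type*} [Fintype V] (G : SimpleGraph V)
    (s a b c : V) (B : List V) (hnd : (a :: c :: s :: b :: B).Nodup)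
    (hcov : ∀ v, v ∈ a :: c :: s :: b :: B) (hs : ∀ v, v ≠ s → G.Adj s v)
    (hab : G.Adj a b) (hbc : G.Adj b c) (hB : (a :: (B ++ [c])).IsChain G.Adj) (hB0 : B ≠ []) :
    HasSpanningHalinSubgraph G := by
  have hne : ∀ t, t ∈ [a, b, c] ∨ t ∈ B → t ≠ s := by
    simp at hnd ⊢; grind
  refine hasSpanningHalinSubgraph_of_blocks G a c [(s, [b], B)] (by simpa using hnd)
    (by simpa using hcov) ?_ ?_ (by simpa using hB) (by simp) (by simpa using hB0) ?_ (by simp)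
  · simp [(hs a (hne a (by simp))).symm, hs c (hne c (by simp))]
  · simp [hab, hbc]
  · simp only [List.mem_singleton, forall_eq]
    intro t ht
    rcases ht with rfl | ht
    · exact hs t (hne t (by simp))
    · exact hs t (hne t (Or.inr ht))

theorem hasSpanningHalinSubgraph_of_complete {V : Type*} [Fintype V] (G : SimpleGraph V)
    (hV : 3 < Fintype.card V) (hG : ∀ u v, u ≠ v → G.Adj u v) : HasSpanningHalinSubgraph G := by
  classical
  by_cases h4 : Fintype.card V = 4
  · exact hasSpanningHalinSubgraph_of_card_four G h4 hG
  obtain ⟨L, hL⟩ : ∃ L, L = (Finset.univ : Finset V).toList := ⟨_, rfl⟩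
  have hlen : L.length = Fintype.card V := by simp [hL]
  have hn : L.Nodup := by rw [hL]; exact Finset.nodup_toList _
  have hm : ∀ v, v ∈ L := by simp [hL]
  obtain ⟨a, c, s, b, d, B, rfl⟩ : ∃ a c s b d B, L = a :: c :: s :: b :: d :: B := by
    match L, hlen with
    | [], h => simp at h; omega
    | [_], h => simp at h; omega
    | [_, _], h => simp at h; omega
    | [_, _, _], h => simp at h; omega
    | [_, _, _, _], h => simp at h; omega
    | a :: c :: s :: b :: d :: B, _ => exact ⟨a, c, s, b, d, B, rfl⟩
  refine hasSpanningHalinSubgraph_of_wheel G s a b c (d :: B) hn hm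
    (fun v hv => hG _ _ hv.symm) (hG _ _ ?_) (hG _ _ ?_) ?_ (by simp)
  · simp at hn; grind
  · simp at hn; grind
  · have : (a :: (d :: B ++ [c])).Nodup := by simp at hn ⊢; grind
    exact List.Pairwise.isChain (this.imp fun h => hG _ _ h)

/-! ### Connectivity and Hamiltonian paths -/

/-- Deleting two vertices `y`, `z` from a 3-connected graph leaves an edge between the two sides
of any nontrivial bipartition. -/
theorem IsKConnected.exists_adj_across {V : Type*} [Fintype V] {G : SimpleGraph V}
    (hG : IsKConnected 3 G) (A : Set V) {y z a b : V} (ha : a ∈ A) (hay : a ≠ y) (haz : a ≠ z)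
    (hb : b ∉ A) (hby : b ≠ y) (hbz : b ≠ z) :
    ∃ u v, u ∈ A ∧ v ∉ A ∧ u ≠ y ∧ u ≠ z ∧ v ≠ y ∧ v ≠ z ∧ G.Adj u v := by
  classical
  have hc := hG.2 {y, z} (lt_of_le_of_lt Finset.card_le_two (by norm_num))
  have hr : ∀ a' b' : ↥((({y, z} : Finset V) : Set V)ᶜ),
      (G.induce _).Reachable a' b' → a'.1 ∈ A → b'.1 ∉ A →
      ∃ u v, u ∈ A ∧ v ∉ A ∧ u ≠ y ∧ u ≠ z ∧ v ≠ y ∧ v ≠ z ∧ G.Adj u v := by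
    rintro a' b' ⟨w⟩
    induction w with
    | nil => exact fun h h' => absurd h h'
    | @cons u v w h p ih =>
      intro hu hw
      by_cases hv : v.1 ∈ A
      · exact ih hv hw
      · have h1 := u.2
        have h2 := v.2
        simp at h1 h2
        exact ⟨u, v, hu, hv, h1.1, h1.2, h2.1, h2.2, h⟩
  exact hr ⟨a, by simp [hay, haz]⟩ ⟨b, by simp [hby, hbz]⟩ (hc.preconnected _ _) ha hb

/-- No three vertices are pairwise nonadjacent. -/
def NoIndepTriple {V : Type*} (G : SimpleGraph V) : Prop :=
  ∀ a b c : V, a ≠ b → a ≠ c → b ≠ c → G.Adj a b ∨ G.Adj a c ∨ G.Adj b c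

/-- `L` lists the vertices of a Hamiltonian path of the subgraph induced on `A`. -/
def IsHamPath {V : Type*} (G : SimpleGraph V) (A : Set V) (L : List V) : Prop :=
  L.Nodup ∧ (∀ v, v ∈ L ↔ v ∈ A) ∧ L.IsChain G.Adj

section

variable {V : Type*} {G : SimpleGraph V} {A : Set V}

theorem isChain_adj_reverse {L : List V} (h : L.IsChain G.Adj) : L.reverse.IsChain G.Adj := by
  rw [List.isChain_reverse]
  exact h.imp fun _ _ h => h.symm

theorem IsHamPath.reverse {L : List V} (h : IsHamPath G A L) : IsHamPath G A L.reverse :=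
  ⟨List.nodup_reverse.2 h.1, fun v => by rw [List.mem_reverse, h.2.1],
    isChain_adj_reverse h.2.2⟩

theorem IsHamPath.perm {L L' : List V} (h : IsHamPath G A L) (hp : L.Perm L')
    (hc : L'.IsChain G.Adj) : IsHamPath G A L' :=
  ⟨hp.nodup_iff.1 h.1, fun v => by rw [← hp.mem_iff, h.2.1], hc⟩

theorem isChain_of_clique {L : List V} (hn : L.Nodup)
    (h : ∀ u ∈ L, ∀ v ∈ L, u ≠ v → G.Adj u v) : L.IsChain G.Adj := by
  refine List.Pairwise.isChain ?_
  exact hn.imp_of_mem fun hu hv hne => h _ hu _ hv hne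

/-- Without independent triples, a set of vertices either has a Hamiltonian path or falls apart
into two nonempty parts with no edge between them: a longest path has adjacent ends, so that no
edge can leave it. -/
theorem exists_isHamPath_or_split [Fintype V] (hα : NoIndepTriple G) (hA : A.Nonempty) :
    (∃ L, IsHamPath G A L) ∨ ∃ N₁ N₂ : Set V, N₁.Nonempty ∧ N₂.Nonempty ∧ N₁ ∪ N₂ = A ∧
      Disjoint N₁ N₂ ∧ ∀ u ∈ N₁, ∀ v ∈ N₂, ¬ G.Adj u v := by
  classical
  let Q : ℕ → Prop := fun n => ∃ L : List V, L.Nodup ∧ (∀ v ∈ L, v ∈ A) ∧ L.IsChain G.Adj ∧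
    L.length = n
  have hQ1 : Q 1 := by
    obtain ⟨a, ha⟩ := hA
    exact ⟨[a], by simp, by simpa using ha, by simp, rfl⟩
  have hbound : ∀ n, Q n → n ≤ Fintype.card V := by
    rintro n ⟨L, hL, -, -, rfl⟩
    exact hL.length_le_card
  have h1 : 1 ≤ Fintype.card V := hbound 1 hQ1
  obtain ⟨L, hLn, hLA, hLc, hLlen⟩ := Nat.findGreatest_spec h1 hQ1
  have hmax : ∀ L' : List V, L'.Nodup → (∀ v ∈ L', v ∈ A) → L'.IsChain G.Adj →
      L'.length ≤ L.length := by
    intro L' h1 h2 h3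
    rw [hLlen]
    exact Nat.le_findGreatest (hbound _ ⟨L', h1, h2, h3, rfl⟩) ⟨L', h1, h2, h3, rfl⟩
  have hLne : L ≠ [] := by
    rintro rfl
    have := Nat.le_findGreatest h1 hQ1
    simp at hLlen
    omega
  by_cases hall : ∀ v ∈ A, v ∈ L
  · exact Or.inl ⟨L, hLn, fun v => ⟨hLA v, hall v⟩, hLc⟩
  right
  push Not at hall
  obtain ⟨w, hwA, hwL⟩ := hall
  -- No outside vertex is adjacent to the first vertex of a longest path.
  have hext : ∀ L' : List V, L'.Perm L → L'.IsChain G.Adj → ∀ u ∈ A, u ∉ L →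
      ∀ h : L' ≠ [], ¬ G.Adj u (L'.head h) := by
    intro L' hp hc u hu huL h hadj
    have := hmax (u :: L') (List.nodup_cons.2 ⟨fun h => huL (hp.mem_iff.1 h), hp.nodup_iff.2 hLn⟩)
      (by
        intro v hv
        rcases List.mem_cons.1 hv with rfl | hv
        · exact hu
        · exact hLA v (hp.mem_iff.1 hv))
      (hc.cons_of_ne_nil h hadj)
    rw [List.length_cons, hp.length_eq] at this
    omega
  have hends : L.getLast hLne = L.head hLne ∨ G.Adj (L.getLast hLne) (L.head hLne) := by
    by_contra! hne
    have e1 := hext L (List.Perm.refl _) hLc w hwA hwL hLne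
    have e2 := hext L.reverse (List.reverse_perm _) (isChain_adj_reverse hLc) w hwA hwL (by simpa)
    rw [List.head_reverse] at e2
    have n1 : w ≠ L.head hLne := fun h => hwL (h ▸ List.head_mem _)
    have n2 : w ≠ L.getLast hLne := fun h => hwL (h ▸ List.getLast_mem _)
    rcases hα w (L.head hLne) (L.getLast hLne) n1 n2 hne.1.symm with h | h | h
    · exact e1 h
    · exact e2 h
    · exact hne.2 h.symm
  refine ⟨{v | v ∈ L}, {v | v ∈ A ∧ v ∉ L}, ⟨_, List.head_mem hLne⟩, ⟨w, hwA, hwL⟩, ?_, ?_, ?_⟩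
  · ext v
    simp only [Set.mem_union, Set.mem_ofPred_eq]
    constructor
    · rintro (h | h)
      · exact hLA v h
      · exact h.1
    · intro h
      by_cases h' : v ∈ L
      · exact Or.inl h'
      · exact Or.inr ⟨h, h'⟩
  · rw [Set.disjoint_left]
    exact fun v h h' => h'.2 h
  · intro u hu v hv huv
    obtain ⟨s, t, rfl⟩ := List.append_of_mem (show u ∈ L from hu)
    -- Rotate the closed path so that it starts at `u`.
    have hc : ((u :: t) ++ s).IsChain G.Adj := by
      refine hLc.right_of_append.append hLc.left_of_append ?_
      intro x hx y hy
      cases s with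
      | nil => simp at hy
      | cons y' s =>
        simp only [List.head?_cons, Option.mem_some_iff] at hy
        subst hy
        have hx' : x = ((y' :: s) ++ u :: t).getLast hLne := by
          rw [List.getLast?_eq_getLast_of_ne_nil (by simp), Option.mem_some_iff] at hx
          rw [← hx, List.getLast_append_of_ne_nil _ (by simp)]
        rw [← hx'] at hends
        have hd : ((y' :: s) ++ u :: t).head hLne = y' := by simp
        rw [hd] at hends
        rcases hends with h | h
        · exfalso
          have hm : x ∈ u :: t := by
            rw [List.getLast?_eq_getLast_of_ne_nil (by simp), Option.mem_some_iff] at hx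
            rw [← hx]; exact List.getLast_mem _
          rw [h] at hm
          exact (List.nodup_append.1 hLn).2.2 y' (by simp) y' hm rfl
        · exact h
    exact hext _ List.perm_append_comm hc v hv.1 hv.2 (by simp) (by simpa using huv.symm)

end

/-! ### Hamiltonian paths with three representatives -/

section

variable {V : Type*} {G : SimpleGraph V}

/-- `q` is the only neighbour of `p` in `Q`. -/
def IsSole (G : SimpleGraph V) (Q : Set V) (q p : V) : Prop :=
  G.Adj p q ∧ ∀ q' ∈ Q, G.Adj p q' → q' = q

/-- `a`, `b`, `c` have three different neighbours in `Q`. -/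
def HasReps (G : SimpleGraph V) (Q : Set V) (a b c : V) : Prop :=
  ∃ q₀ q₁ q₂, q₀ ∈ Q ∧ q₁ ∈ Q ∧ q₂ ∈ Q ∧ q₀ ≠ q₁ ∧ q₀ ≠ q₂ ∧ q₁ ≠ q₂ ∧
    G.Adj a q₀ ∧ G.Adj b q₁ ∧ G.Adj c q₂

/-- Some Hamiltonian path of `N` has its first two vertices and its last one matched into `Q`. -/
def HasGoodPath (G : SimpleGraph V) (N Q : Set V) : Prop :=
  ∃ p₀ p₁ M p, IsHamPath G N (p₀ :: p₁ :: (M ++ [p])) ∧ HasReps G Q p₀ p₁ p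

variable {N Q : Set V}

theorem adj_of_isSole (hα : NoIndepTriple G) (hdisj : ∀ v ∈ N, v ∉ Q) {q a c : V} (ha : a ∈ N)
    (hc : c ∈ N) (h : IsSole G Q q a) (hne : a ≠ c) (hac : ¬ G.Adj a c) {q' : V} (hq' : q' ∈ Q)
    (hqq : q' ≠ q) : G.Adj c q' := by
  have h1 : a ≠ q' := fun e => hdisj a ha (e ▸ hq')
  have h2 : c ≠ q' := fun e => hdisj c hc (e ▸ hq')
  rcases hα a c q' hne h1 h2 with h' | h' | h'
  · exact absurd h' hac
  · exact absurd (h.2 q' hq' h') hqq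
  · exact h'

theorem isSole_clique (hα : NoIndepTriple G) (hdisj : ∀ v ∈ N, v ∉ Q)
    (hQ3 : ∀ a b, ∃ c ∈ Q, c ≠ a ∧ c ≠ b) {q a b : V} (ha : a ∈ N) (hb : b ∈ N)
    (h : IsSole G Q q a) (h' : IsSole G Q q b) (hne : a ≠ b) : G.Adj a b := by
  by_contra hab
  obtain ⟨q', hq', hqq, -⟩ := hQ3 q q
  exact hqq (h'.2 q' hq' (adj_of_isSole hα hdisj ha hb h hne hab hq' hqq))

/-- Nonadjacent `a`, `c` together see all of `Q`, so the only obstruction to representatives for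
`a`, `b`, `c` is a common sole neighbour. -/
theorem hasReps_or_isSole (hα : NoIndepTriple G) (hdisj : ∀ v ∈ N, v ∉ Q)
    (hQ3 : ∀ a b, ∃ c ∈ Q, c ≠ a ∧ c ≠ b) (hnb : ∀ p ∈ N, ∃ q ∈ Q, G.Adj p q)
    {a b c : V} (ha : a ∈ N) (hb : b ∈ N) (hc : c ∈ N) (hne : a ≠ c) (hac : ¬ G.Adj a c) :
    HasReps G Q a b c ∨ ∃ q ∈ Q, IsSole G Q q b ∧ (IsSole G Q q a ∨ IsSole G Q q c) := by
  have side : ∀ a c, a ∈ N → c ∈ N → a ≠ c → ¬ G.Adj a c → ∀ q₁ ∈ Q, IsSole G Q q₁ a →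
      HasReps G Q a b c ∨ IsSole G Q q₁ b := by
    intro a c ha hc hne hac q₁ hq₁ hs
    by_cases hbs : IsSole G Q q₁ b
    · exact Or.inr hbs
    · have : ∃ q' ∈ Q, G.Adj b q' ∧ q' ≠ q₁ := by
        by_contra! hcon
        obtain ⟨q', hq', h⟩ := hnb b hb
        exact hbs ⟨hcon q' hq' h ▸ h, fun q' hq' h => hcon q' hq' h⟩
      obtain ⟨q', hq', h1, h2⟩ := this
      obtain ⟨q'', hq'', h3, h4⟩ := hQ3 q₁ q'
      exact Or.inl ⟨q₁, q', q'', hq₁, hq', hq'', h2.symm, h3.symm, h4.symm, hs.1, h1,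
        adj_of_isSole hα hdisj ha hc hs hne hac hq'' h3⟩
  obtain ⟨q₁, hq₁, hbq⟩ := hnb b hb
  by_cases h1 : ∃ q ∈ Q, q ≠ q₁ ∧ G.Adj a q
  · by_cases h2 : ∃ q ∈ Q, q ≠ q₁ ∧ G.Adj c q
    · obtain ⟨qa, hqa, ha1, ha2⟩ := h1
      obtain ⟨qc, hqc, hc1, hc2⟩ := h2
      by_cases hac' : qa = qc
      · subst hac'
        obtain ⟨e, he, he1, he2⟩ := hQ3 qa q₁
        have n1 : a ≠ e := fun h => hdisj a ha (h ▸ he)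
        have n2 : c ≠ e := fun h => hdisj c hc (h ▸ he)
        rcases hα a c e hne n1 n2 with h | h | h
        · exact absurd h hac
        · exact Or.inl ⟨e, q₁, qa, he, hq₁, hqa, he2, he1, ha1.symm, h, hbq, hc2⟩
        · exact Or.inl ⟨qa, q₁, e, hqa, hq₁, he, ha1, he1.symm, he2.symm, ha2, hbq, h⟩
      · exact Or.inl ⟨qa, q₁, qc, hqa, hq₁, hqc, ha1, hac', hc1.symm, ha2, hbq, hc2⟩
    · push Not at h2
      have hs : IsSole G Q q₁ c := by
        obtain ⟨q, hq, h⟩ := hnb c hc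
        have hqq : q = q₁ := by by_contra hne'; exact h2 q hq hne' h
        exact ⟨hqq ▸ h, fun q' hq' h' => by by_contra hne'; exact h2 q' hq' hne' h'⟩
      rcases side c a hc ha hne.symm (fun h => hac h.symm) q₁ hq₁ hs with h | h
      · obtain ⟨x, y, z, hx, hy, hz, h1, h2, h3, h4, h5, h6⟩ := h
        exact Or.inl ⟨z, y, x, hz, hy, hx, h3.symm, h2.symm, h1.symm, h6, h5, h4⟩
      · exact Or.inr ⟨q₁, hq₁, h, Or.inr hs⟩
  · push Not at h1
    have hs : IsSole G Q q₁ a := by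
      obtain ⟨q, hq, h⟩ := hnb a ha
      have hqq : q = q₁ := by by_contra hne'; exact h1 q hq hne' h
      exact ⟨hqq ▸ h, fun q' hq' h' => by by_contra hne'; exact h1 q' hq' hne' h'⟩
    rcases side a c ha hc hne hac q₁ hq₁ hs with h | h
    · exact Or.inl h
    · exact Or.inr ⟨q₁, hq₁, h, Or.inl hs⟩

theorem exists_last_of_exists {p : V → Prop} {L : List V} (h : ∃ x ∈ L, p x) :
    ∃ U t W, L = U ++ t :: W ∧ p t ∧ ∀ w ∈ W, ¬ p w := by
  induction L with
  | nil => simp at h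
  | cons a L ih =>
    by_cases hL : ∃ x ∈ L, p x
    · obtain ⟨U, t, W, rfl, ht, hW⟩ := ih hL
      exact ⟨a :: U, t, W, rfl, ht, hW⟩
    · push Not at hL
      refine ⟨[], a, L, rfl, ?_, hL⟩
      obtain ⟨x, hx, hpx⟩ := h
      rcases List.mem_cons.1 hx with rfl | hx
      · exact hpx
      · exact absurd hpx (hL x hx)

/-- A Hamiltonian path whose last but one vertex `σ` has a sole neighbour `q` in `Q` and whose
last vertex `c` sees all the rest of `Q` can be turned into a good path: the vertices with sole
neighbour `q` form a clique, which allows to reroute the path so that it starts with `c`, `σ` and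
ends in a vertex with a neighbour other than `q`. -/
theorem hasGoodPath_of_isSole (hα : NoIndepTriple G) (hdisj : ∀ v ∈ N, v ∉ Q)
    (hQ3 : ∀ a b, ∃ c ∈ Q, c ≠ a ∧ c ≠ b) (hnb : ∀ p ∈ N, ∃ q ∈ Q, G.Adj p q)
    (hcross : ∀ y z, y ∈ N ∨ y ∈ Q → z ∈ N ∨ z ∈ Q →
      ∃ p ∈ N, ∃ q ∈ Q, p ≠ y ∧ p ≠ z ∧ q ≠ y ∧ q ≠ z ∧ G.Adj p q)
    {K : List V} {σ c q : V} (hL : IsHamPath G N (K ++ [σ, c])) (hq : q ∈ Q)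
    (hσ : IsSole G Q q σ) (hc : ∀ q' ∈ Q, q' ≠ q → G.Adj c q') : HasGoodPath G N Q := by
  have hmem : ∀ v, v ∈ K ++ [σ, c] → v ∈ N := fun v hv => (hL.2.1 v).1 hv
  have hσN : σ ∈ N := hmem σ (by simp)
  have hcN : c ∈ N := hmem c (by simp)
  have other : ∀ p ∈ N, ¬ IsSole G Q q p → ∃ q' ∈ Q, q' ≠ q ∧ G.Adj p q' := by
    intro p hp hs
    by_contra! hcon
    obtain ⟨q', hq', h⟩ := hnb p hp
    have e : q' = q := by by_contra hne; exact hcon q' hq' hne h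
    exact hs ⟨e ▸ h, fun q'' hq'' h' => by by_contra hne; exact hcon q'' hq'' hne h'⟩
  have reps : ∀ t ∈ N, ¬ IsSole G Q q t → HasReps G Q c σ t := by
    intro t ht hs
    obtain ⟨q', hq', h1, h2⟩ := other t ht hs
    obtain ⟨q'', hq'', h3, h4⟩ := hQ3 q q'
    exact ⟨q'', q, q', hq'', hq, hq', h3, h4, h1.symm, hc q'' hq'' h3, hσ.1, h2⟩
  have hex : ∃ t ∈ K, ¬ IsSole G Q q t := by
    obtain ⟨p, hp, q', hq', h1, h2, h3, h4, h5⟩ := hcross c q (Or.inl hcN) (Or.inr hq)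
    have hs : ¬ IsSole G Q q p := fun h => h4 (h.2 q' hq' h5)
    have hpL := (hL.2.1 p).2 hp
    simp only [List.mem_append, List.mem_cons, List.not_mem_nil, or_false] at hpL
    rcases hpL with h | rfl | h
    · exact ⟨p, h, hs⟩
    · exact absurd hσ hs
    · exact absurd h h1
  obtain ⟨U, t, W, rfl, ht, hW⟩ := exists_last_of_exists hex
  have htN : t ∈ N := hmem t (by simp)
  have hrev := hL.reverse
  cases U with
  | nil =>
    refine ⟨c, σ, W.reverse, t, ?_, reps t htN ht⟩
    simpa using hrev
  | cons u U =>
    have huN : u ∈ N := hmem u (by simp)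
    by_cases hu : IsSole G Q q u
    · refine ⟨c, σ, W.reverse ++ u :: U, t, ?_, reps t htN ht⟩
      have hch := hL.2.2
      have e : u :: U ++ t :: W ++ [σ, c] = (u :: U ++ [t]) ++ (W ++ [σ, c]) := by simp
      rw [e] at hch
      refine hL.perm ?_ ?_
      · rw [e]
        have p1 : (W ++ [σ, c]).Perm (c :: σ :: W.reverse) := by
          have := (List.reverse_perm (W ++ [σ, c])).symm
          simpa using this
        have p2 := (List.perm_append_comm (l₁ := u :: U ++ [t]) (l₂ := W ++ [σ, c])).trans
          (p1.append_right (u :: U ++ [t]))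
        simpa using p2
      · have e2 : c :: σ :: (W.reverse ++ u :: U ++ [t]) =
            (W ++ [σ, c]).reverse ++ (u :: U ++ [t]) := by simp
        rw [e2]
        refine (isChain_adj_reverse hch.right_of_append).append hch.left_of_append ?_
        intro x hx y hy
        simp only [List.cons_append, List.head?_cons, Option.mem_some_iff] at hy
        subst hy
        have hx' : x ∈ σ :: W := by
          have e3 : (W ++ [σ, c]).reverse = c :: σ :: W.reverse := by simp
          rw [e3, List.getLast?_cons_cons] at hx
          have := List.mem_of_getLast? hx
          simpa using this
        have hxs : IsSole G Q q x := by
          rcases List.mem_cons.1 hx' with rfl | h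
          · exact hσ
          · exact not_not.1 (hW x h)
        have hxN : x ∈ N := hmem x (by
          rcases List.mem_cons.1 hx' with rfl | h
          · simp
          · simp [h])
        refine isSole_clique hα hdisj hQ3 hxN huN hxs hu ?_
        rintro rfl
        have hnd := hL.1
        rcases List.mem_cons.1 hx' with rfl | h
        · simp at hnd
        · simp [List.nodup_append] at hnd
          grind
    · refine ⟨c, σ, W.reverse ++ t :: U.reverse, u, ?_, reps u huN hu⟩
      simpa using hrev

theorem hasGoodPath_of_not_adj_ends (hα : NoIndepTriple G) (hdisj : ∀ v ∈ N, v ∉ Q)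
    (hQ3 : ∀ a b, ∃ c ∈ Q, c ≠ a ∧ c ≠ b) (hnb : ∀ p ∈ N, ∃ q ∈ Q, G.Adj p q)
    (hcross : ∀ y z, y ∈ N ∨ y ∈ Q → z ∈ N ∨ z ∈ Q →
      ∃ p ∈ N, ∃ q ∈ Q, p ≠ y ∧ p ≠ z ∧ q ≠ y ∧ q ≠ z ∧ G.Adj p q)
    {p₀ p₁ p : V} {M : List V} (hL : IsHamPath G N (p₀ :: p₁ :: (M ++ [p])))
    (hends : ¬ G.Adj p₀ p) : HasGoodPath G N Q := by
  have hmem : ∀ v, v ∈ p₀ :: p₁ :: (M ++ [p]) → v ∈ N := fun v hv => (hL.2.1 v).1 hv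
  have h0 : p₀ ∈ N := hmem _ (by simp)
  have h1 : p₁ ∈ N := hmem _ (by simp)
  have hp : p ∈ N := hmem _ (by simp)
  have hne : p₀ ≠ p := by
    rintro rfl
    have := hL.1
    simp at this
  rcases hasReps_or_isSole hα hdisj hQ3 hnb h0 h1 hp hne hends with h | ⟨q, hq, hs1, hs0 | hs⟩
  · exact ⟨p₀, p₁, M, p, hL, h⟩
  · have hpq := fun q' (hq' : q' ∈ Q) hqq =>
      adj_of_isSole hα hdisj h0 hp hs0 hne hends hq' hqq
    obtain ⟨K, s, hK⟩ : ∃ K s, p₁ :: M = K ++ [s] :=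
      ⟨_, _, (List.dropLast_append_getLast (List.cons_ne_nil p₁ M)).symm⟩
    have e : p₀ :: p₁ :: (M ++ [p]) = p₀ :: K ++ [s, p] := by
      have : p₀ :: p₁ :: (M ++ [p]) = p₀ :: ((p₁ :: M) ++ [p]) := by simp
      rw [this, hK]; simp
    rw [e] at hL
    have hsN : s ∈ N := (hL.2.1 s).1 (by simp)
    rcases hasReps_or_isSole hα hdisj hQ3 hnb hp hsN h0 hne.symm (fun h => hends h.symm) with
      h | ⟨q', hq', hs1', hsp | hs0'⟩
    · have := hL.reverse
      exact ⟨p, s, K.reverse, p₀, by simpa using this, h⟩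
    · exfalso
      obtain ⟨a, ha, ha1, ha2⟩ := hQ3 q q'
      exact ha2 (hsp.2 a ha (hpq a ha ha1))
    · have : q' = q := hs0.2 q' hq' hs0'.1
      subst this
      exact hasGoodPath_of_isSole hα hdisj hQ3 hnb hcross hL hq hs1' hpq
  · have hpq := fun q' (hq' : q' ∈ Q) hqq =>
      adj_of_isSole hα hdisj hp h0 hs hne.symm (fun h => hends h.symm) hq' hqq
    have := hL.reverse
    have e : (p₀ :: p₁ :: (M ++ [p])).reverse = (p :: M.reverse) ++ [p₁, p₀] := by simp
    rw [e] at this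
    exact hasGoodPath_of_isSole hα hdisj hQ3 hnb hcross this hq hs1 hpq

theorem hasGoodPath_of_not_adj_third (hα : NoIndepTriple G) (hdisj : ∀ v ∈ N, v ∉ Q)
    (hQ3 : ∀ a b, ∃ c ∈ Q, c ≠ a ∧ c ≠ b) (hnb : ∀ p ∈ N, ∃ q ∈ Q, G.Adj p q)
    (hcross : ∀ y z, y ∈ N ∨ y ∈ Q → z ∈ N ∨ z ∈ Q →
      ∃ p ∈ N, ∃ q ∈ Q, p ≠ y ∧ p ≠ z ∧ q ≠ y ∧ q ≠ z ∧ G.Adj p q)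
    {a b c p : V} {M : List V} (hL : IsHamPath G N (a :: b :: c :: (M ++ [p])))
    (hclose : G.Adj p a) (hac : ¬ G.Adj a c) : HasGoodPath G N Q := by
  have hmem : ∀ v, v ∈ a :: b :: c :: (M ++ [p]) → v ∈ N := fun v hv => (hL.2.1 v).1 hv
  have ha : a ∈ N := hmem _ (by simp)
  have hb : b ∈ N := hmem _ (by simp)
  have hc : c ∈ N := hmem _ (by simp)
  have hne : a ≠ c := by
    rintro rfl
    have := hL.1
    simp at this
  have hch := hL.2.2
  have hrot : ∀ X Y : List V, a :: b :: c :: (M ++ [p]) = X ++ Y → X ≠ [] → Y ≠ [] →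
      IsHamPath G N (Y ++ X) := by
    intro X Y h hX hY
    rw [h] at hL hch
    refine hL.perm List.perm_append_comm (hch.right_of_append.append hch.left_of_append ?_)
    intro x hx y hy
    have hy' : y = a := by
      cases X with
      | nil => exact absurd rfl hX
      | cons z X => simp at hy h; rw [← hy, h.1]
    have hx' : x = p := by
      have e1 : (a :: b :: c :: (M ++ [p])).getLast? = some p := by
        have : a :: b :: c :: (M ++ [p]) = (a :: b :: c :: M) ++ [p] := by simp
        rw [this, List.getLast?_append]; simp
      rw [h, List.getLast?_append_of_ne_nil _ hY] at e1
      rw [e1] at hx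
      exact (Option.mem_some_iff.1 hx).symm
    rw [hx', hy']; exact hclose
  rcases hasReps_or_isSole hα hdisj hQ3 hnb ha hb hc hne hac with h | ⟨q, hq, hs, hs' | hs'⟩
  · obtain ⟨x, y, z, hx, hy, hz, h1, h2, h3, h4, h5, h6⟩ := h
    refine ⟨b, c, M ++ [p], a, ?_, ⟨y, z, x, hy, hz, hx, h3, h1.symm, h2.symm, h5, h6, h4⟩⟩
    have := hrot [a] (b :: c :: (M ++ [p])) rfl (by simp) (by simp)
    simpa using this
  · have hpq := fun q' (hq' : q' ∈ Q) hqq =>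
      adj_of_isSole hα hdisj ha hc hs' hne hac hq' hqq
    have := hrot [a, b, c] (M ++ [p]) rfl (by simp) (by simp)
    have e : M ++ [p] ++ [a, b, c] = (M ++ [p, a]) ++ [b, c] := by simp
    rw [e] at this
    exact hasGoodPath_of_isSole hα hdisj hQ3 hnb hcross this hq hs hpq
  · have hpq := fun q' (hq' : q' ∈ Q) hqq =>
      adj_of_isSole hα hdisj hc ha hs' hne.symm (fun h => hac h.symm) hq' hqq
    have := hL.reverse
    have e : (a :: b :: c :: (M ++ [p])).reverse = (p :: M.reverse ++ [c]) ++ [b, a] := by simp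
    rw [e] at this
    exact hasGoodPath_of_isSole hα hdisj hQ3 hnb hcross this hq hs hpq

/-- König's theorem for matchings of size three: if no two vertices meet all edges between `N`
and `Q`, then there are three disjoint such edges. -/
theorem exists_three_matching (hQ : Q.Nonempty)
    (hcross : ∀ y z, y ∈ N ∨ y ∈ Q → z ∈ N ∨ z ∈ Q →
      ∃ p ∈ N, ∃ q ∈ Q, p ≠ y ∧ p ≠ z ∧ q ≠ y ∧ q ≠ z ∧ G.Adj p q) :
    ∃ a b c, a ∈ N ∧ b ∈ N ∧ c ∈ N ∧ a ≠ b ∧ a ≠ c ∧ b ≠ c ∧ HasReps G Q a b c := by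
  obtain ⟨q, hq⟩ := hQ
  obtain ⟨a₁, ha₁, b₁, hb₁, -, -, -, -, h₁⟩ := hcross q q (Or.inr hq) (Or.inr hq)
  obtain ⟨a₂, ha₂, b₂, hb₂, n1, -, -, n2, h₂⟩ := hcross a₁ b₁ (Or.inl ha₁) (Or.inr hb₁)
  obtain ⟨a, ha, b, hb, n3, n4, -, -, h⟩ := hcross a₁ a₂ (Or.inl ha₁) (Or.inl ha₂)
  obtain ⟨a', ha', b', hb', -, -, n5, n6, h'⟩ := hcross b₁ b₂ (Or.inr hb₁) (Or.inr hb₂)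
  have fin : ∀ {x y z u v w}, x ∈ N → y ∈ N → z ∈ N → u ∈ Q → v ∈ Q → w ∈ Q → x ≠ y → x ≠ z →
      y ≠ z → u ≠ v → u ≠ w → v ≠ w → G.Adj x u → G.Adj y v → G.Adj z w →
      ∃ a b c, a ∈ N ∧ b ∈ N ∧ c ∈ N ∧ a ≠ b ∧ a ≠ c ∧ b ≠ c ∧ HasReps G Q a b c :=
    fun h1 h2 h3 h4 h5 h6 h7 h8 h9 h10 h11 h12 h13 h14 h15 =>
      ⟨_, _, _, h1, h2, h3, h7, h8, h9, _, _, _, h4, h5, h6, h10, h11, h12, h13, h14, h15⟩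
  -- An augmenting path argument; the roles of the two edges `a₁b₁`, `a₂b₂` are symmetric.
  have main : ∀ {a₁ b₁ a₂ b₂}, a₁ ∈ N → b₁ ∈ Q → a₂ ∈ N → b₂ ∈ Q → a₂ ≠ a₁ → b₂ ≠ b₁ →
      G.Adj a₁ b₁ → G.Adj a₂ b₂ → a ≠ a₁ → a ≠ a₂ → b' ≠ b₁ → b' ≠ b₂ → G.Adj a b₁ →
      ∃ a b c, a ∈ N ∧ b ∈ N ∧ c ∈ N ∧ a ≠ b ∧ a ≠ c ∧ b ≠ c ∧ HasReps G Q a b c := by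
    intro a₁ b₁ a₂ b₂ ha₁ hb₁ ha₂ hb₂ n1 n2 h₁ h₂ n3 n4 n5 n6 h
    by_cases c1 : a' = a₁
    · subst c1
      exact fin ha ha' ha₂ hb₁ hb' hb₂ n3 n4 n1.symm n5.symm n2.symm n6 h h' h₂
    by_cases c2 : a' = a₂
    · subst c2
      obtain ⟨a'', ha'', b'', hb'', -, m1, m2, -, h''⟩ :=
        hcross b₁ a' (Or.inr hb₁) (Or.inl ha₂)
      by_cases c3 : b'' = b₂
      · subst c3
        by_cases c4 : a'' = a₁
        · subst c4
          exact fin ha'' ha ha₂ hb₂ hb₁ hb' n3.symm n1.symm n4 n2 n6.symm n5.symm h'' h h'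
        · exact fin ha'' ha₂ ha₁ hb₂ hb' hb₁ m1 c4 n1 n6.symm n2 n5 h'' h' h₁
      · by_cases c4 : a'' = a₁
        · subst c4
          exact fin ha ha'' ha₂ hb₁ hb'' hb₂ n3 n4 n1.symm m2.symm n2.symm c3 h h'' h₂
        · exact fin ha'' ha₁ ha₂ hb'' hb₁ hb₂ c4 m1 n1.symm m2 c3 n2.symm h'' h₁ h₂
    · exact fin ha' ha₁ ha₂ hb' hb₁ hb₂ c1 c2 n1.symm n5 n6 n2.symm h' h₁ h₂
  by_cases c1 : b = b₁
  · subst c1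
    exact main ha₁ hb ha₂ hb₂ n1 n2 h₁ h₂ n3 n4 n5 n6 h
  by_cases c2 : b = b₂
  · subst c2
    exact main ha₂ hb ha₁ hb₁ n1.symm n2.symm h₂ h₁ n4 n3 n6 n5 h
  · exact fin ha ha₁ ha₂ hb hb₁ hb₂ n3 n4 n1.symm c1 c2 n2.symm h h₁ h₂

/-- If no Hamiltonian path of `N` is good, then all its Hamiltonian paths close up to cycles along
which vertices at distance two are adjacent; hence every ordering of `N` is a Hamiltonian path,
and the three ends of a matching into `Q` can be moved to the required places. -/
theorem hasGoodPath_of_isHamPath (hα : NoIndepTriple G) (hdisj : ∀ v ∈ N, v ∉ Q)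
    (hQ3 : ∀ a b, ∃ c ∈ Q, c ≠ a ∧ c ≠ b) (hnb : ∀ p ∈ N, ∃ q ∈ Q, G.Adj p q)
    (hcross : ∀ y z, y ∈ N ∨ y ∈ Q → z ∈ N ∨ z ∈ Q →
      ∃ p ∈ N, ∃ q ∈ Q, p ≠ y ∧ p ≠ z ∧ q ≠ y ∧ q ≠ z ∧ G.Adj p q)
    (hQ : Q.Nonempty) {L : List V} (hL : IsHamPath G N L) : HasGoodPath G N Q := by
  classical
  by_contra hbad
  obtain ⟨t₁, t₂, t₃, ht₁, ht₂, ht₃, n12, n13, n23, hreps⟩ := exists_three_matching hQ hcross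
  have hlen : ∀ {L : List V}, IsHamPath G N L → ∃ p₀ p₁ M p, L = p₀ :: p₁ :: (M ++ [p]) := by
    intro L hL
    have hsub : [t₁, t₂, t₃].Subperm L := by
      refine List.subperm_of_subset (by simp [n12, n13, n23]) ?_
      intro v hv
      rw [hL.2.1]
      simp at hv
      rcases hv with rfl | rfl | rfl <;> assumption
    have h3 := hsub.length_le
    match L, h3 with
    | p₀ :: p₁ :: p :: M, _ =>
      exact ⟨p₀, p₁, (p :: M).dropLast, (p :: M).getLast (by simp), by
        rw [List.dropLast_append_getLast]⟩
  have hrot : ∀ {X Y : List V}, IsHamPath G N (X ++ Y) → IsHamPath G N (Y ++ X) := by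
    intro X Y h
    by_cases hX : X = []
    · subst hX; simpa using h
    by_cases hY : Y = []
    · subst hY; simpa using h
    refine h.perm List.perm_append_comm (h.2.2.right_of_append.append h.2.2.left_of_append ?_)
    intro x hx y hy
    obtain ⟨p₀, p₁, M, p, e⟩ := hlen h
    have hy' : y = p₀ := by
      cases X with
      | nil => exact absurd rfl hX
      | cons z X => simp at hy e; rw [← hy, e.1]
    have hx' : x = p := by
      have e1 : (p₀ :: p₁ :: (M ++ [p])).getLast? = some p := by
        have : p₀ :: p₁ :: (M ++ [p]) = (p₀ :: p₁ :: M) ++ [p] := by simp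
        rw [this, List.getLast?_append]; simp
      rw [← e, List.getLast?_append_of_ne_nil _ hY] at e1
      rw [e1] at hx
      exact (Option.mem_some_iff.1 hx).symm
    rw [e] at h
    rw [hx', hy']
    by_contra hcon
    exact hbad (hasGoodPath_of_not_adj_ends hα hdisj hQ3 hnb hcross h fun h => hcon h.symm)
  have hswap : ∀ {a b : V} {X : List V}, IsHamPath G N (a :: b :: X) →
      IsHamPath G N (b :: a :: X) := by
    intro a b X h
    refine h.perm (List.Perm.swap _ _ _) ?_
    have hch := h.2.2
    rw [List.isChain_cons_cons] at hch ⊢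
    refine ⟨hch.1.symm, ?_⟩
    cases X with
    | nil => simp
    | cons c X =>
      rw [List.isChain_cons_cons] at hch ⊢
      refine ⟨?_, hch.2.2⟩
      by_contra hac
      by_cases hX : X = []
      · subst hX
        exact hbad (hasGoodPath_of_not_adj_ends hα hdisj hQ3 hnb hcross
          (M := []) (by simpa using h) hac)
      · have e := (List.dropLast_append_getLast hX).symm
        rw [e] at h
        have hclose : G.Adj (X.getLast hX) a := by
          by_contra hcon
          have e' : a :: b :: c :: (X.dropLast ++ [X.getLast hX]) =
              a :: b :: ((c :: X.dropLast) ++ [X.getLast hX]) := by simp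
          rw [e'] at h
          exact hbad (hasGoodPath_of_not_adj_ends hα hdisj hQ3 hnb hcross h
            fun h => hcon h.symm)
        exact hbad (hasGoodPath_of_not_adj_third hα hdisj hQ3 hnb hcross h hclose hac)
  have hperm : ∀ {X Y : List V}, X.Perm Y → ∀ U W, IsHamPath G N (U ++ X ++ W) →
      IsHamPath G N (U ++ Y ++ W) := by
    intro X Y h
    induction h with
    | nil => exact fun U W h => h
    | @cons a X Y h ih =>
      intro U W h'
      have := ih (U ++ [a]) W (by simpa using h')
      simpa using this
    | swap a b X =>
      intro U W h'
      have h1 : IsHamPath G N ((b :: a :: (X ++ W)) ++ U) := by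
        have : IsHamPath G N (U ++ (b :: a :: (X ++ W))) := by simpa using h'
        exact hrot this
      have h2 : IsHamPath G N ((a :: b :: (X ++ W)) ++ U) := hswap h1
      have h3 := hrot h2
      simpa using h3
    | trans _ _ ih1 ih2 => exact fun U W h => ih2 U W (ih1 U W h)
  let R := L.filter fun v => v ≠ t₁ ∧ v ≠ t₂ ∧ v ≠ t₃
  have hp : L.Perm (t₁ :: t₂ :: (R ++ [t₃])) := by
    rw [List.perm_ext_iff_of_nodup hL.1]
    · intro v
      have := hL.2.1 v
      simp only [this, List.mem_cons, List.mem_append, R, List.mem_filter, List.not_mem_nil,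
        or_false, decide_eq_true_eq]
      constructor
      · intro hv
        by_cases c1 : v = t₁
        · exact Or.inl c1
        by_cases c2 : v = t₂
        · exact Or.inr (Or.inl c2)
        by_cases c3 : v = t₃
        · exact Or.inr (Or.inr (Or.inr c3))
        exact Or.inr (Or.inr (Or.inl ⟨hv, c1, c2, c3⟩))
      · rintro (rfl | rfl | h | rfl)
        · exact ht₁
        · exact ht₂
        · exact h.1
        · exact ht₃
    · have : R.Nodup := hL.1.filter _
      simp [List.nodup_append, n12, n13, n23, R]
      grind
  have := hperm hp [] [] (by simpa using hL)
  exact hbad ⟨t₁, t₂, R, t₃, by simpa using this, hreps⟩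

end

/-! ### Thick paths and thick cycles -/

section

variable {V : Type*} {G : SimpleGraph V}

theorem nodup_strip {l r : V} {S T B : List V} (hS : S.Nodup) (hT : T.Nodup) (hB : B.Nodup)
    (hlr : l ≠ r) (hS1 : ∀ v ∈ S, v ≠ l ∧ v ≠ r) (hB1 : ∀ v ∈ B, v ≠ l ∧ v ≠ r ∧ v ∉ S)
    (hT1 : ∀ v ∈ T, v ≠ l ∧ v ≠ r ∧ v ∉ S ∧ v ∉ B) : (l :: r :: (S ++ (T ++ B))).Nodup := by
  simp only [List.nodup_cons, List.nodup_append, List.mem_cons, List.mem_append]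
  grind

theorem nodup_ends {l r : V} {T : List V} (hT : T.Nodup) (hlr : l ≠ r)
    (hT1 : ∀ v ∈ T, v ≠ l ∧ v ≠ r) : (l :: (T ++ [r])).Nodup := by
  simp only [List.nodup_cons, List.nodup_append, List.mem_cons, List.mem_append]
  grind

theorem exists_sorted_list [Fintype V] (f : V → ℕ) (p : V → Prop) :
    ∃ T : List V, T.Nodup ∧ (∀ v, v ∈ T ↔ p v) ∧ T.Pairwise fun a b => f a ≤ f b := by
  classical
  let L := (Finset.univ.filter p).toList
  have hp := List.mergeSort_perm L fun a b => decide (f a ≤ f b)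
  refine ⟨L.mergeSort fun a b => decide (f a ≤ f b), hp.nodup_iff.2 (Finset.nodup_toList _), ?_, ?_⟩
  · intro v
    rw [hp.mem_iff]
    simp [L]
  · have := List.pairwise_mergeSort (le := fun a b => decide (f a ≤ f b))
      (fun a b c h h' => by simp at *; omega) (fun a b => by simp; omega) L
    simpa using this

/-- A list sorted by class, without gaps, is a path as soon as vertices of equal or consecutive
classes are adjacent. -/
theorem isChain_of_sorted {f : V → ℕ}
    (hadj : ∀ u v, u ≠ v → f u ≤ f v + 1 → f v ≤ f u + 1 → G.Adj u v) {X : List V}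
    (hn : X.Nodup) (hs : X.Pairwise fun a b => f a ≤ f b)
    (hgap : ∀ a ∈ X, ∀ b ∈ X, f a < f b → ∃ c ∈ X, f c = f a + 1) : X.IsChain G.Adj := by
  rw [List.isChain_iff_getElem]
  intro i hi
  rw [List.pairwise_iff_getElem] at hs
  have h1 := hs i (i + 1) (by omega) hi (by omega)
  refine hadj _ _ (fun h => ?_) (by omega) ?_
  · have := hn.getElem_inj_iff.1 h; omega
  · by_contra hcon
    obtain ⟨c, hc, hfc⟩ := hgap X[i] (List.getElem_mem _) X[i + 1] (List.getElem_mem _) (by omega)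
    obtain ⟨j, hj, rfl⟩ := List.getElem_of_mem hc
    rcases Nat.lt_or_ge j (i + 1) with h | h
    · rcases Nat.lt_or_ge j i with h' | h'
      · have := hs j i hj (by omega) h'; omega
      · have : j = i := by omega
        subst this; omega
    · rcases Nat.lt_or_ge (i + 1) j with h' | h'
      · have := hs (i + 1) j hi hj h'; omega
      · have : j = i + 1 := by omega
        subst this; omega

theorem isChain_spine {f : V → ℕ} {k : ℕ} {s : ℕ → V} {l r : V}
    (hadj : ∀ u v, u ≠ v → f u ≤ f v + 1 → f v ≤ f u + 1 → G.Adj u v)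
    (hk : 1 ≤ k) (hs : ∀ i, 1 ≤ i → i ≤ k → f (s i) = i) (hl : G.Adj l (s 1))
    (hr : G.Adj (s k) r) :
    (l :: ((List.range k).map (fun i => s (i + 1)) ++ [r])).IsChain G.Adj := by
  rw [List.isChain_cons, List.isChain_append]
  refine ⟨?_, ?_, by simp, ?_⟩
  · intro y hy
    obtain ⟨k, rfl⟩ := Nat.exists_eq_add_of_le' hk
    rw [List.range_succ_eq_map] at hy
    simp at hy
    exact hy ▸ hl
  · rw [List.isChain_iff_getElem]
    intro i hi
    simp only [List.length_map, List.length_range] at hi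
    simp only [List.getElem_map, List.getElem_range]
    have h1 := hs (i + 1) (by omega) (by omega)
    have h2 := hs (i + 1 + 1) (by omega) (by omega)
    refine hadj _ _ (fun h => ?_) (by omega) (by omega)
    rw [h] at h1; omega
  · intro x hx y hy
    obtain ⟨k, rfl⟩ := Nat.exists_eq_add_of_le' hk
    rw [List.range_succ] at hx
    simp at hx hy
    exact hx ▸ hy ▸ hr

/-- Consecutive cliques `0, …, k + 1` in which all inner ones have at least three vertices: each
inner clique gives one vertex to the spine and one to either side of it. -/
theorem hasSpanningHalinSubgraph_of_thick_path [Fintype V] (f : V → ℕ) (k : ℕ) (hk : 1 ≤ k)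
    (hf : ∀ v, f v ≤ k + 1)
    (hadj : ∀ u v, u ≠ v → f u ≤ f v + 1 → f v ≤ f u + 1 → G.Adj u v)
    (h0 : ∃ v, f v = 0) (hlast : ∃ v, f v = k + 1)
    (h3 : ∀ i, 1 ≤ i → i ≤ k → ∃ s t b, f s = i ∧ f t = i ∧ f b = i ∧ s ≠ t ∧ s ≠ b ∧ t ≠ b) :
    HasSpanningHalinSubgraph G := by
  classical
  obtain ⟨l, hl⟩ := h0
  obtain ⟨r, hr⟩ := hlast
  have h3' : ∀ i, ∃ s t b, 1 ≤ i → i ≤ k →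
      f s = i ∧ f t = i ∧ f b = i ∧ s ≠ t ∧ s ≠ b ∧ t ≠ b := by
    intro i
    by_cases h : 1 ≤ i ∧ i ≤ k
    · obtain ⟨s, t, b, h'⟩ := h3 i h.1 h.2
      exact ⟨s, t, b, fun _ _ => h'⟩
    · exact ⟨l, l, l, fun h1 h2 => absurd ⟨h1, h2⟩ h⟩
  choose s t b hstb using h3'
  let S := (List.range k).map fun i => s (i + 1)
  let B := (List.range k).map fun i => b (i + 1)
  obtain ⟨T, hTn, hTm, hTs⟩ := exists_sorted_list f
    (fun v => v ≠ l ∧ v ≠ r ∧ v ∉ S ∧ v ∉ B)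
  have hS : ∀ v, v ∈ S ↔ ∃ i, 1 ≤ i ∧ i ≤ k ∧ s i = v := by
    intro v
    simp only [S, List.mem_map, List.mem_range]
    exact ⟨fun ⟨i, h, e⟩ => ⟨i + 1, by omega, by omega, e⟩,
      fun ⟨i, h, h', e⟩ => ⟨i - 1, by omega, by rwa [Nat.sub_add_cancel h]⟩⟩
  have hB : ∀ v, v ∈ B ↔ ∃ i, 1 ≤ i ∧ i ≤ k ∧ b i = v := by
    intro v
    simp only [B, List.mem_map, List.mem_range]
    exact ⟨fun ⟨i, h, e⟩ => ⟨i + 1, by omega, by omega, e⟩,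
      fun ⟨i, h, h', e⟩ => ⟨i - 1, by omega, by rwa [Nat.sub_add_cancel h]⟩⟩
  have hSn : S.Nodup := by
    refine List.Nodup.map_on ?_ List.nodup_range
    intro i hi j hj h
    simp at hi hj
    have h1 := (hstb (i + 1) (by omega) (by omega)).1
    have h2 := (hstb (j + 1) (by omega) (by omega)).1
    rw [h] at h1; omega
  have hBn : B.Nodup := by
    refine List.Nodup.map_on ?_ List.nodup_range
    intro i hi j hj h
    simp at hi hj
    have h1 := (hstb (i + 1) (by omega) (by omega)).2.2.1
    have h2 := (hstb (j + 1) (by omega) (by omega)).2.2.1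
    rw [h] at h1; omega
  have hSB : ∀ v ∈ S, v ∉ B := by
    intro v hv hv'
    obtain ⟨i, hi, hi', rfl⟩ := (hS v).1 hv
    obtain ⟨j, hj, hj', h⟩ := (hB _).1 hv'
    have h1 := hstb i hi hi'
    have h2 := hstb j hj hj'
    have : i = j := by rw [← h1.1, ← h2.2.2.1, h]
    subst this
    exact h1.2.2.2.2.1 h.symm
  have hfS : ∀ v ∈ S, 1 ≤ f v ∧ f v ≤ k := by
    intro v hv
    obtain ⟨i, hi, hi', rfl⟩ := (hS v).1 hv
    rw [(hstb i hi hi').1]; exact ⟨hi, hi'⟩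
  have hfB : ∀ v ∈ B, 1 ≤ f v ∧ f v ≤ k := by
    intro v hv
    obtain ⟨i, hi, hi', rfl⟩ := (hB v).1 hv
    rw [(hstb i hi hi').2.2.1]; exact ⟨hi, hi'⟩
  have hlS : l ∉ S := fun h => by have := hfS l h; omega
  have hlB : l ∉ B := fun h => by have := hfB l h; omega
  have hrS : r ∉ S := fun h => by have := hfS r h; omega
  have hrB : r ∉ B := fun h => by have := hfB r h; omega
  have hlr : l ≠ r := by rintro rfl; omega
  have htT : ∀ i, 1 ≤ i → i ≤ k → t i ∈ T := by
    intro i hi hi'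
    have h1 := hstb i hi hi'
    rw [hTm]
    refine ⟨?_, ?_, ?_, ?_⟩
    · intro h; have := h1.2.1; rw [h] at this; omega
    · intro h; have := h1.2.1; rw [h] at this; omega
    · intro h
      obtain ⟨j, hj, hj', e⟩ := (hS _).1 h
      have h2 := hstb j hj hj'
      have : i = j := by rw [← h1.2.1, ← h2.1, e]
      subst this
      exact h1.2.2.2.1 e
    · intro h
      obtain ⟨j, hj, hj', e⟩ := (hB _).1 h
      have h2 := hstb j hj hj'
      have : i = j := by rw [← h1.2.1, ← h2.2.2.1, e]
      subst this
      exact h1.2.2.2.2.2 e.symm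
  let cl : V → ℕ := fun v => max 1 (min k (f v))
  have hcl : ∀ v, 1 ≤ cl v ∧ cl v ≤ k ∧ f v ≤ cl v + 1 ∧ cl v ≤ f v + 1 := by
    intro v
    have := hf v
    simp only [cl]; omega
  have hSget : ∀ v, S[cl v - 1]? = some (s (cl v)) := by
    intro v
    have := hcl v
    rw [List.getElem?_eq_getElem (by simp [S]; omega)]
    simp only [S, List.getElem_map, List.getElem_range]
    rw [Nat.sub_add_cancel this.1]
  have hpar : ∀ v, v ∉ S → s (cl v) ∈ S ∧ G.Adj (s (cl v)) v := by
    intro v hv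
    have h1 := hcl v
    have h2 := (hstb _ h1.1 h1.2.1).1
    have h3 : s (cl v) ∈ S := (hS _).2 ⟨_, h1.1, h1.2.1, rfl⟩
    exact ⟨h3, hadj _ _ (fun h => hv (h ▸ h3)) (by omega) (by omega)⟩
  refine hasSpanningHalinSubgraph_of_strip G l r S T B (fun v => s (cl v)) ?_ ?_ ?_ ?_ ?_ ?_ ?_
    ?_ ?_ ?_ ?_
  · have hT1 : ∀ v ∈ T, v ≠ l ∧ v ≠ r ∧ v ∉ S ∧ v ∉ B := fun v => (hTm v).1
    exact nodup_strip hSn hTn hBn hlr (fun v hv => ⟨fun h => hlS (h ▸ hv), fun h => hrS (h ▸ hv)⟩)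
      (fun v hv => ⟨fun h => hlB (h ▸ hv), fun h => hrB (h ▸ hv), fun h => hSB v h hv⟩) hT1
  · intro v
    simp only [List.mem_cons, List.mem_append, hTm]
    tauto
  · refine isChain_spine hadj hk (fun i hi hi' => (hstb i hi hi').1) ?_ ?_
    · have h1 := (hstb 1 le_rfl hk).1
      exact hadj _ _ (by rintro rfl; omega) (by omega) (by omega)
    · have h1 := (hstb k hk le_rfl).1
      refine hadj _ _ (fun h => ?_) (by omega) (by omega)
      rw [h] at h1; omega
  · refine isChain_of_sorted hadj ?_ ?_ ?_
    · have hT1 : ∀ v ∈ T, v ≠ l ∧ v ≠ r ∧ v ∉ S ∧ v ∉ B := fun v => (hTm v).1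
      exact nodup_ends hTn hlr fun v hv => ⟨(hT1 v hv).1, (hT1 v hv).2.1⟩
    · rw [List.pairwise_cons, List.pairwise_append]
      refine ⟨fun v _ => by omega, hTs, by simp, ?_⟩
      intro v _ w hw
      simp at hw
      have := hf v
      rw [hw]; omega
    · intro a _ c hc hac
      have hfc := hf c
      rcases Nat.lt_or_ge k (f a + 1) with h | h
      · exact ⟨r, by simp, by omega⟩
      · exact ⟨t (f a + 1), by simp [htT (f a + 1) (by omega) h],
          (hstb _ (by omega) h).2.1⟩
  · refine isChain_spine hadj hk (fun i hi hi' => (hstb i hi hi').2.2.1) ?_ ?_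
    · have h1 := (hstb 1 le_rfl hk).2.2.1
      exact hadj _ _ (by rintro rfl; omega) (by omega) (by omega)
    · have h1 := (hstb k hk le_rfl).2.2.1
      refine hadj _ _ (fun h => ?_) (by omega) (by omega)
      rw [h] at h1; omega
  · exact List.ne_nil_of_mem (htT 1 le_rfl hk)
  · exact List.ne_nil_of_mem ((hB _).2 ⟨1, le_rfl, hk, rfl⟩)
  · rintro v (hv | hv)
    · exact hpar v ((hTm v).1 hv).2.2.1
    · exact hpar v fun h => hSB v h hv
  · refine hTs.imp ?_
    intro a c h
    exact ⟨_, _, hSget a, hSget c, by simp only [cl]; omega⟩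
  · rw [List.pairwise_map]
    refine List.pairwise_lt_range.imp_of_mem ?_
    intro i j hi hj hij
    simp at hi hj
    refine ⟨_, _, hSget _, hSget _, ?_⟩
    simp only [cl]
    rw [(hstb (i + 1) (by omega) (by omega)).2.2.1, (hstb (j + 1) (by omega) (by omega)).2.2.1]
    omega
  · intro v hv
    obtain ⟨i, hi, hi', rfl⟩ := (hS v).1 hv
    refine ⟨t i, Or.inl (htT i hi hi'), ?_⟩
    have : cl (t i) = i := by simp only [cl]; rw [(hstb i hi hi').2.1]; omega
    simp only [this]

/-- Cliques `0, …, k + 1` arranged in a cycle, where all but two consecutive ones have at least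
two vertices: the spine runs through the large cliques, the leaf cycle goes around. -/
theorem hasSpanningHalinSubgraph_of_thick_cycle [Fintype V] (f : V → ℕ) (k : ℕ) (hk : 2 ≤ k)
    (hf : ∀ v, f v ≤ k + 1)
    (hadj : ∀ u v, u ≠ v → f u ≤ f v + 1 → f v ≤ f u + 1 → G.Adj u v)
    (hclose : ∀ u v, f u = 0 → f v = k + 1 → G.Adj u v)
    (h0 : ∃ v, f v = 0) (hlast : ∃ v, f v = k + 1)
    (h2 : ∀ i, 1 ≤ i → i ≤ k → ∃ s t, f s = i ∧ f t = i ∧ s ≠ t) :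
    HasSpanningHalinSubgraph G := by
  classical
  obtain ⟨z, hz⟩ := h0
  obtain ⟨r, hr⟩ := hlast
  have h2' : ∀ i, ∃ s t, 1 ≤ i → i ≤ k → f s = i ∧ f t = i ∧ s ≠ t := by
    intro i
    by_cases h : 1 ≤ i ∧ i ≤ k
    · obtain ⟨s, t, h'⟩ := h2 i h.1 h.2
      exact ⟨s, t, fun _ _ => h'⟩
    · exact ⟨z, z, fun h1 h2 => absurd ⟨h1, h2⟩ h⟩
  choose s t hst using h2'
  let S := (List.range k).map fun i => s (i + 1)
  obtain ⟨l, hldef⟩ : ∃ l, l = t 1 := ⟨_, rfl⟩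
  have hl : f l = 1 := by rw [hldef]; exact (hst 1 le_rfl (by omega)).2.1
  obtain ⟨T, hTn, hTm, hTs⟩ := exists_sorted_list f
    (fun v => v ≠ l ∧ v ∉ S ∧ 1 ≤ f v ∧ f v ≤ k)
  obtain ⟨B₀, hB₀n, hB₀m, -⟩ := exists_sorted_list f (fun v => f v = 0)
  obtain ⟨B₁, hB₁n, hB₁m, -⟩ := exists_sorted_list f (fun v => v ≠ r ∧ f v = k + 1)
  have hS : ∀ v, v ∈ S ↔ ∃ i, 1 ≤ i ∧ i ≤ k ∧ s i = v := by
    intro v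
    simp only [S, List.mem_map, List.mem_range]
    exact ⟨fun ⟨i, h, e⟩ => ⟨i + 1, by omega, by omega, e⟩,
      fun ⟨i, h, h', e⟩ => ⟨i - 1, by omega, by rwa [Nat.sub_add_cancel h]⟩⟩
  have hSn : S.Nodup := by
    refine List.Nodup.map_on ?_ List.nodup_range
    intro i hi j hj h
    simp at hi hj
    have h1 := (hst (i + 1) (by omega) (by omega)).1
    have h2 := (hst (j + 1) (by omega) (by omega)).1
    rw [h] at h1; omega
  have hfS : ∀ v ∈ S, 1 ≤ f v ∧ f v ≤ k := by
    intro v hv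
    obtain ⟨i, hi, hi', rfl⟩ := (hS v).1 hv
    rw [(hst i hi hi').1]; exact ⟨hi, hi'⟩
  have htS : ∀ i, 1 ≤ i → i ≤ k → t i ∉ S := by
    intro i hi hi' h
    have h1 := hst i hi hi'
    obtain ⟨j, hj, hj', e⟩ := (hS _).1 h
    have h2 := hst j hj hj'
    have : i = j := by rw [← h1.2.1, ← h2.1, e]
    subst this
    exact h1.2.2 e
  have hlS : l ∉ S := hldef ▸ htS 1 le_rfl (by omega)
  have hrS : r ∉ S := fun h => by have := hfS r h; omega
  have hlr : l ≠ r := by rintro rfl; omega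
  have htT : ∀ i, 2 ≤ i → i ≤ k → t i ∈ T := by
    intro i hi hi'
    have h1 := hst i (by omega) hi'
    rw [hTm]
    refine ⟨?_, htS i (by omega) hi', by omega, by omega⟩
    intro h
    have := h1.2.1
    rw [h] at this; omega
  let cl : V → ℕ := fun v => max 1 (min k (f v))
  have hcl : ∀ v, 1 ≤ cl v ∧ cl v ≤ k ∧ f v ≤ cl v + 1 ∧ cl v ≤ f v + 1 := by
    intro v
    have := hf v
    simp only [cl]; omega
  have hSget : ∀ v, S[cl v - 1]? = some (s (cl v)) := by
    intro v
    have := hcl v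
    rw [List.getElem?_eq_getElem (by simp [S]; omega)]
    simp only [S, List.getElem_map, List.getElem_range]
    rw [Nat.sub_add_cancel this.1]
  have hpar : ∀ v, v ∉ S → s (cl v) ∈ S ∧ G.Adj (s (cl v)) v := by
    intro v hv
    have h1 := hcl v
    have h2 := (hst _ h1.1 h1.2.1).1
    have h3 : s (cl v) ∈ S := (hS _).2 ⟨_, h1.1, h1.2.1, rfl⟩
    exact ⟨h3, hadj _ _ (fun h => hv (h ▸ h3)) (by omega) (by omega)⟩
  have hT1 : ∀ v ∈ T, v ≠ l ∧ v ∉ S ∧ 1 ≤ f v ∧ f v ≤ k := fun v => (hTm v).1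
  have hB0' : ∀ v ∈ B₀, f v = 0 := fun v => (hB₀m v).1
  have hB1' : ∀ v ∈ B₁, v ≠ r ∧ f v = k + 1 := fun v => (hB₁m v).1
  refine hasSpanningHalinSubgraph_of_strip G l r S T (B₀ ++ B₁) (fun v => s (cl v))
    ?_ ?_ ?_ ?_ ?_ ?_ ?_ ?_ ?_ ?_ ?_
  · refine nodup_strip hSn hTn ?_ hlr
      (fun v hv => ⟨fun h => hlS (h ▸ hv), fun h => hrS (h ▸ hv)⟩) ?_ ?_
    · rw [List.nodup_append]
      refine ⟨hB₀n, hB₁n, fun u hu v hv h => ?_⟩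
      have h1 := hB0' u hu
      have h2 := (hB1' v hv).2
      rw [h] at h1; omega
    · intro v hv
      rcases List.mem_append.1 hv with hv | hv
      · have h1 := hB0' v hv
        refine ⟨by rintro rfl; omega, by rintro rfl; omega, fun h => ?_⟩
        have := hfS v h; omega
      · have h1 := hB1' v hv
        refine ⟨by rintro rfl; omega, h1.1, fun h => ?_⟩
        have := hfS v h; omega
    · intro v hv
      have h1 := hT1 v hv
      refine ⟨h1.1, by rintro rfl; omega, h1.2.1, fun h => ?_⟩
      rcases List.mem_append.1 h with h | h
      · have := hB0' v h; omega
      · have := hB1' v h; omega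
  · intro v
    have := hf v
    simp only [List.mem_cons, List.mem_append, hTm, hB₀m, hB₁m]
    by_cases c1 : v = l
    · exact Or.inl c1
    by_cases c2 : v = r
    · exact Or.inr (Or.inl c2)
    by_cases c3 : v ∈ S
    · exact Or.inr (Or.inr (Or.inl c3))
    simp only [c1, c2, c3, false_or, ne_eq, not_false_eq_true, true_and]
    omega
  · refine isChain_spine hadj (by omega) (fun i hi hi' => (hst i hi hi').1) ?_ ?_
    · have h1 := hst 1 le_rfl (by omega)
      exact hadj _ _ (hldef ▸ h1.2.2.symm) (by omega) (by omega)
    · have h1 := (hst k (by omega) le_rfl).1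
      refine hadj _ _ (fun h => ?_) (by omega) (by omega)
      rw [h] at h1; omega
  · refine isChain_of_sorted hadj ?_ ?_ ?_
    · refine nodup_ends hTn hlr fun v hv => ⟨(hT1 v hv).1, ?_⟩
      rintro rfl
      have := hT1 _ hv; omega
    · rw [List.pairwise_cons, List.pairwise_append]
      refine ⟨?_, hTs, by simp, ?_⟩
      · intro v hv
        simp at hv
        rcases hv with hv | rfl
        · have := hT1 v hv; omega
        · omega
      · intro v _ w hw
        simp at hw
        have := hf v
        rw [hw]; omega
    · intro a ha c hc hac
      have hfc := hf c
      have hfa : 1 ≤ f a := by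
        simp at ha
        rcases ha with rfl | ha | rfl
        · omega
        · exact (hT1 a ha).2.2.1
        · omega
      rcases Nat.lt_or_ge k (f a + 1) with h | h
      · exact ⟨r, by simp, by omega⟩
      · exact ⟨t (f a + 1), by simp [htT (f a + 1) (by omega) h],
          (hst _ (by omega) h).2.1⟩
  · have hB₀c : B₀.IsChain G.Adj := by
      refine isChain_of_clique hB₀n ?_
      intro u hu v hv hne
      have := hB0' u hu
      have := hB0' v hv
      exact hadj _ _ hne (by omega) (by omega)
    have hB₁c : (B₁ ++ [r]).IsChain G.Adj := by
      refine isChain_of_clique ?_ ?_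
      · rw [List.nodup_append]
        refine ⟨hB₁n, List.nodup_singleton r, fun u hu v hv h => ?_⟩
        simp at hv
        exact (hB1' u hu).1 (h.trans hv)
      · have hB1f : ∀ v ∈ B₁ ++ [r], f v = k + 1 := by
          intro v hv
          simp at hv
          rcases hv with hv | rfl
          · exact (hB1' v hv).2
          · exact hr
        intro u hu v hv hne
        have := hB1f u hu
        have := hB1f v hv
        exact hadj _ _ hne (by omega) (by omega)
    have hz' : z ∈ B₀ := (hB₀m z).2 hz
    rw [List.append_assoc, ← List.cons_append]
    refine List.IsChain.append (hB₀c.cons ?_) hB₁c ?_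
    · intro y hy
      have := hB0' y (List.mem_of_mem_head? hy)
      exact hadj _ _ (by rintro rfl; omega) (by omega) (by omega)
    · intro x hx y hy
      have hx' : f x = 0 := by
        have : (l :: B₀).getLast? = B₀.getLast? := by
          cases B₀ with
          | nil => simp at hz'
          | cons w W => simp
        rw [this] at hx
        exact hB0' x (List.mem_of_getLast? hx)
      have hy' : f y = k + 1 := by
        have := List.mem_of_mem_head? hy
        simp at this
        rcases this with h | rfl
        · exact (hB1' y h).2
        · exact hr
      exact hclose x y hx' hy'
  · exact List.ne_nil_of_mem (htT 2 le_rfl hk)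
  · exact List.ne_nil_of_mem (List.mem_append_left _ ((hB₀m z).2 hz))
  · rintro v (hv | hv)
    · exact hpar v (hT1 v hv).2.1
    · refine hpar v fun h => ?_
      have := hfS v h
      rcases List.mem_append.1 hv with hv | hv
      · have := hB0' v hv; omega
      · have := hB1' v hv; omega
  · refine hTs.imp ?_
    intro a c h
    exact ⟨_, _, hSget a, hSget c, by simp only [cl]; omega⟩
  · have hall : (B₀ ++ B₁).Pairwise fun a c => f a ≤ f c := by
      rw [List.pairwise_append]
      refine ⟨hB₀n.imp_of_mem ?_, hB₁n.imp_of_mem ?_, ?_⟩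
      · intro a c ha hc _
        rw [hB0' a ha, hB0' c hc]
      · intro a c ha hc _
        rw [(hB1' a ha).2, (hB1' c hc).2]
      · intro a ha c hc
        rw [hB0' a ha]; omega
    refine hall.imp ?_
    intro a c h
    exact ⟨_, _, hSget a, hSget c, by simp only [cl]; omega⟩
  · intro v hv
    obtain ⟨i, hi, hi', rfl⟩ := (hS v).1 hv
    rcases Nat.lt_or_ge i 2 with h | h
    · have : i = 1 := by omega
      subst this
      refine ⟨z, Or.inr (List.mem_append_left _ ((hB₀m z).2 hz)), ?_⟩
      have : cl z = 1 := by simp only [cl]; rw [hz]; omega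
      simp only [this]
    · refine ⟨t i, Or.inl (htT i h hi'), ?_⟩
      have : cl (t i) = i := by simp only [cl]; rw [(hst i hi hi').2.1]; omega
      simp only [this]

end

/-! ### Strips from representatives -/

section

variable {V : Type*} {G : SimpleGraph V}

/-- `hasSpanningHalinSubgraph_of_blocks` with the vertices of the strip given in any order. -/
theorem hasSpanningHalinSubgraph_of_blocks_perm [Fintype V] (l r : V)
    (bl : List (V × List V × List V)) {L : List V} (hL : L.Nodup) (hcov : ∀ v, v ∈ L)
    (hp : (l :: r :: (bl.map (·.1) ++ (bl.flatMap (·.2.1) ++ bl.flatMap (·.2.2)))).Perm L)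
    (hS : (l :: (bl.map (·.1) ++ [r])).IsChain G.Adj)
    (hT : (l :: (bl.flatMap (·.2.1) ++ [r])).IsChain G.Adj)
    (hB : (l :: (bl.flatMap (·.2.2) ++ [r])).IsChain G.Adj)
    (hT0 : bl.flatMap (·.2.1) ≠ []) (hB0 : bl.flatMap (·.2.2) ≠ [])
    (hadj : ∀ b ∈ bl, ∀ t, t ∈ b.2.1 ∨ t ∈ b.2.2 → G.Adj b.1 t)
    (hdeg : ∀ b ∈ bl, b.2.1 ≠ [] ∨ b.2.2 ≠ []) : HasSpanningHalinSubgraph G :=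
  hasSpanningHalinSubgraph_of_blocks G l r bl (hp.nodup_iff.2 hL)
    (fun v => hp.mem_iff.2 (hcov v)) hS hT hB hT0 hB0 hadj hdeg

theorem isChain_insert {a b : V} {L R : List V} (h : (a :: b :: R).IsChain G.Adj)
    (hL : L.IsChain G.Adj) (ha : ∀ v ∈ L, G.Adj a v) (hb : ∀ v ∈ L, G.Adj v b) :
    (a :: (L ++ b :: R)).IsChain G.Adj := by
  rcases L with _ | ⟨c, L⟩
  · exact h
  · rw [List.cons_append, List.isChain_cons_cons]
    refine ⟨ha c (by simp), ?_⟩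
    rw [← List.cons_append]
    refine hL.append (List.isChain_cons_cons.1 h).2 ?_
    intro u hu v hv
    simp at hv
    exact hv ▸ hb u (List.mem_of_getLast? hu)

/-- A spine `x, p₀, q₀` whose leaf cycle runs through `p, M, p₁, q₁` on one side and through the
rest of the clique `q₀, q₁, q₂, R` on the other. -/
theorem hasSpanningHalinSubgraph_of_reps [Fintype V] {x p₀ p₁ p q₀ q₁ q₂ : V} {M R : List V}
    (hnd : (x :: p₀ :: p₁ :: (M ++ p :: q₀ :: q₁ :: q₂ :: R)).Nodup)
    (hcov : ∀ v, v ∈ x :: p₀ :: p₁ :: (M ++ p :: q₀ :: q₁ :: q₂ :: R))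
    (hch : (p₁ :: (M ++ [p])).IsChain G.Adj) (hM : M ≠ []) (hx₀ : G.Adj x p₀)
    (hxM : ∀ v ∈ M, G.Adj x v) (hxp : G.Adj x p) (h₀₁ : G.Adj p₀ p₁) (h₀ : G.Adj p₀ q₀)
    (h₁ : G.Adj p₁ q₁) (h₂ : G.Adj p q₂)
    (hQ : ∀ u ∈ q₀ :: q₁ :: q₂ :: R, ∀ v ∈ q₀ :: q₁ :: q₂ :: R, u ≠ v → G.Adj u v) :
    HasSpanningHalinSubgraph G := by
  have hndQ : (q₀ :: q₁ :: q₂ :: R).Nodup :=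
    (List.nodup_append.1 hnd.of_cons.of_cons.of_cons).2.1.of_cons
  have n01 : q₀ ≠ q₁ := by simp at hndQ; tauto
  have hR : ∀ v ∈ q₂ :: R, v ≠ q₀ ∧ v ≠ q₁ := by
    intro v hv
    simp only [List.nodup_cons] at hndQ
    exact ⟨fun h => hndQ.1 (List.mem_cons_of_mem _ (h ▸ hv)), fun h => hndQ.2.1 (h ▸ hv)⟩
  have hmQ : ∀ v ∈ q₂ :: R, v ∈ q₀ :: q₁ :: q₂ :: R := fun v hv =>
    List.mem_cons_of_mem _ (List.mem_cons_of_mem _ hv)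
  refine hasSpanningHalinSubgraph_of_blocks_perm p q₁
    [(x, M.reverse, []), (p₀, [p₁], []), (q₀, [], q₂ :: R)] hnd hcov ?_ ?_ ?_ ?_ (by simp)
    (by simp) ?_ ?_
  · classical
    rw [List.perm_iff_count]
    intro a
    simp [List.count_cons, List.count_append]
    omega
  · simp [hxp.symm, hx₀, h₀, hQ q₀ (by simp) q₁ (by simp) n01]
  · have h := isChain_adj_reverse hch
    simp only [List.reverse_cons, List.reverse_append, List.reverse_nil, List.nil_append] at h
    have : ((p :: (M.reverse ++ [p₁])) ++ [q₁]).IsChain G.Adj := by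
      refine List.IsChain.append (by simpa using h) (by simp) ?_
      intro u hu v hv
      have e : (p :: (M.reverse ++ [p₁])).getLast? = some p₁ := by
        rw [← List.cons_append, List.getLast?_append]; simp
      rw [e] at hu
      simp at hu hv
      subst hu hv; exact h₁
    simpa using this
  · have hR' : (q₂ :: R).IsChain G.Adj := isChain_of_clique hndQ.of_cons.of_cons
      fun u hu v hv => hQ u (hmQ u hu) v (hmQ v hv)
    have : ((q₂ :: R) ++ [q₁]).IsChain G.Adj := by
      refine hR'.append (by simp) ?_
      intro u hu v hv
      simp at hv
      have hu := List.mem_of_getLast? hu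
      exact hv ▸ hQ u (hmQ u hu) q₁ (by simp) (hR u hu).2
    simpa using ⟨h₂, this⟩
  · intro b hb t ht
    simp only [List.mem_cons, List.not_mem_nil, or_false] at hb
    rcases hb with rfl | rfl | rfl
    · simp at ht; exact hxM t ht
    · simp at ht; exact ht ▸ h₀₁
    · simp only [List.not_mem_nil, false_or] at ht
      exact hQ q₀ (by simp) t (hmQ t ht) (hR t ht).1.symm
  · simp [hM]

/-- A spine `p₁, q₁` whose leaf cycle runs through the clique `X` on one side and through the
rest of the clique `q₀, q₁, q₂, R` on the other. -/
theorem hasSpanningHalinSubgraph_of_reps_triple [Fintype V] {p₀ p₁ p q₀ q₁ q₂ : V} {X R : List V}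
    (hnd : (X ++ p₀ :: p₁ :: p :: q₀ :: q₁ :: q₂ :: R).Nodup)
    (hcov : ∀ v, v ∈ X ++ p₀ :: p₁ :: p :: q₀ :: q₁ :: q₂ :: R)
    (hX0 : X ≠ []) (hX : X.IsChain G.Adj)
    (hXp : ∀ v ∈ X, G.Adj v p₀ ∧ G.Adj v p₁ ∧ G.Adj v p) (h₀₁ : G.Adj p₀ p₁) (h₁p : G.Adj p₁ p)
    (h₀ : G.Adj p₀ q₀) (h₁ : G.Adj p₁ q₁) (h₂ : G.Adj p q₂)
    (hQ : ∀ u ∈ q₀ :: q₁ :: q₂ :: R, ∀ v ∈ q₀ :: q₁ :: q₂ :: R, u ≠ v → G.Adj u v) :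
    HasSpanningHalinSubgraph G := by
  have hndQ : (q₀ :: q₁ :: q₂ :: R).Nodup :=
    (List.nodup_append.1 hnd).2.1.of_cons.of_cons.of_cons
  have n01 : q₀ ≠ q₁ := by simp at hndQ; tauto
  have hR : ∀ v ∈ q₂ :: R, v ≠ q₀ ∧ v ≠ q₁ := by
    intro v hv
    simp only [List.nodup_cons] at hndQ
    exact ⟨fun h => hndQ.1 (List.mem_cons_of_mem _ (h ▸ hv)), fun h => hndQ.2.1 (h ▸ hv)⟩
  have hmQ : ∀ v ∈ q₂ :: R, v ∈ q₀ :: q₁ :: q₂ :: R := fun v hv =>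
    List.mem_cons_of_mem _ (List.mem_cons_of_mem _ hv)
  refine hasSpanningHalinSubgraph_of_blocks_perm p q₀
    [(p₁, X ++ [p₀], []), (q₁, [], q₂ :: R)] hnd hcov ?_ ?_ ?_ ?_ (by simp) (by simp) ?_ (by simp)
  · classical
    rw [List.perm_iff_count]
    intro a
    simp [List.count_cons, List.count_append]
    omega
  · simp [h₁p.symm, h₁, (hQ q₀ (by simp) q₁ (by simp) n01).symm]
  · have h : (X ++ [p₀, q₀]).IsChain G.Adj := by
      refine hX.append (by simp [h₀]) ?_
      intro u hu v hv
      simp at hv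
      exact hv ▸ (hXp u (List.mem_of_getLast? hu)).1
    have h' : (p :: (X ++ [p₀, q₀])).IsChain G.Adj := by
      refine h.cons ?_
      intro y hy
      have : y ∈ X := by
        obtain ⟨c, X, rfl⟩ := List.exists_cons_of_ne_nil hX0
        simp at hy
        simp [hy]
      exact (hXp y this).2.2.symm
    simpa using h'
  · have hR' : (q₂ :: R).IsChain G.Adj := isChain_of_clique hndQ.of_cons.of_cons
      fun u hu v hv => hQ u (hmQ u hu) v (hmQ v hv)
    have : ((q₂ :: R) ++ [q₀]).IsChain G.Adj := by
      refine hR'.append (by simp) ?_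
      intro u hu v hv
      simp at hv
      have hu := List.mem_of_getLast? hu
      exact hv ▸ hQ u (hmQ u hu) q₀ (by simp) (hR u hu).1
    simpa using ⟨h₂, this⟩
  · intro b hb t ht
    simp only [List.mem_cons, List.not_mem_nil, or_false] at hb
    rcases hb with rfl | rfl
    · simp at ht
      rcases ht with ht | rfl
      · exact (hXp t ht).2.1.symm
      · exact h₀₁.symm
    · simp only [List.not_mem_nil, false_or] at ht
      exact hQ q₁ (by simp) t (hmQ t ht) (hR t ht).2.symm

/-- A spine `x, p₀` whose leaf cycle runs through `p, M, p₁, q'` on one side and through `q` on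
the other. -/
theorem hasSpanningHalinSubgraph_of_reps_pair [Fintype V] {x p₀ p₁ p q q' : V} {M : List V}
    (hnd : (x :: p₀ :: p₁ :: (M ++ [p, q, q'])).Nodup)
    (hcov : ∀ v, v ∈ x :: p₀ :: p₁ :: (M ++ [p, q, q']))
    (hch : (p₁ :: (M ++ [p])).IsChain G.Adj) (hx₀ : G.Adj x p₀) (hx₁ : G.Adj x p₁)
    (hxM : ∀ v ∈ M, G.Adj x v) (hxp : G.Adj x p) (h₀ : G.Adj p₀ q) (h₀' : G.Adj p₀ q')
    (h₁ : G.Adj p₁ q') (h₂ : G.Adj p q) (hq : G.Adj q q') : HasSpanningHalinSubgraph G := by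
  refine hasSpanningHalinSubgraph_of_blocks_perm p q'
    [(x, M.reverse ++ [p₁], []), (p₀, [], [q])] hnd hcov ?_ ?_ ?_ ?_ (by simp) (by simp) ?_
    (by simp)
  · classical
    rw [List.perm_iff_count]
    intro a
    simp [List.count_cons, List.count_append]
    omega
  · simp [hxp.symm, hx₀, h₀']
  · have h := isChain_adj_reverse hch
    simp only [List.reverse_cons, List.reverse_append, List.reverse_nil, List.nil_append] at h
    have : ((p :: (M.reverse ++ [p₁])) ++ [q']).IsChain G.Adj := by
      refine List.IsChain.append (by simpa using h) (by simp) ?_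
      intro u hu v hv
      have e : (p :: (M.reverse ++ [p₁])).getLast? = some p₁ := by
        rw [← List.cons_append, List.getLast?_append]; simp
      rw [e] at hu
      simp at hu hv
      subst hu hv; exact h₁
    simpa using this
  · simp [h₂, hq]
  · intro b hb t ht
    simp only [List.mem_cons, List.not_mem_nil, or_false] at hb
    rcases hb with rfl | rfl
    · simp at ht
      rcases ht with ht | rfl
      · exact hxM t ht
      · exact hx₁
    · simp at ht; exact ht ▸ h₀

/-- A spine `p, q` whose leaf cycle runs from `x` to `q₁` through `A, a` on one side and through
`C, c, R` on the other. -/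
theorem hasSpanningHalinSubgraph_of_sides [Fintype V] {x p q q₁ a c : V} {A C R : List V}
    (hnd : (x :: p :: q :: q₁ :: a :: c :: (A ++ (C ++ R))).Nodup)
    (hcov : ∀ v, v ∈ x :: p :: q :: q₁ :: a :: c :: (A ++ (C ++ R)))
    (hxp : G.Adj x p) (hxA : ∀ v ∈ A ++ [a], G.Adj x v) (hxC : ∀ v ∈ C ++ [c], G.Adj x v)
    (hpA : ∀ v ∈ A ++ [a], G.Adj p v) (hA : (A ++ [a]).IsChain G.Adj)
    (hqC : ∀ v ∈ C ++ [c], G.Adj q v) (hC : (C ++ [c]).IsChain G.Adj) (hpq : G.Adj p q)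
    (hqR : ∀ v ∈ R ++ [q₁], G.Adj q v) (hR : (c :: (R ++ [q₁])).IsChain G.Adj)
    (ha : G.Adj a q₁) : HasSpanningHalinSubgraph G := by
  refine hasSpanningHalinSubgraph_of_blocks_perm x q₁
    [(p, A ++ [a], []), (q, [], (C ++ [c]) ++ R)] hnd hcov ?_ ?_ ?_ ?_ (by simp) (by simp) ?_
    (by simp)
  · classical
    rw [List.perm_iff_count]
    intro a
    simp [List.count_cons, List.count_append]
    omega
  · simp [hxp, hpq, hqR]
  · have h : ((A ++ [a]) ++ [q₁]).IsChain G.Adj := hA.append (by simp) (by simpa using ha)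
    have h' : (x :: ((A ++ [a]) ++ [q₁])).IsChain G.Adj := by
      refine h.cons ?_
      intro y hy
      exact hxA y (List.mem_of_mem_head? (by rwa [List.head?_append_of_ne_nil _ (by simp)] at hy))
    simpa using h'
  · have h : (C ++ c :: (R ++ [q₁])).IsChain G.Adj := by
      have h1 := (List.isChain_append.1 hC)
      refine h1.1.append hR ?_
      intro u hu v hv
      exact h1.2.2 u hu v (by simpa using hv)
    have h' : (x :: (C ++ c :: (R ++ [q₁]))).IsChain G.Adj := by
      refine h.cons ?_
      intro y hy
      refine hxC y ?_
      cases C with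
      | nil => simp at hy ⊢; exact hy.symm
      | cons d C => simp at hy ⊢; exact Or.inl hy.symm
    simpa using h'
  · intro b hb t ht
    simp only [List.mem_cons, List.not_mem_nil, or_false] at hb
    rcases hb with rfl | rfl
    · simp only [List.not_mem_nil, or_false] at ht; exact hpA t ht
    · simp only [List.not_mem_nil, false_or] at ht
      rcases List.mem_append.1 ht with ht | ht
      · exact hqC t ht
      · exact hqR t (List.mem_append_left _ ht)

/-- `L` lists the elements of `A` without repetition. -/
def Lists (A : Set V) (L : List V) : Prop := L.Nodup ∧ ∀ v, v ∈ L ↔ v ∈ A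

theorem exists_lists_append [Fintype V] {A : Set V} {K : List V} (hK : K.Nodup)
    (hKA : ∀ v ∈ K, v ∈ A) : ∃ L, Lists A (K ++ L) := by
  classical
  refine ⟨(Finset.univ.filter fun v => v ∈ A ∧ v ∉ K).toList, ?_, ?_⟩
  · rw [List.nodup_append]
    refine ⟨hK, Finset.nodup_toList _, ?_⟩
    rintro u hu v hv rfl
    simp at hv
    exact hv.2 hu
  · intro v
    by_cases h : v ∈ K
    · simp [h, hKA v h]
    · simp [h]

theorem Lists.perm {A : Set V} {L L' : List V} (h : Lists A L) (hp : L.Perm L') : Lists A L' :=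
  ⟨hp.nodup_iff.1 h.1, fun v => by rw [← hp.mem_iff, h.2]⟩

theorem Lists.append {A B : Set V} {L L' : List V} (h : Lists A L) (h' : Lists B L')
    (hd : ∀ v ∈ A, v ∉ B) : Lists (A ∪ B) (L ++ L') := by
  refine ⟨List.nodup_append.2 ⟨h.1, h'.1, ?_⟩, ?_⟩
  · rintro u hu v hv rfl
    exact hd u ((h.2 u).1 hu) ((h'.2 u).1 hv)
  · intro v
    rw [List.mem_append, h.2, h'.2]; rfl

end

/-! ### Graphs without independent triples -/

/-- The partition of the vertex set seen from a vertex with the largest number of nonneighbours: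
`Q` is the set of its nonneighbours, `X` the set of vertices with exactly these nonneighbours, and
`N` the rest. -/
structure AntipodalPartition {V : Type*} (G : SimpleGraph V) (X N Q : Set V) : Prop where
  cover : ∀ v, v ∈ X ∨ v ∈ N ∨ v ∈ Q
  notMem_N : ∀ v ∈ X, v ∉ N
  notMem_Q : ∀ v ∈ X, v ∉ Q
  notMem_Q_of_N : ∀ v ∈ N, v ∉ Q
  adj_X : ∀ u ∈ X, ∀ v ∈ X, u ≠ v → G.Adj u v
  adj_X_N : ∀ u ∈ X, ∀ v ∈ N, G.Adj u v
  not_adj_X_Q : ∀ u ∈ X, ∀ v ∈ Q, ¬ G.Adj u v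
  adj_Q : ∀ u ∈ Q, ∀ v ∈ Q, u ≠ v → G.Adj u v
  exists_adj_Q : ∀ u ∈ N, ∃ q ∈ Q, G.Adj u q
  /-- No vertex has more than `|Q|` nonneighbours. -/
  bound : ∀ (v : V) (L K : List V), L.Nodup → (∀ w ∈ L, w ≠ v ∧ ¬ G.Adj v w) →
    (∀ w ∈ Q, w ∈ K) → L.length ≤ K.length

section

variable {V : Type*} {G : SimpleGraph V}

theorem exists_antipodalPartition [Fintype V] [Nonempty V] (hα : NoIndepTriple G) :
    ∃ X N Q : Set V, X.Nonempty ∧ AntipodalPartition G X N Q := by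
  classical
  let D : V → Finset V := fun v => Finset.univ.filter fun w => w ≠ v ∧ ¬ G.Adj v w
  have hD : ∀ v w, w ∈ D v ↔ w ≠ v ∧ ¬ G.Adj v w := by simp [D]
  obtain ⟨x, hx⟩ := Finite.exists_max fun v => (D v).card
  have hXQ : ∀ v, D v = D x → v ∉ D x := by
    intro v hv h
    rw [← hv, hD] at h
    exact h.1 rfl
  refine ⟨{v | D v = D x}, {v | v ∉ D x ∧ D v ≠ D x}, {v | v ∈ D x}, ⟨x, rfl⟩, ?_, ?_, ?_, ?_, ?_,
    ?_, ?_, ?_, ?_, ?_⟩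
  · intro v
    simp only [Set.mem_ofPred_eq]
    tauto
  · exact fun v hv h => h.2 hv
  · exact hXQ
  · exact fun v hv => hv.1
  · intro u hu v hv hne
    by_contra h
    have : v ∈ D u := (hD u v).2 ⟨hne.symm, h⟩
    rw [show D u = D x from hu] at this
    exact hXQ v hv this
  · intro u hu v hv
    by_contra h
    have : v ∈ D u := (hD u v).2 ⟨by rintro rfl; exact hv.2 hu, h⟩
    rw [show D u = D x from hu] at this
    exact hv.1 this
  · intro u hu v hv
    have : v ∈ D u := by rw [show D u = D x from hu]; exact hv
    exact ((hD u v).1 this).2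
  · intro u hu v hv hne
    have hu := (hD x u).1 hu
    have hv := (hD x v).1 hv
    rcases hα x u v hu.1.symm hv.1.symm hne with h | h | h
    · exact absurd h hu.2
    · exact absurd h hv.2
    · exact h
  · intro u hu
    by_contra! h
    refine hu.2 (Finset.eq_of_subset_of_card_le ?_ (hx u)).symm
    intro q hq
    exact (hD u q).2 ⟨by rintro rfl; exact hu.1 hq, h q hq⟩
  · intro v L K hL hLv hK
    calc L.length = L.toFinset.card := (List.toFinset_card_of_nodup hL).symm
      _ ≤ (D v).card := Finset.card_le_card fun w hw => (hD v w).2 (hLv w (List.mem_toFinset.1 hw))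
      _ ≤ (D x).card := hx v
      _ ≤ K.toFinset.card := Finset.card_le_card fun w hw => List.mem_toFinset.2 (hK w hw)
      _ ≤ K.length := K.toFinset_card_le

variable {X N Q : Set V}

theorem isChain_insert_front {a b : V} {L M : List V} (h : (a :: (M ++ [b])).IsChain G.Adj)
    (hL : L.IsChain G.Adj) (ha : ∀ v ∈ L, G.Adj a v) (hb : ∀ v ∈ L, ∀ w ∈ M ++ [b], G.Adj v w) :
    (a :: ((L ++ M) ++ [b])).IsChain G.Adj := by
  rw [List.append_assoc]
  cases M with
  | nil => exact isChain_insert h hL ha fun v hv => hb v hv b (by simp)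
  | cons c M => exact isChain_insert h hL ha fun v hv => hb v hv c (by simp)

namespace AntipodalPartition

theorem lists (P : AntipodalPartition G X N Q) {LX LN LQ : List V} (hX : Lists X LX)
    (hN : Lists N LN) (hQ : Lists Q LQ) : Lists Set.univ (LX ++ (LN ++ LQ)) := by
  have h := hX.append (hN.append hQ P.notMem_Q_of_N) (fun v hv h => by
    rcases h with h | h
    · exact P.notMem_N v hv h
    · exact P.notMem_Q v hv h)
  refine ⟨h.1, fun v => ?_⟩
  rw [h.2]
  have := P.cover v
  simpa using this

theorem exists_ne_ne [Fintype V] (P : AntipodalPartition G X N Q) (hG : IsKConnected 3 G) {x q : V}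
    (hx : x ∈ X) (hq : q ∈ Q) (y z : V) : ∃ p ∈ N, p ≠ y ∧ p ≠ z := by
  classical
  have hstep : ∀ y z, y ≠ x → y ≠ q → z ≠ x → z ≠ q → ∃ p ∈ N, p ≠ y ∧ p ≠ z := by
    intro y z h1 h2 h3 h4
    obtain ⟨u, v, hu, hv, -, -, hvy, hvz, huv⟩ := hG.exists_adj_across X (y := y) (z := z) hx
      h1.symm h3.symm (fun h => P.notMem_Q q h hq) h2.symm h4.symm
    rcases P.cover v with h | h | h
    · exact absurd h hv
    · exact ⟨v, h, hvy, hvz⟩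
    · exact absurd huv (P.not_adj_X_Q u hu v h)
  obtain ⟨d, hd⟩ : ∃ d, d ∉ ({x, q} : Finset V) := by
    by_contra! h
    have h1 : (Finset.univ : Finset V).card ≤ ({x, q} : Finset V).card :=
      Finset.card_le_card fun v _ => h v
    have h2 := hG.1
    have h3 : ({x, q} : Finset V).card ≤ 2 := Finset.card_le_two
    rw [Finset.card_univ] at h1
    omega
  simp at hd
  have hrep : ∀ y, ∃ y', y' ≠ x ∧ y' ≠ q ∧ ∀ p ∈ N, p ≠ y' → p ≠ y := by
    intro y
    by_cases hy : y ∈ N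
    · exact ⟨y, fun h => P.notMem_N x hx (h ▸ hy), fun h => P.notMem_Q_of_N q (h ▸ hy) hq,
        fun _ _ h => h⟩
    · exact ⟨d, hd.1, hd.2, fun p hp _ h => hy (h ▸ hp)⟩
  obtain ⟨y', hy1, hy2, hy⟩ := hrep y
  obtain ⟨z', hz1, hz2, hz⟩ := hrep z
  obtain ⟨p, hp, h1, h2⟩ := hstep y' z' hy1 hy2 hz1 hz2
  exact ⟨p, hp, hy p hp h1, hz p hp h2⟩

theorem exists_adj_ne_ne [Fintype V] (P : AntipodalPartition G X N Q) (hG : IsKConnected 3 G)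
    (hX : X.Nonempty) (hQ3 : ∀ a b, ∃ c ∈ Q, c ≠ a ∧ c ≠ b) (y z : V) (hy : y ∈ N ∨ y ∈ Q)
    (hz : z ∈ N ∨ z ∈ Q) : ∃ p ∈ N, ∃ q ∈ Q, p ≠ y ∧ p ≠ z ∧ q ≠ y ∧ q ≠ z ∧ G.Adj p q := by
  obtain ⟨x, hx⟩ := hX
  obtain ⟨q, hq, hqy, hqz⟩ := hQ3 y z
  have hne : ∀ y, y ∈ N ∨ y ∈ Q → x ≠ y := by
    rintro y (h | h) rfl
    · exact P.notMem_N x hx h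
    · exact P.notMem_Q x hx h
  obtain ⟨u, v, hu, hv, huy, huz, hvy, hvz, huv⟩ := hG.exists_adj_across Q hq hqy hqz
    (P.notMem_Q x hx) (hne y hy) (hne z hz)
  rcases P.cover v with h | h | h
  · exact absurd huv.symm (P.not_adj_X_Q v h u hu)
  · exact ⟨v, h, u, hu, hvy, hvz, huy, huz, huv.symm⟩
  · exact absurd h hv

theorem isChain_lists (P : AntipodalPartition G X N Q) {L L' : List V} (h : Lists X (L ++ L')) :
    L'.IsChain G.Adj :=
  isChain_of_clique (List.nodup_append.1 h.1).2.1 fun u hu v hv =>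
    P.adj_X u ((h.2 u).1 (List.mem_append_right _ hu)) v ((h.2 v).1 (List.mem_append_right _ hv))

theorem of_goodPath [Fintype V] (P : AntipodalPartition G X N Q) (hX : X.Nonempty)
    (h : HasGoodPath G N Q) : HasSpanningHalinSubgraph G := by
  classical
  obtain ⟨x, hx⟩ := hX
  obtain ⟨p₀, p₁, M, p, hM, q₀, q₁, q₂, hq₀, hq₁, hq₂, h01, h02, h12, a₀, a₁, a₂⟩ := h
  obtain ⟨X', hX'⟩ := exists_lists_append (A := X) (K := [x]) (by simp) (by simpa using hx)
  obtain ⟨R, hR⟩ := exists_lists_append (A := Q) (K := [q₀, q₁, q₂]) (by simp [h01, h02, h12])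
    (by simp [hq₀, hq₁, hq₂])
  have hL := P.lists hX' ⟨hM.1, hM.2.1⟩ hR
  have hQc : ∀ u ∈ q₀ :: q₁ :: q₂ :: R, ∀ v ∈ q₀ :: q₁ :: q₂ :: R, u ≠ v → G.Adj u v :=
    fun u hu v hv => P.adj_Q u ((hR.2 u).1 hu) v ((hR.2 v).1 hv)
  have hmN : ∀ v ∈ p₀ :: p₁ :: (M ++ [p]), ∀ u ∈ X, G.Adj u v := fun v hv u hu =>
    P.adj_X_N u hu v ((hM.2.1 v).1 hv)
  rcases eq_or_ne M [] with rfl | hM0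
  · have hc := hM.2.2
    simp at hc
    refine hasSpanningHalinSubgraph_of_reps_triple (X := [x] ++ X') (p₀ := p₀) (p₁ := p₁) (p := p)
      (q₀ := q₀) (q₁ := q₁) (q₂ := q₂) (R := R) (by simpa using hL.1)
      (fun v => by simpa using (hL.2 v).2 trivial) (by simp)
      (P.isChain_lists (L := []) (by simpa using hX')) ?_ hc.1 hc.2 a₀ a₁ a₂ hQc
    intro v hv
    have hv := (hX'.2 v).1 hv
    exact ⟨hmN _ (by simp) v hv, hmN _ (by simp) v hv, hmN _ (by simp) v hv⟩
  · have hL' : Lists Set.univ (x :: p₀ :: p₁ :: ((X' ++ M) ++ p :: q₀ :: q₁ :: q₂ :: R)) := by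
      refine hL.perm ?_
      rw [List.perm_iff_count]
      intro a
      simp [List.count_cons, List.count_append]
      omega
    have hxX : ∀ v ∈ X', v ∈ X := fun v hv => (hX'.2 v).1 (by simp [hv])
    refine hasSpanningHalinSubgraph_of_reps hL'.1 (fun v => (hL'.2 v).2 trivial)
      (isChain_insert_front hM.2.2.of_cons (P.isChain_lists hX') ?_ ?_) (by simp [hM0])
      (hmN _ (by simp) x hx) ?_ (hmN _ (by simp) x hx) ?_ a₀ a₁ a₂ hQc
    · exact fun v hv => (hmN _ (by simp) v (hxX v hv)).symm
    · exact fun v hv w hw => hmN w (by simp at hw ⊢; tauto) v (hxX v hv)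
    · intro v hv
      rcases List.mem_append.1 hv with hv | hv
      · refine P.adj_X x hx v (hxX v hv) ?_
        rintro rfl
        have := hX'.1
        simp at this
        exact this.1 hv
      · exact hmN v (by simp [hv]) x hx
    · exact (List.isChain_cons_cons.1 hM.2.2).1

/-- `Q` has two elements `q`, `q'`, and `N` consists of a common neighbour `p₀` of these and a
path whose ends have neighbours `q'` and `q`. -/
theorem of_pair [Fintype V] (P : AntipodalPartition G X N Q) (hX : X.Nonempty) {q q' p₀ p₁ p : V}
    {M : List V} (hQ : Lists Q [q, q']) (hN : Lists N (p₀ :: p₁ :: (M ++ [p])))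
    (hc : (p₁ :: (M ++ [p])).IsChain G.Adj) (h₀ : G.Adj p₀ q) (h₀' : G.Adj p₀ q')
    (h₁ : G.Adj p₁ q') (h₂ : G.Adj p q) : HasSpanningHalinSubgraph G := by
  classical
  obtain ⟨x, hx⟩ := hX
  obtain ⟨X', hX'⟩ := exists_lists_append (A := X) (K := [x]) (by simp) (by simpa using hx)
  have hL' : Lists Set.univ (x :: p₀ :: p₁ :: ((X' ++ M) ++ [p, q, q'])) := by
    refine (P.lists hX' hN hQ).perm ?_
    rw [List.perm_iff_count]
    intro a
    simp [List.count_cons, List.count_append]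
    omega
  have hmN : ∀ v ∈ p₀ :: p₁ :: (M ++ [p]), ∀ u ∈ X, G.Adj u v := fun v hv u hu =>
    P.adj_X_N u hu v ((hN.2 v).1 hv)
  have hxX : ∀ v ∈ X', v ∈ X := fun v hv => (hX'.2 v).1 (by simp [hv])
  refine hasSpanningHalinSubgraph_of_reps_pair hL'.1 (fun v => (hL'.2 v).2 trivial)
    (isChain_insert_front hc (P.isChain_lists hX') ?_ ?_)
    (hmN _ (by simp) x hx) (hmN _ (by simp) x hx) ?_ (hmN _ (by simp) x hx) h₀ h₀' h₁ h₂ ?_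
  · exact fun v hv => (hmN _ (by simp) v (hxX v hv)).symm
  · exact fun v hv w hw => hmN w (by simp at hw ⊢; tauto) v (hxX v hv)
  · intro v hv
    rcases List.mem_append.1 hv with hv | hv
    · refine P.adj_X x hx v (hxX v hv) ?_
      rintro rfl
      have := hX'.1
      simp at this
      exact this.1 hv
    · exact hmN v (by simp [hv]) x hx
  · refine P.adj_Q q ((hQ.2 q).1 (by simp)) q' ((hQ.2 q').1 (by simp)) ?_
    have := hQ.1
    simpa using this

end AntipodalPartition

end

/-! ### A Hamiltonian path between the two cliques -/

section

variable {V : Type*} {G : SimpleGraph V} {X N Q : Set V}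

theorem exists_eq_cons_cons_append [Nonempty V] {L : List V} (h : ∀ y z, ∃ p ∈ L, p ≠ y ∧ p ≠ z) :
    ∃ a b M c, L = a :: b :: (M ++ [c]) := by
  match L with
  | [] =>
    obtain ⟨v⟩ := ‹Nonempty V›
    obtain ⟨p, hp, -⟩ := h v v
    simp at hp
  | [a] => obtain ⟨p, hp, h1, h2⟩ := h a a; simp at hp; exact absurd hp h1
  | [a, b] =>
    obtain ⟨p, hp, h1, h2⟩ := h a b; simp at hp
    rcases hp with h | h
    · exact absurd h h1
    · exact absurd h h2
  | a :: b :: c :: T =>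
    rcases List.eq_nil_or_concat (c :: T) with h | ⟨M, d, h⟩
    · simp at h
    · exact ⟨a, b, M, d, by rw [h, List.concat_eq_append]⟩

namespace AntipodalPartition

/-- When no vertex of `Q = {q, q'}` has two nonneighbours in `N`, any two different vertices of `N`
have different neighbours in `Q`, as `of_pair` requires for the ends of the path. -/
theorem of_pair_of_complete [Fintype V] (P : AntipodalPartition G X N Q) (hX : X.Nonempty)
    {q q' p₀ p₁ p : V} {M : List V} (hQ : Lists Q [q, q']) (hN : Lists N (p₀ :: p₁ :: (M ++ [p])))
    (hc : (p₁ :: (M ++ [p])).IsChain G.Adj) (h₀ : ∀ q ∈ Q, G.Adj p₀ q)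
    (hmiss : ∀ q ∈ Q, ∀ a ∈ N, ∀ b ∈ N, a ≠ b → G.Adj a q ∨ G.Adj b q) :
    HasSpanningHalinSubgraph G := by
  have hq : q ∈ Q := (hQ.2 q).1 (by simp)
  have hq' : q' ∈ Q := (hQ.2 q').1 (by simp)
  have hp₁ : p₁ ∈ N := (hN.2 p₁).1 (by simp)
  have hp : p ∈ N := (hN.2 p).1 (by simp)
  have hne : p₁ ≠ p := by
    have := hN.1
    simp only [List.nodup_cons, List.mem_append, List.mem_singleton] at this
    exact fun h => this.2.1 (Or.inr h)
  have hor : ∀ u ∈ N, G.Adj u q ∨ G.Adj u q' := by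
    intro u hu
    obtain ⟨w, hw, h⟩ := P.exists_adj_Q u hu
    rw [← hQ.2] at hw
    simp at hw
    rcases hw with rfl | rfl
    · exact Or.inl h
    · exact Or.inr h
  have key : (G.Adj p₁ q' ∧ G.Adj p q) ∨ (G.Adj p₁ q ∧ G.Adj p q') := by
    have h1 := hmiss q hq p₁ hp₁ p hp hne
    have h2 := hmiss q' hq' p₁ hp₁ p hp hne
    have h3 := hor p₁ hp₁
    have h4 := hor p hp
    clear * - h1 h2 h3 h4
    tauto
  rcases key with ⟨h1, h2⟩ | ⟨h1, h2⟩
  · exact P.of_pair hX hQ hN hc (h₀ q hq) (h₀ q' hq') h1 h2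
  · exact P.of_pair hX (hQ.perm (List.Perm.swap _ _ _)) hN hc (h₀ q' hq') (h₀ q hq) h1 h2

/-- If an end of the Hamiltonian path sees all of `Q`, it is taken as `p₀`. Otherwise the second
vertex is, and it remains to reconnect the first one, for which there is room since no vertex has
more than two nonneighbours. -/
theorem of_isHamPath_of_pair [Fintype V] (P : AntipodalPartition G X N Q) (hX : X.Nonempty)
    (hG : IsKConnected 3 G) {q q' : V} (hQ : Lists Q [q, q']) {L : List V}
    (hL : IsHamPath G N L) : HasSpanningHalinSubgraph G := by
  classical
  have hq : q ∈ Q := (hQ.2 q).1 (by simp)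
  have hq' : q' ∈ Q := (hQ.2 q').1 (by simp)
  have hQK : ∀ w ∈ Q, w ∈ [q, q'] := fun w => (hQ.2 w).2
  have hqq : q ≠ q' := by simpa using hQ.1
  obtain ⟨x, hx⟩ := hX
  have hmiss : ∀ q ∈ Q, ∀ a ∈ N, ∀ b ∈ N, a ≠ b → G.Adj a q ∨ G.Adj b q := by
    intro q hq a ha b hb hab
    by_contra! h
    have := P.bound q [x, a, b] _ ?_ ?_ hQK
    · simp at this
    · have h1 : x ≠ a := by rintro rfl; exact P.notMem_N _ hx ha
      have h2 : x ≠ b := by rintro rfl; exact P.notMem_N _ hx hb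
      simp [hab, h1, h2]
    · intro w hw
      simp at hw
      rcases hw with rfl | rfl | rfl
      · exact ⟨fun h => P.notMem_Q _ hx (h ▸ hq), fun h => P.not_adj_X_Q _ hx q hq h.symm⟩
      · exact ⟨fun h => P.notMem_Q_of_N _ ha (h ▸ hq), fun h' => h.1 h'.symm⟩
      · exact ⟨fun h => P.notMem_Q_of_N _ hb (h ▸ hq), fun h' => h.2 h'.symm⟩
  have : Nonempty V := ⟨x⟩
  obtain ⟨r₀, r₁, M, r, rfl⟩ := exists_eq_cons_cons_append (L := L) (fun y z => by
    obtain ⟨p, hp, h⟩ := P.exists_ne_ne hG hx hq y z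
    exact ⟨p, (hL.2.1 p).2 hp, h⟩)
  have hN : Lists N (r₀ :: r₁ :: (M ++ [r])) := ⟨hL.1, hL.2.1⟩
  have hch := List.isChain_cons_cons.1 hL.2.2
  have hr₀ : r₀ ∈ N := (hN.2 _).1 (by simp)
  have hr₁ : r₁ ∈ N := (hN.2 _).1 (by simp)
  have hr : r ∈ N := (hN.2 _).1 (by simp)
  have hnd := hN.1
  simp only [List.nodup_cons, List.mem_cons, List.mem_append, List.not_mem_nil, or_false,
    not_or] at hnd
  by_cases h0 : ∀ q ∈ Q, G.Adj r₀ q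
  · exact P.of_pair_of_complete ⟨x, hx⟩ hQ hN hch.2 h0 hmiss
  by_cases hk : ∀ q ∈ Q, G.Adj r q
  · have hrev := hL.reverse
    obtain ⟨a, b, M', c, he⟩ := exists_eq_cons_cons_append
      (L := (r₀ :: r₁ :: (M ++ [r])).reverse) (fun y z => by
        obtain ⟨p, hp, h⟩ := P.exists_ne_ne hG hx hq y z
        exact ⟨p, (hrev.2.1 p).2 hp, h⟩)
    have ha : a = r := by
      have := congrArg List.head? he
      simpa using this.symm
    rw [he] at hrev
    subst ha
    exact P.of_pair_of_complete ⟨x, hx⟩ hQ ⟨hrev.1, hrev.2.1⟩ hrev.2.2.of_cons hk hmiss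
  have h1 : ∀ u ∈ N, u ≠ r₀ → u ≠ r → ∀ q ∈ Q, G.Adj u q := by
    intro u hu hu0 huk w hw
    by_contra hcon
    have e0 := (hmiss w hw u hu r₀ hr₀ hu0).resolve_left hcon
    have ek := (hmiss w hw u hu r hr huk).resolve_left hcon
    push Not at h0 hk
    obtain ⟨a, ha, h0⟩ := h0
    obtain ⟨b, hb, hk⟩ := hk
    have hab : a = b := by
      rw [← hQ.2] at ha hb hw
      have n1 : a ≠ w := by rintro rfl; exact h0 e0
      have n2 : b ≠ w := by rintro rfl; exact hk ek
      clear * - ha hb hw n1 n2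
      simp at ha hb hw
      grind
    subst hab
    rcases hmiss a ha r₀ hr₀ r hr hnd.1.2.2 with h | h
    · exact h0 h
    · exact hk h
  have hr₁c := h1 r₁ hr₁ (Ne.symm hnd.1.1) hnd.2.1.2
  have hMr : (M ++ [r]).IsChain G.Adj := hch.2.of_cons
  by_cases h2 : ∀ y ∈ (M ++ [r]).head?, G.Adj r₀ y
  · exact P.of_pair_of_complete ⟨x, hx⟩ hQ (hN.perm (List.Perm.swap _ _ _)) (hMr.cons h2) hr₁c
      hmiss
  obtain ⟨a, ha, h0a⟩ : ∃ a ∈ Q, ¬ G.Adj r₀ a := by push Not at h0; exact h0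
  rcases M with _ | ⟨r₂, M⟩
  · -- The only vertices are `x`, `q`, `q'`, `r₀`, `r₁`, `r`, and `r₁` is the centre of a wheel.
    simp at h2
    have hXx : ∀ v ∈ X, v = x := by
      intro v hv
      by_contra hvx
      have := P.bound a [v, x, r₀] _ ?_ ?_ hQK
      · simp at this
      · have h1 : v ≠ r₀ := by rintro rfl; exact P.notMem_N _ hv hr₀
        have h2 : x ≠ r₀ := by rintro rfl; exact P.notMem_N _ hx hr₀
        simp [hvx, h1, h2]
      · intro w hw
        simp at hw
        rcases hw with rfl | rfl | rfl
        · exact ⟨fun h => P.notMem_Q _ hv (h ▸ ha), fun h => P.not_adj_X_Q _ hv a ha h.symm⟩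
        · exact ⟨fun h => P.notMem_Q _ hx (h ▸ ha), fun h => P.not_adj_X_Q _ hx a ha h.symm⟩
        · exact ⟨fun h => P.notMem_Q_of_N _ hr₀ (h ▸ ha), fun h' => h0a h'.symm⟩
    have wheel : ∀ c d, Lists Q [c, d] → G.Adj r₀ c → G.Adj d r → HasSpanningHalinSubgraph G := by
      intro c d hcd h3 h4
      have hXl : Lists X [x] := ⟨by simp, fun v => by
        simp only [List.mem_singleton]; exact ⟨fun h => h ▸ hx, hXx v⟩⟩
      have hLall : Lists Set.univ (r₀ :: r :: r₁ :: x :: [c, d]) := by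
        refine (P.lists hXl hN hcd).perm ?_
        rw [List.perm_iff_count]
        intro a
        simp [List.count_cons]
        omega
      refine hasSpanningHalinSubgraph_of_wheel G r₁ r₀ x r [c, d] hLall.1
        (fun v => (hLall.2 v).2 trivial) ?_ (P.adj_X_N x hx _ hr₀).symm (P.adj_X_N x hx _ hr) ?_
        (by simp)
      · intro v hv
        rcases P.cover v with h | h | h
        · exact (P.adj_X_N v h r₁ hr₁).symm
        · rw [← hN.2] at h
          simp at h
          have hch1 := hch.2
          simp at hch1
          rcases h with rfl | rfl | rfl
          · exact hch.1.symm
          · exact absurd rfl hv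
          · exact hch1
        · exact hr₁c v h
      · have : G.Adj c d := P.adj_Q c ((hcd.2 c).1 (by simp)) d ((hcd.2 d).1 (by simp)) (by
          have := hcd.1
          simpa using this)
        simp [h3, this, h4]
    rw [← hQ.2] at ha
    have e1 := fun q hq => hmiss q hq r₀ hr₀ r hr hnd.1.2.2
    obtain ⟨c, hc, h0c⟩ := P.exists_adj_Q r₀ hr₀
    rw [← hQ.2] at hc
    simp at ha hc
    rcases ha with rfl | rfl
    · have : c = q' := hc.resolve_left (by rintro rfl; exact h0a h0c)
      subst this
      exact wheel c a (hQ.perm (List.Perm.swap _ _ _)) h0c ((e1 a hq).resolve_left h0a).symm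
    · have : c = q := hc.resolve_right (by rintro rfl; exact h0a h0c)
      subst this
      exact wheel c a hQ h0c ((e1 a hq').resolve_left h0a).symm
  · simp at h2
    have hr₂ : r₂ ∈ N := (hN.2 _).1 (by simp)
    simp at hnd
    have hadj : G.Adj r r₀ := by
      by_contra hcon
      have := P.bound r₀ [a, r₂, r] _ ?_ ?_ hQK
      · simp at this
      · have h1 : a ≠ r₂ := by rintro rfl; exact P.notMem_Q_of_N _ hr₂ ha
        have h2 : a ≠ r := by rintro rfl; exact P.notMem_Q_of_N _ hr ha
        have h3 : r₂ ≠ r := by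
          have := hMr
          rintro rfl
          simp at hnd
        simp [h1, h2, h3]
      · intro w hw
        simp at hw
        rcases hw with rfl | rfl | rfl
        · exact ⟨fun h => P.notMem_Q_of_N _ hr₀ (h ▸ ha), h0a⟩
        · exact ⟨Ne.symm hnd.1.2.1.1, h2⟩
        · exact ⟨Ne.symm hnd.1.2.2, fun h => hcon h.symm⟩
    refine P.of_pair_of_complete ⟨x, hx⟩ hQ (p₀ := r₁) (p₁ := r₂) (M := M ++ [r]) (p := r₀)
      (hN.perm ?_) ?_ hr₁c hmiss
    · rw [List.perm_iff_count]
      intro a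
      simp [List.count_cons, List.count_append]
      omega
    · have : ((r₂ :: (M ++ [r])) ++ [r₀]).IsChain G.Adj := by
        refine List.IsChain.append (by simpa using hMr) (by simp) ?_
        intro u hu v hv
        have e : (r₂ :: (M ++ [r])).getLast? = some r := by
          rw [← List.cons_append, List.getLast?_append]; simp
        rw [e] at hu
        simp at hu hv
        subst hu hv; exact hadj
      simpa using this

/-- Here all of `N` sees both `x` and `q`, which become the spine and a single leaf below it. -/
theorem of_isHamPath_of_singleton [Fintype V] (P : AntipodalPartition G X N Q) (hX : X.Nonempty)
    (hG : IsKConnected 3 G) {q : V} (hQ : Lists Q [q]) {L : List V}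
    (hL : IsHamPath G N L) : HasSpanningHalinSubgraph G := by
  classical
  have hq : q ∈ Q := (hQ.2 q).1 (by simp)
  obtain ⟨x, hx⟩ := hX
  have hNq : ∀ p ∈ N, G.Adj p q := by
    intro p hp
    obtain ⟨w, hw, h⟩ := P.exists_adj_Q p hp
    rw [← hQ.2] at hw
    simp at hw
    exact hw ▸ h
  have hXx : ∀ v ∈ X, v = x := by
    intro v hv
    by_contra hvx
    have := P.bound q [v, x] [q] (by simpa using hvx) ?_ fun w => (hQ.2 w).2
    · simp at this
    · intro w hw
      simp at hw
      rcases hw with rfl | rfl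
      · exact ⟨fun h => P.notMem_Q _ hv (h ▸ hq), fun h => P.not_adj_X_Q _ hv q hq h.symm⟩
      · exact ⟨fun h => P.notMem_Q _ hx (h ▸ hq), fun h => P.not_adj_X_Q _ hx q hq h.symm⟩
  have hXl : Lists X [x] := ⟨by simp, fun v => by
    simp only [List.mem_singleton]; exact ⟨fun h => h ▸ hx, hXx v⟩⟩
  have : Nonempty V := ⟨x⟩
  obtain ⟨r₀, r₁, M, r, rfl⟩ := exists_eq_cons_cons_append (L := L) (fun y z => by
    obtain ⟨p, hp, h⟩ := P.exists_ne_ne hG hx hq y z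
    exact ⟨p, (hL.2.1 p).2 hp, h⟩)
  have hall := P.lists hXl ⟨hL.1, hL.2.1⟩ hQ
  have hxN : ∀ p ∈ r₀ :: r₁ :: (M ++ [r]), G.Adj x p := fun p hp =>
    P.adj_X_N x hx p ((hL.2.1 p).1 hp)
  have hqN : ∀ p ∈ r₀ :: r₁ :: (M ++ [r]), G.Adj p q := fun p hp => hNq p ((hL.2.1 p).1 hp)
  have hch := List.isChain_cons_cons.1 hL.2.2
  rcases eq_or_ne M [] with rfl | hM
  · have hLall : Lists Set.univ (r₀ :: r :: r₁ :: x :: [q]) := by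
      refine hall.perm ?_
      rw [List.perm_iff_count]
      intro a
      simp [List.count_cons]
      omega
    refine hasSpanningHalinSubgraph_of_wheel G r₁ r₀ x r [q] hLall.1
      (fun v => (hLall.2 v).2 trivial) ?_ (hxN _ (by simp)).symm (hxN _ (by simp)) ?_ (by simp)
    · intro v hv
      have := (hLall.2 v).2 trivial
      have hch1 := hch.2
      simp at this hch1
      rcases this with rfl | rfl | rfl | rfl | rfl
      · exact hch.1.symm
      · exact hch1
      · exact absurd rfl hv
      · exact (hxN _ (by simp)).symm
      · exact hqN _ (by simp)
    · simp [hqN r₀, (hqN r (by simp)).symm]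
  · refine hasSpanningHalinSubgraph_of_blocks_perm r r₁
      [(x, M.reverse, []), (r₀, [], [q])] hall.1 (fun v => (hall.2 v).2 trivial) ?_ ?_ ?_ ?_
      (by simpa using hM) (by simp) ?_ (by simpa using hM)
    · rw [List.perm_iff_count]
      intro a
      simp [List.count_cons, List.count_append]
      omega
    · simp [hxN r₀, (hxN r (by simp)).symm, hch.1]
    · simpa using isChain_adj_reverse hch.2
    · simp [hqN r, (hqN r₁ (by simp)).symm]
    · intro b hb t ht
      simp only [List.mem_cons, List.not_mem_nil, or_false] at hb
      rcases hb with rfl | rfl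
      · simp at ht; exact hxN t (by simp [ht])
      · simp at ht; exact ht ▸ hqN r₀ (by simp)

theorem of_isHamPath [Fintype V] (P : AntipodalPartition G X N Q) (hα : NoIndepTriple G)
    (hX : X.Nonempty) (hG : IsKConnected 3 G) (hQ3 : ∀ a b, ∃ c ∈ Q, c ≠ a ∧ c ≠ b) {L : List V}
    (hL : IsHamPath G N L) : HasSpanningHalinSubgraph G := by
  obtain ⟨x, hx⟩ := hX
  obtain ⟨q, hq, -⟩ := hQ3 x x
  exact P.of_goodPath ⟨x, hx⟩ (hasGoodPath_of_isHamPath hα P.notMem_Q_of_N hQ3 P.exists_adj_Q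
    (P.exists_adj_ne_ne hG ⟨x, hx⟩ hQ3) ⟨q, hq⟩ hL)

end AntipodalPartition

end

/-! ### No Hamiltonian path between the two cliques -/

section

variable {V : Type*} {G : SimpleGraph V} {X N Q N₁ N₂ : Set V}

theorem isChain_append_append {K₁ K₂ K₃ : List V} (h₁ : K₁.IsChain G.Adj) (h₂ : K₂.IsChain G.Adj)
    (h₃ : K₃.IsChain G.Adj) (hne : K₂ ≠ []) (h₁₂ : ∀ u ∈ K₁, ∀ v ∈ K₂, G.Adj u v)
    (h₂₃ : ∀ u ∈ K₂, ∀ v ∈ K₃, G.Adj u v) : (K₁ ++ (K₂ ++ K₃)).IsChain G.Adj := by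
  refine h₁.append (h₂.append h₃ fun u hu v hv =>
    h₂₃ u (List.mem_of_getLast? hu) v (List.mem_of_mem_head? hv)) ?_
  intro u hu v hv
  rw [List.head?_append_of_ne_nil _ hne] at hv
  exact h₁₂ u (List.mem_of_getLast? hu) v (List.mem_of_mem_head? hv)

theorem Lists.exists_ne_ne {q₀ q₁ q₂ : V} {L : List V} (h : Lists Q (q₀ :: q₁ :: q₂ :: L))
    (y z : V) : ∃ c ∈ Q, c ≠ y ∧ c ≠ z := by
  have hn := h.1
  have h0 := (h.2 q₀).1 (by simp)
  have h1 := (h.2 q₁).1 (by simp)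
  have h2 := (h.2 q₂).1 (by simp)
  have n01 : q₀ ≠ q₁ := by simp at hn; tauto
  have n02 : q₀ ≠ q₂ := by simp at hn; tauto
  have n12 : q₁ ≠ q₂ := by simp at hn; tauto
  clear * - h0 h1 h2 n01 n02 n12
  by_cases e0 : q₀ = y ∨ q₀ = z
  · by_cases e1 : q₁ = y ∨ q₁ = z
    · exact ⟨q₂, h2, by grind, by grind⟩
    · push Not at e1; exact ⟨q₁, h1, e1⟩
  · push Not at e0; exact ⟨q₀, h0, e0⟩

/-- `N` is the union of the nonempty sets `N₁` and `N₂`, with no edge between these. -/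
structure IsSplit (G : SimpleGraph V) (N N₁ N₂ : Set V) : Prop where
  nonempty_left : N₁.Nonempty
  nonempty_right : N₂.Nonempty
  mem_iff : ∀ v, v ∈ N ↔ v ∈ N₁ ∨ v ∈ N₂
  disj : ∀ v ∈ N₁, v ∉ N₂
  not_adj : ∀ u ∈ N₁, ∀ v ∈ N₂, ¬ G.Adj u v

namespace IsSplit

theorem symm (S : IsSplit G N N₁ N₂) : IsSplit G N N₂ N₁ :=
  ⟨S.2, S.1, fun v => by rw [S.mem_iff, or_comm], fun v h h' => S.disj v h' h,
    fun u hu v hv h => S.not_adj v hv u hu h.symm⟩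

theorem left (S : IsSplit G N N₁ N₂) {v : V} (h : v ∈ N₁) : v ∈ N := (S.mem_iff v).2 (Or.inl h)

theorem right (S : IsSplit G N N₁ N₂) {v : V} (h : v ∈ N₂) : v ∈ N := (S.mem_iff v).2 (Or.inr h)

theorem ne (S : IsSplit G N N₁ N₂) {u v : V} (hu : u ∈ N₁) (hv : v ∈ N₂) : u ≠ v := by
  rintro rfl
  exact S.disj u hu hv

theorem adj_left (S : IsSplit G N N₁ N₂) (hα : NoIndepTriple G) {u v : V} (hu : u ∈ N₁)
    (hv : v ∈ N₁) (hne : u ≠ v) : G.Adj u v := by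
  obtain ⟨c, hc⟩ := S.nonempty_right
  rcases hα u v c hne (S.ne hu hc) (S.ne hv hc) with h | h | h
  · exact h
  · exact absurd h (S.not_adj u hu c hc)
  · exact absurd h (S.not_adj v hv c hc)

theorem isChain_left (S : IsSplit G N N₁ N₂) (hα : NoIndepTriple G) {L : List V} (hL : L.Nodup)
    (h : ∀ v ∈ L, v ∈ N₁) : L.IsChain G.Adj :=
  isChain_of_clique hL fun u hu v hv => S.adj_left hα (h u hu) (h v hv)

theorem lists (S : IsSplit G N N₁ N₂) {L L' : List V} (h : Lists N₁ L) (h' : Lists N₂ L') :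
    Lists N (L ++ L') := by
  have := h.append h' S.disj
  exact ⟨this.1, fun v => by rw [this.2, S.mem_iff]; rfl⟩

end IsSplit

namespace AntipodalPartition

/-- When `X` has a vertex to spare, it links `N₁` to `N₂` in a path. -/
theorem exists_path_of_isSplit [Fintype V] (P : AntipodalPartition G X N Q)
    (hα : NoIndepTriple G) (S : IsSplit G N N₁ N₂) {x x' p₀ p₁ p : V} (hx : x ∈ X) (hx' : x' ∈ X)
    (hxx : x ≠ x') (hp₀ : p₀ ∈ N₁) (hp₁ : p₁ ∈ N₁) (hp : p ∈ N₂) (h₀₁ : p₀ ≠ p₁) :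
    ∃ M, M ≠ [] ∧ (∀ L, Lists Q L → Lists Set.univ (x :: p₀ :: p₁ :: (M ++ p :: L))) ∧
      (p₁ :: (M ++ [p])).IsChain G.Adj ∧ ∀ v ∈ M, G.Adj x v := by
  classical
  obtain ⟨X', hX'⟩ := exists_lists_append (A := X) (K := [x, x']) (by simpa using hxx)
    (by simp [hx, hx'])
  obtain ⟨A, hA⟩ := exists_lists_append (A := N₁) (K := [p₀, p₁]) (by simpa using h₀₁)
    (by simp [hp₀, hp₁])
  obtain ⟨C, hC⟩ := exists_lists_append (A := N₂) (K := [p]) (by simp) (by simpa using hp)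
  have hXm : ∀ v ∈ x' :: X', v ∈ X := fun v hv => (hX'.2 v).1 (by simp at hv ⊢; tauto)
  have hAm : ∀ v ∈ p₁ :: A, v ∈ N₁ := fun v hv => (hA.2 v).1 (by simp at hv ⊢; tauto)
  have hCm : ∀ v ∈ C ++ [p], v ∈ N₂ := fun v hv => (hC.2 v).1 (by simp at hv ⊢; tauto)
  refine ⟨A ++ ((x' :: X') ++ C), by simp, ?_, ?_, ?_⟩
  · intro L hL
    refine (P.lists hX' (S.lists hA hC) hL).perm ?_
    rw [List.perm_iff_count]
    intro a
    simp [List.count_cons, List.count_append]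
    omega
  · have hAc : (p₁ :: A).IsChain G.Adj := S.isChain_left hα (List.nodup_cons.1 hA.1).2 hAm
    have hCc : (C ++ [p]).IsChain G.Adj :=
      S.symm.isChain_left hα (List.perm_append_comm.nodup_iff.1 hC.1) hCm
    have hXc : (x' :: X').IsChain G.Adj := P.isChain_lists (L := [x]) hX'
    have := isChain_append_append hAc hXc hCc (by simp)
      (fun u hu v hv => (P.adj_X_N v (hXm v hv) u (S.left (hAm u hu))).symm)
      (fun u hu v hv => P.adj_X_N u (hXm u hu) v (S.right (hCm v hv)))
    simpa using this
  · intro v hv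
    simp only [List.mem_append] at hv
    rcases hv with hv | hv | hv
    · exact P.adj_X_N x hx v (S.left (hAm v (by simp [hv])))
    · refine P.adj_X x hx v (hXm v hv) ?_
      rintro rfl
      exact (List.nodup_cons.1 hX'.1).1 hv
    · exact P.adj_X_N x hx v (S.right (hCm v (by simp [hv])))

theorem of_hasReps [Fintype V] (P : AntipodalPartition G X N Q)
    (hα : NoIndepTriple G) (S : IsSplit G N N₁ N₂) {x x' p₀ p₁ p : V} (hx : x ∈ X) (hx' : x' ∈ X)
    (hxx : x ≠ x') (hp₀ : p₀ ∈ N₁) (hp₁ : p₁ ∈ N₁) (hp : p ∈ N₂) (h₀₁ : p₀ ≠ p₁)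
    (h : HasReps G Q p₀ p₁ p) : HasSpanningHalinSubgraph G := by
  obtain ⟨q₀, q₁, q₂, hq₀, hq₁, hq₂, h01, h02, h12, a₀, a₁, a₂⟩ := h
  obtain ⟨R, hR⟩ := exists_lists_append (A := Q) (K := [q₀, q₁, q₂]) (by simp [h01, h02, h12])
    (by simp [hq₀, hq₁, hq₂])
  obtain ⟨M, hM, hl, hc, hxM⟩ := P.exists_path_of_isSplit hα S hx hx' hxx hp₀ hp₁ hp h₀₁
  have hL := hl _ hR
  exact hasSpanningHalinSubgraph_of_reps hL.1 (fun v => (hL.2 v).2 trivial) hc hM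
    (P.adj_X_N x hx _ (S.left hp₀)) hxM (P.adj_X_N x hx _ (S.right hp))
    (S.adj_left hα hp₀ hp₁ h₀₁) a₀ a₁ a₂
    fun u hu v hv => P.adj_Q u ((hR.2 u).1 hu) v ((hR.2 v).1 hv)

/-- The only obstruction to representatives for two vertices of `N₁` and one of `N₂` is a common
sole neighbour of all of `N₁`. -/
theorem exists_hasReps_or_isSole (P : AntipodalPartition G X N Q) (hα : NoIndepTriple G)
    (hQ3 : ∀ a b, ∃ c ∈ Q, c ≠ a ∧ c ≠ b) (S : IsSplit G N N₁ N₂) {a b : V} (ha : a ∈ N₁)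
    (hb : b ∈ N₁) (hab : a ≠ b) :
    (∃ p₀ p₁ p, p₀ ∈ N₁ ∧ p₁ ∈ N₁ ∧ p ∈ N₂ ∧ p₀ ≠ p₁ ∧ HasReps G Q p₀ p₁ p) ∨
      ∃ q ∈ Q, ∀ u ∈ N₁, IsSole G Q q u := by
  by_contra! hcon
  obtain ⟨hno, hns⟩ := hcon
  obtain ⟨c, hc⟩ := S.nonempty_right
  have key : ∀ a b, a ∈ N₁ → b ∈ N₁ → a ≠ b → ∃ q ∈ Q, IsSole G Q q a ∧ IsSole G Q q b := by
    intro a b ha hb hab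
    rcases hasReps_or_isSole hα P.notMem_Q_of_N hQ3 P.exists_adj_Q (S.left ha) (S.left hb)
      (S.right hc) (S.ne ha hc) (S.not_adj a ha c hc) with h | ⟨q, hq, h1, h2 | h2⟩
    · exact absurd h (hno a b c ha hb hc hab)
    · exact ⟨q, hq, h2, h1⟩
    · exact absurd (isSole_clique hα P.notMem_Q_of_N hQ3 (S.left hb) (S.right hc) h1 h2
        (S.ne hb hc)) (S.not_adj b hb c hc)
  obtain ⟨q, hq, h1, -⟩ := key a b ha hb hab
  obtain ⟨u, hu, hns⟩ := hns q hq
  by_cases hua : a = u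
  · exact hns (hua ▸ h1)
  · obtain ⟨q', hq', h2, h3⟩ := key a u ha hu hua
    have : q' = q := h1.2 q' hq' h2.1
    exact hns (this ▸ h3)

theorem of_isSplit_of_three [Fintype V] (P : AntipodalPartition G X N Q) (hα : NoIndepTriple G)
    (hG : IsKConnected 3 G) (hQ3 : ∀ a b, ∃ c ∈ Q, c ≠ a ∧ c ≠ b) (S : IsSplit G N N₁ N₂)
    {x x' a b : V} (hx : x ∈ X) (hx' : x' ∈ X) (hxx : x ≠ x') (ha : a ∈ N₁) (hb : b ∈ N₁)
    (hab : a ≠ b) : HasSpanningHalinSubgraph G := by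
  rcases P.exists_hasReps_or_isSole hα hQ3 S ha hb hab with
    ⟨p₀, p₁, p, hp₀, hp₁, hp, h01, h⟩ | ⟨q, hq, hs⟩
  · exact P.of_hasReps hα S hx hx' hxx hp₀ hp₁ hp h01 h
  obtain ⟨c, hc⟩ := S.nonempty_right
  by_cases hd : ∃ d ∈ N₂, c ≠ d
  · obtain ⟨d, hd, hcd⟩ := hd
    rcases P.exists_hasReps_or_isSole hα hQ3 S.symm hc hd hcd with
      ⟨p₀, p₁, p, hp₀, hp₁, hp, h01, h⟩ | ⟨q', hq', hs'⟩
    · exact P.of_hasReps hα S.symm hx hx' hxx hp₀ hp₁ hp h01 h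
    · obtain ⟨w, hw, h1, h2⟩ := hQ3 q q'
      exact absurd ((hs' c hc).2 w hw (adj_of_isSole hα P.notMem_Q_of_N (S.left ha) (S.right hc)
        (hs a ha) (S.ne ha hc) (S.not_adj a ha c hc) hw h1)) h2
  · -- Deleting `q` and `c` would separate the rest of `Q`.
    push Not at hd
    obtain ⟨w, hw, h1, h2⟩ := hQ3 q c
    obtain ⟨u, v, hu, hv, huq, -, -, hvc, huv⟩ := hG.exists_adj_across Q hw h1 h2
      (P.notMem_Q x hx) (fun h => P.notMem_Q x hx (h ▸ hq))
      (fun h => P.notMem_N x hx (h ▸ S.right hc))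
    rcases P.cover v with h | h | h
    · exact absurd huv.symm (P.not_adj_X_Q v h u hu)
    · rcases (S.mem_iff v).1 h with h | h
      · exact absurd ((hs v h).2 u hu huv.symm) huq
      · exact absurd (hd v h).symm hvc
    · exact absurd h hv

theorem of_isSplit_of_pair [Fintype V] (P : AntipodalPartition G X N Q) (hα : NoIndepTriple G)
    {q q' : V} (hQ : Lists Q [q, q']) (S : IsSplit G N N₁ N₂)
    {x x' a b : V} (hx : x ∈ X) (hx' : x' ∈ X) (hxx : x ≠ x') (ha : a ∈ N₁) (hb : b ∈ N₁)
    (hab : a ≠ b) : HasSpanningHalinSubgraph G := by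
  have hQN : ∀ p ∈ N, ∀ w ∈ Q, G.Adj p w := by
    intro p hp w hw
    by_contra hcon
    have := P.bound w [x, x', p] [q, q'] ?_ ?_ fun w => (hQ.2 w).2
    · simp at this
    · have h1 : x ≠ p := by rintro rfl; exact P.notMem_N _ hx hp
      have h2 : x' ≠ p := by rintro rfl; exact P.notMem_N _ hx' hp
      simp [hxx, h1, h2]
    · intro y hy
      simp at hy
      rcases hy with rfl | rfl | rfl
      · exact ⟨fun h => P.notMem_Q _ hx (h ▸ hw), fun h => P.not_adj_X_Q _ hx w hw h.symm⟩
      · exact ⟨fun h => P.notMem_Q _ hx' (h ▸ hw), fun h => P.not_adj_X_Q _ hx' w hw h.symm⟩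
      · exact ⟨fun h => P.notMem_Q_of_N _ hp (h ▸ hw), fun h' => hcon h'.symm⟩
  have hq : q ∈ Q := (hQ.2 q).1 (by simp)
  have hq' : q' ∈ Q := (hQ.2 q').1 (by simp)
  obtain ⟨c, hc⟩ := S.nonempty_right
  obtain ⟨M, hM, hl, hch, hxM⟩ := P.exists_path_of_isSplit hα S hx hx' hxx ha hb hc hab
  have hL := hl _ hQ
  exact hasSpanningHalinSubgraph_of_reps_pair hL.1 (fun v => (hL.2 v).2 trivial) hch
    (P.adj_X_N x hx _ (S.left ha)) (P.adj_X_N x hx _ (S.left hb)) hxM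
    (P.adj_X_N x hx _ (S.right hc)) (hQN a (S.left ha) q hq) (hQN a (S.left ha) q' hq')
    (hQN b (S.left hb) q' hq') (hQN c (S.right hc) q hq)
    (P.adj_Q q hq q' hq' (by simpa using hQ.1))

/-- If `X = {x}`, deleting `x` and a vertex `q` of `Q` does not isolate `N₁`. -/
theorem exists_adj_ne_of_isSplit [Fintype V] (P : AntipodalPartition G X N Q)
    (hG : IsKConnected 3 G) (S : IsSplit G N N₁ N₂) {x q : V} (hx : x ∈ X) (hXx : ∀ v ∈ X, v = x)
    (hq : q ∈ Q) : ∃ u ∈ N₁, ∃ v ∈ Q, v ≠ q ∧ G.Adj u v := by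
  obtain ⟨a, ha⟩ := S.nonempty_left
  obtain ⟨c, hc⟩ := S.nonempty_right
  have h1 : ∀ v ∈ N, v ≠ x ∧ v ≠ q := fun v hv =>
    ⟨fun h => P.notMem_N x hx (h ▸ hv), fun h => P.notMem_Q_of_N v hv (h ▸ hq)⟩
  obtain ⟨u, v, hu, hv, -, -, hvx, hvq, huv⟩ := hG.exists_adj_across N₁ ha (h1 a (S.left ha)).1
    (h1 a (S.left ha)).2 (S.symm.disj c hc) (h1 c (S.right hc)).1 (h1 c (S.right hc)).2
  rcases P.cover v with h | h | h
  · exact absurd (hXx v h) hvx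
  · rcases (S.mem_iff v).1 h with h | h
    · exact absurd h hv
    · exact absurd huv (S.not_adj u hu v h)
  · exact ⟨u, hu, v, h, hvq, huv⟩

/-- A vertex `q` of `Q` joined to all of `N₂` and to some vertex of `N₁` gives the spine. -/
theorem of_isSplit_of_complete [Fintype V] (P : AntipodalPartition G X N Q)
    (hα : NoIndepTriple G) (hG : IsKConnected 3 G) (S : IsSplit G N N₁ N₂) {x a₀ b₀ q p₀ : V}
    (hx : x ∈ X) (hXx : ∀ v ∈ X, v = x) (ha₀ : a₀ ∈ N₁) (hb₀ : b₀ ∈ N₁) (hab₀ : a₀ ≠ b₀)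
    (hq : q ∈ Q) (hqN : ∀ c ∈ N₂, G.Adj q c) (hp₀ : p₀ ∈ N₁) (hpq₀ : G.Adj p₀ q) :
    HasSpanningHalinSubgraph G := by
  classical
  -- A neighbour `p` of `q` in `N₁`, and another vertex `a` of `N₁` with a neighbour other than `q`.
  have hpa : ∃ p a w, p ∈ N₁ ∧ a ∈ N₁ ∧ p ≠ a ∧ G.Adj p q ∧ w ∈ Q ∧ w ≠ q ∧ G.Adj a w := by
    obtain ⟨a, ha, w, hw, hwq, haw⟩ := P.exists_adj_ne_of_isSplit hG S hx hXx hq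
    by_cases h : p₀ = a
    · subst h
      obtain ⟨b, hb, hbp⟩ : ∃ b ∈ N₁, b ≠ p₀ := by
        by_cases h : a₀ = p₀
        · exact ⟨b₀, hb₀, fun h' => hab₀ (h.trans h'.symm)⟩
        · exact ⟨a₀, ha₀, h⟩
      obtain ⟨w', hw', hbw⟩ := P.exists_adj_Q b (S.left hb)
      by_cases hwq' : w' = q
      · exact ⟨b, p₀, w, hb, hp₀, hbp, hwq' ▸ hbw, hw, hwq, haw⟩
      · exact ⟨p₀, b, w', hp₀, hb, hbp.symm, hpq₀, hw', hwq', hbw⟩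
    · exact ⟨p₀, a, w, hp₀, ha, h, hpq₀, hw, hwq, haw⟩
  obtain ⟨p, a, q₁, hp, ha, hpa, hpq, hq₁, hq₁q, haq₁⟩ := hpa
  obtain ⟨c, hc, q₂, hq₂, hq₂q, hcq₂⟩ := P.exists_adj_ne_of_isSplit hG S.symm hx hXx hq
  obtain ⟨A, hA⟩ := exists_lists_append (A := N₁) (K := [p, a]) (by simpa using hpa)
    (by simp [hp, ha])
  obtain ⟨C, hC⟩ := exists_lists_append (A := N₂) (K := [c]) (by simp) (by simpa using hc)
  have hXl : Lists X [x] := ⟨by simp, fun v => by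
    simp only [List.mem_singleton]; exact ⟨fun h => h ▸ hx, hXx v⟩⟩
  have hAm : ∀ v ∈ A ++ [a], v ∈ N₁ := fun v hv => (hA.2 v).1 (by simp at hv ⊢; tauto)
  have hCm : ∀ v ∈ C ++ [c], v ∈ N₂ := fun v hv => (hC.2 v).1 (by simp at hv ⊢; tauto)
  have main : ∀ q₁ R, Lists Q ([q, q₁] ++ R) → G.Adj a q₁ → (c :: (R ++ [q₁])).IsChain G.Adj →
      HasSpanningHalinSubgraph G := by
    intro q₁ R hR haq hch
    have hL : Lists Set.univ (x :: p :: q :: q₁ :: a :: c :: (A ++ (C ++ R))) := by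
      refine (P.lists hXl (S.lists hA hC) hR).perm ?_
      rw [List.perm_iff_count]
      intro a
      simp [List.count_cons, List.count_append]
      omega
    have hAn : (A ++ [a]).Nodup := by
      have := (List.nodup_cons.1 hA.1).2
      exact (List.perm_append_comm (l₁ := [a])).nodup_iff.1 this
    refine hasSpanningHalinSubgraph_of_sides hL.1 (fun v => (hL.2 v).2 trivial)
      (P.adj_X_N x hx p (S.left hp)) (fun v hv => P.adj_X_N x hx v (S.left (hAm v hv)))
      (fun v hv => P.adj_X_N x hx v (S.right (hCm v hv)))
      (fun v hv => S.adj_left hα hp (hAm v hv) ?_) (S.isChain_left hα hAn hAm)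
      (fun v hv => hqN v (hCm v hv))
      (S.symm.isChain_left hα (List.perm_append_comm.nodup_iff.1 hC.1) hCm) hpq
      (fun v hv => P.adj_Q q hq v ((hR.2 v).1 ?_) ?_) hch haq
    · rintro rfl
      refine (List.nodup_cons.1 hA.1).1 ?_
      simp at hv ⊢; tauto
    · simp at hv ⊢; tauto
    · rintro rfl
      refine (List.nodup_cons.1 hR.1).1 ?_
      simp at hv ⊢; tauto
  have main' : ∀ q₁ q₂, q₁ ∈ Q → q₂ ∈ Q → q₁ ≠ q → q₂ ≠ q → q₁ ≠ q₂ → G.Adj a q₁ →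
      G.Adj c q₂ → HasSpanningHalinSubgraph G := by
    intro q₁ q₂ h1 h2 h3 h4 h5 h6 h7
    obtain ⟨R, hR⟩ := exists_lists_append (A := Q) (K := [q, q₁, q₂]) (by
      simp [h3.symm, h4.symm, h5]) (by simp [hq, h1, h2])
    refine main q₁ (q₂ :: R) hR h6 ?_
    rw [List.cons_append, List.isChain_cons_cons]
    refine ⟨h7, isChain_of_clique (L := (q₂ :: R) ++ [q₁])
      ((List.perm_append_comm (l₁ := [q₁])).nodup_iff.1 (List.nodup_cons.1 hR.1).2) ?_⟩
    intro u hu v hv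
    exact P.adj_Q u ((hR.2 u).1 (by simp at hu ⊢; tauto)) v ((hR.2 v).1 (by simp at hv ⊢; tauto))
  by_cases h12 : q₁ = q₂
  · subst h12
    by_cases hw : ∃ w ∈ Q, w ≠ q ∧ w ≠ q₁
    · obtain ⟨w, hw, hwq, hwq₁⟩ := hw
      rcases hα a c w (S.ne ha hc) (fun h => P.notMem_Q_of_N a (S.left ha) (h ▸ hw))
        (fun h => P.notMem_Q_of_N c (S.right hc) (h ▸ hw)) with h | h | h
      · exact absurd h (S.not_adj a ha c hc)
      · exact main' w q₁ hw hq₁ hwq hq₁q hwq₁ h hcq₂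
      · exact main' q₁ w hq₁ hw hq₁q hwq hwq₁.symm haq₁ h
    · push Not at hw
      refine main q₁ [] ⟨by simpa using hq₁q.symm, fun v => ?_⟩ haq₁ (by simpa using hcq₂)
      simp only [List.append_nil, List.mem_cons, List.not_mem_nil, or_false]
      constructor
      · rintro (rfl | rfl) <;> assumption
      · intro hv
        by_cases h : v = q
        · exact Or.inl h
        · exact Or.inr (hw v hv h)
  · exact main' q₁ q₂ hq₁ hq₂ hq₁q hq₂q h12 haq₁ hcq₂

/-- If each vertex of `Q` sees exactly one of `N₁`, `N₂`, the graph is a blown-up pentagon. -/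
theorem of_isSplit_of_pentagon [Fintype V] (P : AntipodalPartition G X N Q)
    (hα : NoIndepTriple G) (hG : IsKConnected 3 G) (S : IsSplit G N N₁ N₂) {x a₀ b₀ : V}
    (hx : x ∈ X) (hXx : ∀ v ∈ X, v = x) (ha₀ : a₀ ∈ N₁) (hb₀ : b₀ ∈ N₁) (hab₀ : a₀ ≠ b₀)
    (hQ : Q.Nonempty)
    (hno₁ : ∀ q ∈ Q, (∀ c ∈ N₂, G.Adj q c) → ∀ a ∈ N₁, ¬ G.Adj a q)
    (hno₂ : ∀ q ∈ Q, (∀ a ∈ N₁, G.Adj q a) → ∀ c ∈ N₂, ¬ G.Adj c q) :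
    HasSpanningHalinSubgraph G := by
  classical
  have hor : ∀ q ∈ Q, (¬ ∀ a ∈ N₁, G.Adj q a) → ∀ c ∈ N₂, G.Adj q c := by
    intro q hq h c hc
    push Not at h
    obtain ⟨a, ha, h⟩ := h
    rcases hα a c q (S.ne ha hc) (fun h => P.notMem_Q_of_N a (S.left ha) (h ▸ hq))
        (fun h => P.notMem_Q_of_N c (S.right hc) (h ▸ hq)) with h' | h' | h'
    · exact absurd h' (S.not_adj a ha c hc)
    · exact absurd h'.symm h
    · exact h'.symm
  -- The pentagon is `X`, `N₁`, the part of `Q` joined to `N₁`, the part joined to `N₂`, `N₂`.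
  let f : V → ℕ := fun v => if v ∈ X then 0 else if v ∈ N₁ then 1 else
    if v ∈ N₂ then 4 else if ∀ a ∈ N₁, G.Adj v a then 2 else 3
  have hcl : ∀ v, (f v = 0 ∧ v ∈ X) ∨ (f v = 1 ∧ v ∈ N₁) ∨
      (f v = 2 ∧ v ∈ Q ∧ ∀ a ∈ N₁, G.Adj v a) ∨ (f v = 3 ∧ v ∈ Q ∧ ∀ c ∈ N₂, G.Adj v c) ∨
      (f v = 4 ∧ v ∈ N₂) := by
    intro v
    by_cases h1 : v ∈ X
    · exact Or.inl ⟨by simp [f, h1], h1⟩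
    by_cases h2 : v ∈ N₁
    · exact Or.inr (Or.inl ⟨by simp [f, h1, h2], h2⟩)
    by_cases h3 : v ∈ N₂
    · exact Or.inr (Or.inr (Or.inr (Or.inr ⟨by simp [f, h1, h2, h3], h3⟩)))
    have hvQ : v ∈ Q := by
      have := P.cover v
      rw [S.mem_iff] at this
      tauto
    by_cases h4 : ∀ a ∈ N₁, G.Adj v a
    · exact Or.inr (Or.inr (Or.inl ⟨by simp only [f, if_neg h1, if_neg h2, if_neg h3, if_pos h4],
        hvQ, h4⟩))
    · exact Or.inr (Or.inr (Or.inr (Or.inl ⟨by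
        simp only [f, if_neg h1, if_neg h2, if_neg h3, if_neg h4], hvQ, hor v hvQ h4⟩)))
  have hf1 : ∀ v ∈ N₁, f v = 1 := by
    intro v hv
    have h1 : v ∉ X := fun h => P.notMem_N v h (S.left hv)
    simp [f, h1, hv]
  have hf4 : ∀ v ∈ N₂, f v = 4 := by
    intro v hv
    have h1 : v ∉ X := fun h => P.notMem_N v h (S.right hv)
    have h2 : v ∉ N₁ := fun h => S.disj v h hv
    simp [f, h1, h2, hv]
  have hf2 : ∀ v ∈ Q, ∀ u ∈ N₁, G.Adj u v → f v = 2 := by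
    intro v hv u hu huv
    rcases hcl v with h | h | h | h | h
    · exact absurd hv (P.notMem_Q v h.2)
    · exact absurd hv (P.notMem_Q_of_N v (S.left h.2))
    · exact h.1
    · exact absurd huv (hno₁ v hv h.2.2 u hu)
    · exact absurd hv (P.notMem_Q_of_N v (S.right h.2))
  have hf3 : ∀ v ∈ Q, ∀ u ∈ N₂, G.Adj u v → f v = 3 := by
    intro v hv u hu huv
    rcases hcl v with h | h | h | h | h
    · exact absurd hv (P.notMem_Q v h.2)
    · exact absurd hv (P.notMem_Q_of_N v (S.left h.2))
    · exact absurd huv (hno₂ v hv h.2.2 u hu)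
    · exact h.1
    · exact absurd hv (P.notMem_Q_of_N v (S.right h.2))
  have hadj : ∀ u v, u ≠ v → f u ≤ f v → f v ≤ f u + 1 → G.Adj u v := by
    intro u v hne h1 h2
    rcases hcl u with hu | hu | hu | hu | hu <;> rcases hcl v with hv | hv | hv | hv | hv <;>
      first
      | (exfalso; have := hu.1; have := hv.1; omega)
      | skip
    · exact P.adj_X u hu.2 v hv.2 hne
    · exact P.adj_X_N u hu.2 v (S.left hv.2)
    · exact S.adj_left hα hu.2 hv.2 hne
    · exact (hv.2.2 u hu.2).symm
    · exact P.adj_Q u hu.2.1 v hv.2.1 hne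
    · exact P.adj_Q u hu.2.1 v hv.2.1 hne
    · exact P.adj_Q u hu.2.1 v hv.2.1 hne
    · exact hu.2.2 v hv.2
    · exact S.symm.adj_left hα hu.2 hv.2 hne
  obtain ⟨q, hq⟩ := hQ
  refine hasSpanningHalinSubgraph_of_thick_cycle f 3 (by norm_num) ?_ ?_ ?_ ?_ ?_ ?_
  · intro v
    rcases hcl v with h | h | h | h | h <;> omega
  · intro u v hne h1 h2
    rcases Nat.le_total (f u) (f v) with h | h
    · exact hadj u v hne h h2
    · exact (hadj v u hne.symm h h1).symm
  · intro u v hu hv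
    have hu' : u ∈ X := by rcases hcl u with h | h | h | h | h <;> first | exact h.2 | omega
    have hv' : v ∈ N₂ := by rcases hcl v with h | h | h | h | h <;> first | omega | exact h.2
    exact P.adj_X_N u hu' v (S.right hv')
  · exact ⟨x, by simp [f, hx]⟩
  · obtain ⟨c, hc⟩ := S.nonempty_right
    exact ⟨c, hf4 c hc⟩
  · intro i hi hi'
    interval_cases i
    · exact ⟨a₀, b₀, hf1 a₀ ha₀, hf1 b₀ hb₀, hab₀⟩
    · obtain ⟨u, hu, v, hv, -, huv⟩ := P.exists_adj_ne_of_isSplit hG S hx hXx hq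
      obtain ⟨u', hu', v', hv', hne, huv'⟩ := P.exists_adj_ne_of_isSplit hG S hx hXx hv
      exact ⟨v, v', hf2 v hv u hu huv, hf2 v' hv' u' hu' huv', hne.symm⟩
    · obtain ⟨u, hu, v, hv, -, huv⟩ := P.exists_adj_ne_of_isSplit hG S.symm hx hXx hq
      obtain ⟨u', hu', v', hv', hne, huv'⟩ := P.exists_adj_ne_of_isSplit hG S.symm hx hXx hv
      exact ⟨v, v', hf3 v hv u hu huv, hf3 v' hv' u' hu' huv', hne.symm⟩

theorem of_isSplit [Fintype V] (P : AntipodalPartition G X N Q) (hα : NoIndepTriple G)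
    (hG : IsKConnected 3 G) (S : IsSplit G N N₁ N₂) {x a b : V} (hx : x ∈ X) (ha : a ∈ N₁)
    (hb : b ∈ N₁) (hab : a ≠ b) : HasSpanningHalinSubgraph G := by
  obtain ⟨c, hc⟩ := S.nonempty_right
  have hQ2 : ∀ K : List V, (∀ w ∈ Q, w ∈ K) → 2 ≤ K.length := by
    intro K hK
    refine P.bound c [a, b] K (by simpa using hab) ?_ hK
    intro w hw
    simp at hw
    rcases hw with rfl | rfl
    · exact ⟨S.ne ha hc, fun h => S.not_adj _ ha c hc h.symm⟩
    · exact ⟨S.ne hb hc, fun h => S.not_adj _ hb c hc h.symm⟩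
  obtain ⟨q, hq, -⟩ := P.exists_adj_Q c (S.right hc)
  by_cases hXx : ∀ v ∈ X, v = x
  · by_cases h1 : ∃ q ∈ Q, (∀ c ∈ N₂, G.Adj q c) ∧ ∃ a ∈ N₁, G.Adj a q
    · obtain ⟨q, hq, hqN, p, hp, hpq⟩ := h1
      exact P.of_isSplit_of_complete hα hG S hx hXx ha hb hab hq hqN hp hpq
    by_cases h2 : ∃ q ∈ Q, (∀ a ∈ N₁, G.Adj q a) ∧ ∃ c ∈ N₂, G.Adj c q
    · obtain ⟨q, hq, hqN, p, hp, hpq⟩ := h2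
      by_cases hd : ∃ d ∈ N₂, p ≠ d
      · obtain ⟨d, hd, hpd⟩ := hd
        exact P.of_isSplit_of_complete hα hG S.symm hx hXx hp hd hpd hq hqN hp hpq
      · push Not at hd
        exact absurd ⟨q, hq, fun c hc => hd c hc ▸ hpq.symm, a, ha, (hqN a ha).symm⟩ h1
    push Not at h1 h2
    exact P.of_isSplit_of_pentagon hα hG S hx hXx ha hb hab ⟨q, hq⟩ h1 h2
  · push Not at hXx
    obtain ⟨x', hx', hxx⟩ := hXx
    obtain ⟨L, hL⟩ := exists_lists_append (A := Q) (K := []) (by simp) (by simp)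
    match L, hL with
    | [], hL => have := hQ2 [] fun w => (hL.2 w).2; simp at this
    | [q], hL => have := hQ2 [q] fun w => (hL.2 w).2; simp at this
    | [q, q'], hL => exact P.of_isSplit_of_pair hα hL S hx hx' hxx.symm ha hb hab
    | q₀ :: q₁ :: q₂ :: L, hL =>
      exact P.of_isSplit_of_three hα hG hL.exists_ne_ne S hx hx' hxx.symm ha hb hab

end AntipodalPartition

/-- The case of graphs in which no three vertices are pairwise nonadjacent; the exclusion of claws
and bulls is not needed here. -/
theorem hasSpanningHalinSubgraph_of_noIndepTriple [Fintype V] (hG : IsKConnected 3 G)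
    (hα : NoIndepTriple G) : HasSpanningHalinSubgraph G := by
  have : Nonempty V := Fintype.card_pos_iff.1 (by have := hG.1; omega)
  obtain ⟨X, N, Q, hX, P⟩ := exists_antipodalPartition hα
  rcases Q.eq_empty_or_nonempty with hQ | ⟨q, hq⟩
  · have hall : ∀ v, v ∈ X := by
      intro v
      rcases P.cover v with h | h | h
      · exact h
      · obtain ⟨q, hq, -⟩ := P.exists_adj_Q v h
        simp [hQ] at hq
      · simp [hQ] at h
    exact hasSpanningHalinSubgraph_of_complete G hG.1 fun u v => P.adj_X u (hall u) v (hall v)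
  obtain ⟨x, hx⟩ := hX
  obtain ⟨p, hp, -⟩ := P.exists_ne_ne hG hx hq x x
  rcases exists_isHamPath_or_split hα ⟨p, hp⟩ with ⟨L, hL⟩ | ⟨N₁, N₂, h1, h2, hN, hd, hna⟩
  · obtain ⟨K, hK⟩ := exists_lists_append (A := Q) (K := []) (by simp) (by simp)
    match K, hK with
    | [], hK => have := (hK.2 q).2 hq; simp at this
    | [q], hK => exact P.of_isHamPath_of_singleton ⟨x, hx⟩ hG hK hL
    | [q, q'], hK => exact P.of_isHamPath_of_pair ⟨x, hx⟩ hG hK hL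
    | q₀ :: q₁ :: q₂ :: K, hK => exact P.of_isHamPath hα ⟨x, hx⟩ hG hK.exists_ne_ne hL
  · have S : IsSplit G N N₁ N₂ := ⟨h1, h2, fun v => by rw [← hN]; rfl,
      fun v h h' => Set.disjoint_left.1 hd h h', hna⟩
    obtain ⟨a, ha⟩ := h1
    obtain ⟨c, hc⟩ := h2
    obtain ⟨w, hw, hwa, hwc⟩ := P.exists_ne_ne hG hx hq a c
    rcases (S.mem_iff w).1 hw with h | h
    · exact P.of_isSplit hα hG S hx ha h hwa.symm
    · exact P.of_isSplit hα hG S.symm hx hc h hwc.symm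

end

/-! ### Longest induced paths -/

section

variable {V : Type*} {G : SimpleGraph V}

/-- No vertex has three pairwise nonadjacent neighbours. -/
def ClawRule (G : SimpleGraph V) : Prop :=
  ∀ c x y z, G.Adj c x → G.Adj c y → G.Adj c z → x ≠ y → x ≠ z → y ≠ z →
    G.Adj x y ∨ G.Adj x z ∨ G.Adj y z

/-- A triangle `a, b, c` with a further neighbour `d` of `a` and a further neighbour `e` of `b`
has an additional edge. -/
def BullRule (G : SimpleGraph V) : Prop :=
  ∀ a b c d e, G.Adj a b → G.Adj a c → G.Adj b c → G.Adj a d → G.Adj b e →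
    G.Adj d b ∨ G.Adj d c ∨ G.Adj e a ∨ G.Adj e c ∨ G.Adj d e

theorem clawRule_of_isInducedFree (h : IsInducedFree claw G) : ClawRule G := by
  intro c x y z hx hy hz hxy hxz hyz
  by_contra! hno
  obtain ⟨n1, n2, n3⟩ := hno
  have := hx.ne
  have := hy.ne
  have := hz.ne
  refine h ⟨⟨⟨Sum.elim (fun _ => c) ![x, y, z], ?_⟩, ?_⟩⟩
  · rintro (i | i) (j | j) hij
    · rw [Subsingleton.elim i j]
    · fin_cases j <;> simp_all
    · fin_cases i <;> simp_all
    · fin_cases i <;> fin_cases j <;> simp_all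
  · intro i j
    change G.Adj (Sum.elim (fun _ => c) ![x, y, z] i) (Sum.elim (fun _ => c) ![x, y, z] j) ↔ _
    have := hx.symm
    have := hy.symm
    have := hz.symm
    have := fun h : G.Adj y x => n1 h.symm
    have := fun h : G.Adj z x => n2 h.symm
    have := fun h : G.Adj z y => n3 h.symm
    rcases i with i | i <;> rcases j with j | j
    · simp
    · fin_cases j <;> simp_all
    · fin_cases i <;> simp_all
    · fin_cases i <;> fin_cases j <;> simp_all

theorem bullRule_of_isInducedFree (h : IsInducedFree bull G) : BullRule G := by
  intro a b c d e ab ac bc ad be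
  by_contra! hno
  obtain ⟨n1, n2, n3, n4, n5⟩ := hno
  have h1 := ab.ne
  have h2 := ac.ne
  have h3 := bc.ne
  have h4 := ad.ne
  have h5 := be.ne
  have m1 : d ≠ b := by rintro rfl; exact n2 bc
  have m2 : d ≠ c := by rintro rfl; exact n1 bc.symm
  have m3 : e ≠ a := by rintro rfl; exact n4 ac
  have m4 : e ≠ c := by rintro rfl; exact n3 ac.symm
  have m5 : d ≠ e := by rintro rfl; exact n1 be.symm
  refine h ⟨⟨⟨![a, b, c, d, e], ?_⟩, ?_⟩⟩
  · intro i j hij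
    fin_cases i <;> fin_cases j <;> simp_all
  · intro i j
    change G.Adj (![a, b, c, d, e] i) (![a, b, c, d, e] j) ↔ _
    have := ab.symm
    have := ac.symm
    have := bc.symm
    have := ad.symm
    have := be.symm
    have := fun h : G.Adj b d => n1 h.symm
    have := fun h : G.Adj c d => n2 h.symm
    have := fun h : G.Adj a e => n3 h.symm
    have := fun h : G.Adj c e => n4 h.symm
    have := fun h : G.Adj e d => n5 h.symm
    simp only [bull, SimpleGraph.fromEdgeSet_adj]
    fin_cases i <;> fin_cases j <;> simp_all

/-- `p 1, …, p k` are the vertices of an induced path, in this order. -/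
structure IsInducedPath (G : SimpleGraph V) (k : ℕ) (p : ℕ → V) : Prop where
  adj_iff : ∀ i j, 1 ≤ i → i ≤ k → 1 ≤ j → j ≤ k → (G.Adj (p i) (p j) ↔ i + 1 = j ∨ j + 1 = i)
  ne : ∀ i j, 1 ≤ i → i < j → j ≤ k → p i ≠ p j

theorem IsInducedPath.reverse {k : ℕ} {p : ℕ → V} (h : IsInducedPath G k p) :
    IsInducedPath G k fun j => p (k + 1 - j) := by
  refine ⟨fun i j h1 h2 h3 h4 => ?_, fun i j h1 h2 h3 => ?_⟩
  · rw [h.adj_iff _ _ (by omega) (by omega) (by omega) (by omega)]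
    omega
  · exact (h.ne _ _ (by omega) (by omega) (by omega)).symm

theorem IsInducedPath.cons {k : ℕ} {p : ℕ → V} (h : IsInducedPath G k p) {v : V}
    (hv : ∀ j, 1 ≤ j → j ≤ k → v ≠ p j) (hadj : ∀ j, 1 ≤ j → j ≤ k → (G.Adj v (p j) ↔ j = 1)) :
    IsInducedPath G (k + 1) fun j => if j = 1 then v else p (j - 1) := by
  refine ⟨fun i j h1 h2 h3 h4 => ?_, fun i j h1 h2 h3 => ?_⟩
  · by_cases hi : i = 1 <;> by_cases hj : j = 1
    · simp [hi, hj]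
    · simp only [hi, hj, if_true, if_false]
      rw [hadj _ (by omega) (by omega)]
      omega
    · simp only [hi, hj, if_true, if_false]
      rw [G.adj_comm, hadj _ (by omega) (by omega)]
      omega
    · simp only [hi, hj, if_false]
      rw [h.adj_iff _ _ (by omega) (by omega) (by omega) (by omega)]
      omega
  · have hj : j ≠ 1 := by omega
    by_cases hi : i = 1
    · simp only [hi, hj, if_true, if_false]
      exact hv _ (by omega) (by omega)
    · simp only [hi, hj, if_false]
      exact h.ne _ _ (by omega) (by omega) (by omega)

/-- A longest induced path `p 1, …, p k`, with at least five vertices, in a graph without induced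
claws and bulls. It suffices that no induced path has exactly `k + 1` vertices. -/
structure IsLongestPath (G : SimpleGraph V) (k : ℕ) (p : ℕ → V) : Prop where
  claw : ClawRule G
  bull : BullRule G
  five : 5 ≤ k
  path : IsInducedPath G k p
  longest : ∀ p', ¬ IsInducedPath G (k + 1) p'

namespace IsLongestPath

variable {k : ℕ} {p : ℕ → V}

theorem reverse (P : IsLongestPath G k p) : IsLongestPath G k fun j => p (k + 1 - j) :=
  ⟨P.claw, P.bull, P.five, P.path.reverse, P.longest⟩

theorem adj (P : IsLongestPath G k p) {i : ℕ} (h1 : 1 ≤ i) (h2 : i + 1 ≤ k) :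
    G.Adj (p i) (p (i + 1)) :=
  (P.path.adj_iff _ _ h1 (by omega) (by omega) h2).2 (Or.inl rfl)

theorem not_adj (P : IsLongestPath G k p) {i j : ℕ} (h1 : 1 ≤ i) (h2 : i ≤ k) (h3 : 1 ≤ j)
    (h4 : j ≤ k) (h5 : i + 2 ≤ j ∨ j + 2 ≤ i) : ¬ G.Adj (p i) (p j) := by
  rw [P.path.adj_iff _ _ h1 h2 h3 h4]
  omega

/-- A vertex adjacent to `p i` and `p (i + 1)` but not to `p (i + 2)` has no neighbours further
along the path, because of the triangle formed with `p i` and `p (i + 1)`. -/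
theorem not_adj_of_gap (P : IsLongestPath G k p) {v : V} (hv : ∀ j, 1 ≤ j → j ≤ k → v ≠ p j)
    {i l : ℕ} (hi : 1 ≤ i) (h0 : G.Adj v (p i)) (h1 : G.Adj v (p (i + 1)))
    (h2 : ¬ G.Adj v (p (i + 2))) (hl : i + 3 ≤ l) (hlk : l ≤ k) : ¬ G.Adj v (p l) := by
  have far : ∀ l, i + 4 ≤ l → l ≤ k → ¬ G.Adj v (p l) := by
    intro l hl hlk hvl
    rcases P.bull v (p (i + 1)) (p i) (p l) (p (i + 2)) h1 h0 (P.adj hi (by omega)).symm hvl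
      (P.adj (by omega) (by omega)) with h | h | h | h | h
    · exact P.not_adj (by omega) (by omega) (by omega) (by omega) (by omega) h
    · exact P.not_adj (by omega) (by omega) (by omega) (by omega) (by omega) h
    · exact h2 h.symm
    · exact P.not_adj (by omega) (by omega) (by omega) (by omega) (by omega) h
    · exact P.not_adj (by omega) (by omega) (by omega) (by omega) (by omega) h
  intro hvl
  rcases Nat.lt_or_ge (i + 3) l with hl' | hl'
  · exact far l hl' hlk hvl
  obtain rfl : l = i + 3 := by omega
  rcases Nat.lt_or_ge (i + 3) k with hk | hk
  · rcases P.claw (p (i + 3)) (p (i + 2)) (p (i + 4)) v (P.adj (by omega) (by omega)).symm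
      (P.adj (by omega) (by omega)) hvl.symm (P.path.ne _ _ (by omega) (by omega) (by omega))
      (hv _ (by omega) (by omega)).symm (hv _ (by omega) (by omega)).symm with h | h | h
    · exact P.not_adj (by omega) (by omega) (by omega) (by omega) (by omega) h
    · exact h2 h.symm
    · exact far _ le_rfl (by omega) h.symm
  · have := P.five
    obtain ⟨i, rfl⟩ := Nat.exists_eq_add_of_le' (show 1 ≤ i by omega)
    rcases P.bull (p (i + 1)) (p (i + 1 + 1)) v (p i) (p (i + 1 + 2)) (P.adj hi (by omega))
      h0.symm h1.symm (P.adj (by omega) (by omega)).symm (P.adj (by omega) (by omega)) with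
      h | h | h | h | h
    · exact P.not_adj (by omega) (by omega) (by omega) (by omega) (by omega) h
    · rcases P.claw v (p i) (p (i + 1 + 1)) (p (i + 1 + 3)) h.symm h1 hvl
        (P.path.ne _ _ (by omega) (by omega) (by omega))
        (P.path.ne _ _ (by omega) (by omega) (by omega))
        (P.path.ne _ _ (by omega) (by omega) (by omega)) with h | h | h
      · exact P.not_adj (by omega) (by omega) (by omega) (by omega) (by omega) h
      · exact P.not_adj (by omega) (by omega) (by omega) (by omega) (by omega) h
      · exact P.not_adj (by omega) (by omega) (by omega) (by omega) (by omega) h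
    · exact P.not_adj (by omega) (by omega) (by omega) (by omega) (by omega) h
    · exact h2 h.symm
    · exact P.not_adj (by omega) (by omega) (by omega) (by omega) (by omega) h

/-- The mirror image of `not_adj_of_gap`. -/
theorem not_adj_of_gap' (P : IsLongestPath G k p) {v : V} (hv : ∀ j, 1 ≤ j → j ≤ k → v ≠ p j)
    {i l : ℕ} (hi : i + 2 ≤ k) (h0 : G.Adj v (p (i + 1))) (h1 : G.Adj v (p (i + 2)))
    (h2 : ¬ G.Adj v (p i)) (hl : 1 ≤ l) (hlk : l + 1 ≤ i) : ¬ G.Adj v (p l) := by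
  have := P.reverse.not_adj_of_gap (v := v) (fun j _ _ => hv _ (by omega) (by omega))
    (i := k - 1 - i) (l := k + 1 - l) (by omega) ?_ ?_ ?_ (by omega) (by omega)
  · simpa only [show k + 1 - (k + 1 - l) = l by omega] using this
  · simpa only [show k + 1 - (k - 1 - i) = i + 2 by omega] using h1
  · simpa only [show k + 1 - (k - 1 - i + 1) = i + 1 by omega] using h0
  · simpa only [show k + 1 - (k - 1 - i + 2) = i by omega] using h2

theorem not_only_first (P : IsLongestPath G k p) {v : V} (hv : ∀ j, 1 ≤ j → j ≤ k → v ≠ p j)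
    (h : ∀ j, 1 ≤ j → j ≤ k → (G.Adj v (p j) ↔ j = 1)) : False :=
  P.longest _ (P.path.cons hv h)

/-- A vertex off the path with a neighbour on it sees it either like some `p i`, or just in its two
ends. A vertex with two consecutive neighbours on the path has no others than these and at most one
next to them; without consecutive neighbours it has none in the interior of the path, and a single
one at an end would extend the path. -/
theorem adj_iff_interval_or_ends (P : IsLongestPath G k p) {v : V}
    (hv : ∀ j, 1 ≤ j → j ≤ k → v ≠ p j) (hn : ∃ j, 1 ≤ j ∧ j ≤ k ∧ G.Adj v (p j)) :
    (∃ i, 1 ≤ i ∧ i ≤ k ∧ ∀ j, 1 ≤ j → j ≤ k → (G.Adj v (p j) ↔ j ≤ i + 1 ∧ i ≤ j + 1)) ∨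
      ∀ j, 1 ≤ j → j ≤ k → (G.Adj v (p j) ↔ j = 1 ∨ j = k) := by
  classical
  have h5 := P.five
  by_cases hpair : ∃ i, 1 ≤ i ∧ i + 1 ≤ k ∧ G.Adj v (p i) ∧ G.Adj v (p (i + 1))
  · left
    obtain ⟨hi1, hik, hvi, hvi'⟩ := Nat.find_spec hpair
    have hleast := fun j (h : j < Nat.find hpair) => Nat.find_min hpair h
    generalize Nat.find hpair = i at hi1 hik hvi hvi' hleast
    have hprev : ∀ j, j + 1 = i → 1 ≤ j → ¬ G.Adj v (p j) := by
      rintro j rfl hj h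
      exact hleast j (by omega) ⟨hj, by omega, h, hvi⟩
    have hbelow : ∀ l, 1 ≤ l → l < i → ¬ G.Adj v (p l) := by
      intro l hl hli
      obtain ⟨j, rfl⟩ := Nat.exists_eq_add_of_le' hi1
      rcases Nat.lt_or_ge l j with h | h
      · exact P.not_adj_of_gap' hv (by omega) hvi hvi' (hprev j rfl (by omega)) hl h
      · exact hprev l (by omega) hl
    by_cases h2 : i + 2 ≤ k ∧ G.Adj v (p (i + 2))
    · obtain ⟨h2k, hv2⟩ := h2
      have h3 : i + 3 ≤ k → ¬ G.Adj v (p (i + 3)) := by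
        intro h3k hv3
        by_cases h4 : i + 4 ≤ k
        · rcases P.bull v (p (i + 3)) (p (i + 2)) (p i) (p (i + 4)) hv3 hv2
            (P.adj (by omega) (by omega)).symm hvi (P.adj (by omega) (by omega)) with
            h | h | h | h | h
          · exact P.not_adj (by omega) (by omega) (by omega) (by omega) (by omega) h
          · exact P.not_adj (by omega) (by omega) (by omega) (by omega) (by omega) h
          · rcases P.claw v (p i) (p (i + 2)) (p (i + 4)) hvi hv2 h.symm
              (P.path.ne _ _ (by omega) (by omega) (by omega))
              (P.path.ne _ _ (by omega) (by omega) (by omega))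
              (P.path.ne _ _ (by omega) (by omega) (by omega)) with h | h | h
            · exact P.not_adj (by omega) (by omega) (by omega) (by omega) (by omega) h
            · exact P.not_adj (by omega) (by omega) (by omega) (by omega) (by omega) h
            · exact P.not_adj (by omega) (by omega) (by omega) (by omega) (by omega) h
          · exact P.not_adj (by omega) (by omega) (by omega) (by omega) (by omega) h
          · exact P.not_adj (by omega) (by omega) (by omega) (by omega) (by omega) h
        · obtain ⟨j, rfl⟩ := Nat.exists_eq_add_of_le' hi1
          rcases P.bull v (p (j + 1)) (p (j + 1 + 1)) (p (j + 1 + 3)) (p j) hvi hvi'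
            (P.adj (by omega) (by omega)) hv3 (P.adj (by omega) (by omega)).symm with
            h | h | h | h | h
          · exact P.not_adj (by omega) (by omega) (by omega) (by omega) (by omega) h
          · exact P.not_adj (by omega) (by omega) (by omega) (by omega) (by omega) h
          · exact hprev j rfl (by omega) h.symm
          · exact P.not_adj (by omega) (by omega) (by omega) (by omega) (by omega) h
          · exact P.not_adj (by omega) (by omega) (by omega) (by omega) (by omega) h
      refine ⟨i + 1, by omega, by omega, fun j hj hjk => ⟨fun h => ?_, fun h => ?_⟩⟩
      · by_contra hcon
        rcases Nat.lt_or_ge j i with hji | hji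
        · exact hbelow j hj hji h
        · rcases Nat.lt_or_ge (i + 3) j with h' | h'
          · exact P.not_adj_of_gap hv (i := i + 1) (by omega) hvi' hv2 (h3 (by omega))
              (by omega) hjk h
          · obtain rfl : j = i + 3 := by omega
            exact h3 hjk h
      · obtain rfl | rfl | rfl : j = i ∨ j = i + 1 ∨ j = i + 2 := by omega
        · exact hvi
        · exact hvi'
        · exact hv2
    · have habove : ∀ j, i + 2 ≤ j → j ≤ k → ¬ G.Adj v (p j) := by
        intro j hj hjk h
        have h2' : ¬ G.Adj v (p (i + 2)) := fun h => h2 ⟨by omega, h⟩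
        rcases Nat.lt_or_ge (i + 2) j with h' | h'
        · exact P.not_adj_of_gap hv hi1 hvi hvi' h2' h' hjk h
        · obtain rfl : j = i + 2 := by omega
          exact h2' h
      have hend : i = 1 ∨ i + 1 = k := by
        by_contra! hcon
        obtain ⟨j, rfl⟩ := Nat.exists_eq_add_of_le' hi1
        rcases P.bull (p (j + 1)) (p (j + 1 + 1)) v (p j) (p (j + 1 + 2))
          (P.adj (by omega) (by omega)) hvi.symm hvi'.symm (P.adj (by omega) (by omega)).symm
          (P.adj (by omega) (by omega)) with h | h | h | h | h
        · exact P.not_adj (by omega) (by omega) (by omega) (by omega) (by omega) h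
        · exact hprev j rfl (by omega) h.symm
        · exact P.not_adj (by omega) (by omega) (by omega) (by omega) (by omega) h
        · exact habove _ le_rfl (by omega) h.symm
        · exact P.not_adj (by omega) (by omega) (by omega) (by omega) (by omega) h
      have hiff : ∀ j, 1 ≤ j → j ≤ k → (G.Adj v (p j) ↔ j = i ∨ j = i + 1) := by
        intro j hj hjk
        constructor
        · intro h
          by_contra hcon
          rcases Nat.lt_or_ge j i with h' | h'
          · exact hbelow j hj h' h
          · exact habove j (by omega) hjk h
        · rintro (rfl | rfl) <;> assumption
      rcases hend with rfl | hend
      · exact ⟨1, le_rfl, by omega, fun j hj hjk => by rw [hiff j hj hjk]; omega⟩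
      · exact ⟨k, by omega, le_rfl, fun j hj hjk => by rw [hiff j hj hjk]; omega⟩
  · right
    have hinner : ∀ j, 2 ≤ j → j + 1 ≤ k → ¬ G.Adj v (p j) := by
      intro j hj hjk h
      obtain ⟨j, rfl⟩ := Nat.exists_eq_add_of_le' (show 1 ≤ j by omega)
      rcases P.claw (p (j + 1)) (p j) (p (j + 1 + 1)) v (P.adj (by omega) (by omega)).symm
        (P.adj (by omega) (by omega)) h.symm (P.path.ne _ _ (by omega) (by omega) (by omega))
        (hv _ (by omega) (by omega)).symm (hv _ (by omega) (by omega)).symm with h' | h' | h'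
      · exact P.not_adj (by omega) (by omega) (by omega) (by omega) (by omega) h'
      · exact hpair ⟨j, by omega, by omega, h'.symm, h⟩
      · exact hpair ⟨j + 1, by omega, by omega, h, h'.symm⟩
    have hends : ∀ j, 1 ≤ j → j ≤ k → G.Adj v (p j) → j = 1 ∨ j = k := by
      intro j hj hjk h
      by_contra hcon
      exact hinner j (by omega) (by omega) h
    have hfirst : G.Adj v (p 1) := by
      by_contra h1
      have hk : ∀ j, 1 ≤ j → j ≤ k → G.Adj v (p j) → j = k := by
        intro j hj hjk h
        rcases hends j hj hjk h with rfl | h'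
        · exact absurd h h1
        · exact h'
      obtain ⟨j, hj, hjk, h⟩ := hn
      have := hk j hj hjk h
      subst this
      refine P.reverse.not_only_first (fun j _ _ => hv _ (by omega) (by omega)) fun i hi hij => ?_
      refine ⟨fun h' => ?_, ?_⟩
      · have := hk _ (by omega) (by omega) h'
        omega
      · rintro rfl
        simpa using h
    have hlast : G.Adj v (p k) := by
      by_contra hk
      refine P.not_only_first hv fun j hj hjk => ⟨fun h => ?_, ?_⟩
      · rcases hends j hj hjk h with h' | rfl
        · exact h'
        · exact absurd h hk
      · rintro rfl; exact hfirst
    refine fun j hj hjk => ⟨hends j hj hjk, ?_⟩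
    rintro (rfl | rfl) <;> assumption

end IsLongestPath

end

/-! ### Classes along a longest induced path -/

section

variable {V : Type*} {G : SimpleGraph V} {k : ℕ} {p : ℕ → V}

/-- The vertex `v` sees the path `p 1, …, p k` as its `i`-th vertex does: the vertices of the path
which are equal or adjacent to `v` are `p (i - 1)`, `p i` and `p (i + 1)`, as far as these exist. -/
def InClass (G : SimpleGraph V) (p : ℕ → V) (k : ℕ) (v : V) (i : ℕ) : Prop :=
  ∀ j, 1 ≤ j → j ≤ k → ((v = p j ∨ G.Adj v (p j)) ↔ j ≤ i + 1 ∧ i ≤ j + 1)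

/-- The vertex `v` outside of the path `p 1, …, p k` is adjacent to its ends only. -/
def InRing (G : SimpleGraph V) (p : ℕ → V) (k : ℕ) (v : V) : Prop :=
  ∀ j, 1 ≤ j → j ≤ k → v ≠ p j ∧ (G.Adj v (p j) ↔ j = 1 ∨ j = k)

theorem InClass.reverse {v : V} {i : ℕ} (h : InClass G p k v i) (h2 : i ≤ k) :
    InClass G (fun j => p (k + 1 - j)) k v (k + 1 - i) := by
  intro j hj hjk
  rw [h (k + 1 - j) (by omega) (by omega)]
  omega

theorem InRing.reverse {v : V} (h : InRing G p k v) : InRing G (fun j => p (k + 1 - j)) k v := by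
  intro j hj hjk
  have := h (k + 1 - j) (by omega) (by omega)
  refine ⟨this.1, ?_⟩
  rw [this.2]
  omega

theorem InClass.not_adj {v : V} {i j : ℕ} (h : InClass G p k v i) (h1 : 1 ≤ j) (h2 : j ≤ k)
    (h3 : i + 2 ≤ j ∨ j + 2 ≤ i) : ¬ G.Adj v (p j) := by
  intro h'
  have := (h j h1 h2).1 (Or.inr h')
  omega

theorem InClass.ne {v : V} {i j : ℕ} (h : InClass G p k v i) (h1 : 1 ≤ j) (h2 : j ≤ k)
    (h3 : i + 2 ≤ j ∨ j + 2 ≤ i) : v ≠ p j := by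
  intro h'
  have := (h j h1 h2).1 (Or.inl h')
  omega

theorem InClass.eq_or_adj {v : V} {i : ℕ} (h : InClass G p k v i) (h1 : 1 ≤ i) (h2 : i ≤ k) :
    v = p i ∨ G.Adj v (p i) :=
  (h i h1 h2).2 (by omega)

theorem InRing.not_adj {v : V} {j : ℕ} (h : InRing G p k v) (h1 : 2 ≤ j) (h2 : j + 1 ≤ k) :
    ¬ G.Adj v (p j) := by
  rw [(h j (by omega) (by omega)).2]
  omega

namespace IsLongestPath

theorem inClass_self (P : IsLongestPath G k p) {i : ℕ} (h1 : 1 ≤ i) (h2 : i ≤ k) :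
    InClass G p k (p i) i := by
  intro j hj hjk
  rw [P.path.adj_iff i j h1 h2 hj hjk]
  have : p i = p j ↔ i = j := by
    refine ⟨fun h => ?_, fun h => by rw [h]⟩
    rcases Nat.lt_trichotomy i j with h' | h' | h'
    · exact absurd h (P.path.ne i j h1 h' hjk)
    · exact h'
    · exact absurd h.symm (P.path.ne j i hj h' h2)
  rw [this]
  omega

/-- A vertex has only one class. -/
theorem eq_of_inClass (P : IsLongestPath G k p) {v : V} {i j : ℕ} (hi1 : 1 ≤ i) (hik : i ≤ k)
    (hj1 : 1 ≤ j) (hjk : j ≤ k) (hi : InClass G p k v i) (hj : InClass G p k v j) : i = j := by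
  have h5 := P.five
  have h : ∀ l, 1 ≤ l → l ≤ k → (l ≤ i + 1 ∧ i ≤ l + 1 ↔ l ≤ j + 1 ∧ j ≤ l + 1) :=
    fun l h1 h2 => by rw [← hi l h1 h2, hj l h1 h2]
  have a1 := h (i - 1)
  have a2 := h (i + 1)
  have a3 := h (j - 1)
  have a4 := h (j + 1)
  omega

theorem adj_of_inClass (P : IsLongestPath G k p) {v : V} {i j : ℕ} (hv : InClass G p k v i)
    (hi1 : 1 ≤ i) (hik : i ≤ k) (hj1 : 1 ≤ j) (hjk : j ≤ k) (h : i + 1 = j ∨ j + 1 = i) :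
    G.Adj v (p j) := by
  rcases (hv j hj1 hjk).2 (by omega) with rfl | h'
  · have := P.eq_of_inClass hi1 hik hj1 hjk hv (P.inClass_self hj1 hjk)
    omega
  · exact h'

theorem classify_of_adj (P : IsLongestPath G k p) {v : V}
    (hn : ∃ j, 1 ≤ j ∧ j ≤ k ∧ (v = p j ∨ G.Adj v (p j))) :
    (∃ i, 1 ≤ i ∧ i ≤ k ∧ InClass G p k v i) ∨ InRing G p k v := by
  by_cases hv : ∃ j, 1 ≤ j ∧ j ≤ k ∧ v = p j
  · obtain ⟨j, h1, h2, rfl⟩ := hv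
    exact Or.inl ⟨j, h1, h2, P.inClass_self h1 h2⟩
  · have hv' : ∀ j, 1 ≤ j → j ≤ k → v ≠ p j := fun j h1 h2 h => hv ⟨j, h1, h2, h⟩
    have hn' : ∃ j, 1 ≤ j ∧ j ≤ k ∧ G.Adj v (p j) := by
      obtain ⟨j, h1, h2, h | h⟩ := hn
      · exact absurd h (hv' j h1 h2)
      · exact ⟨j, h1, h2, h⟩
    rcases P.adj_iff_interval_or_ends hv' hn' with ⟨i, h1, h2, h⟩ | h
    · refine Or.inl ⟨i, h1, h2, fun j hj hjk => ?_⟩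
      rw [← h j hj hjk]
      simp [hv' j hj hjk]
    · exact Or.inr fun j hj hjk => ⟨hv' j hj hjk, h j hj hjk⟩

/-- The neighbours of vertices in the first class are on the path or have neighbours on it. -/
theorem exists_adj_of_adj_first (P : IsLongestPath G k p) {u v : V} (hu : InClass G p k u 1)
    (huv : G.Adj u v) : ∃ j, 1 ≤ j ∧ j ≤ k ∧ (v = p j ∨ G.Adj v (p j)) := by
  have h5 := P.five
  by_contra! hv
  rcases hu.eq_or_adj le_rfl (by omega) with rfl | hu1
  · exact (hv 1 (by omega) (by omega)).2 huv.symm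
  · have hu2 := P.adj_of_inClass hu (by omega) (by omega) (j := 2) (by omega) (by omega) (by omega)
    rcases P.bull u (p 2) (p 1) v (p 3) hu2 hu1 (P.adj (by omega) (by omega)).symm huv
      (P.adj (by omega) (by omega)) with h | h | h | h | h
    · exact (hv 2 (by omega) (by omega)).2 h
    · exact (hv 1 (by omega) (by omega)).2 h
    · exact hu.not_adj (by omega) (by omega) (by omega) h.symm
    · exact P.not_adj (by omega) (by omega) (by omega) (by omega) (by omega) h
    · exact (hv 3 (by omega) (by omega)).2 h

/-- A vertex adjacent to one which is on the path or has a neighbour on it is again of this kind;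
by connectedness, all vertices are. -/
theorem exists_adj_of_adj (P : IsLongestPath G k p) {u v : V}
    (hu : ∃ j, 1 ≤ j ∧ j ≤ k ∧ (u = p j ∨ G.Adj u (p j)))
    (huv : G.Adj u v) : ∃ j, 1 ≤ j ∧ j ≤ k ∧ (v = p j ∨ G.Adj v (p j)) := by
  have h5 := P.five
  rcases P.classify_of_adj hu with ⟨i, h1, h2, hu⟩ | hu
  · by_cases hi : i = 1
    · subst hi; exact P.exists_adj_of_adj_first hu huv
    by_cases hi' : i = k
    · have hr := hu.reverse h2
      rw [hi', show k + 1 - k = 1 by omega] at hr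
      obtain ⟨j, hj, hjk, h⟩ := P.reverse.exists_adj_of_adj_first hr huv
      exact ⟨k + 1 - j, by omega, by omega, h⟩
    obtain ⟨i, rfl⟩ := Nat.exists_eq_add_of_le' h1
    by_contra! hv
    rcases P.claw u (p i) (p (i + 1 + 1)) v
      (P.adj_of_inClass hu (by omega) (by omega) (by omega) (by omega) (by omega))
      (P.adj_of_inClass hu (by omega) (by omega) (by omega) (by omega) (by omega)) huv
      (P.path.ne _ _ (by omega) (by omega) (by omega)) (hv _ (by omega) (by omega)).1.symm
      (hv _ (by omega) (by omega)).1.symm with h | h | h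
    · exact P.not_adj (by omega) (by omega) (by omega) (by omega) (by omega) h
    · exact (hv _ (by omega) (by omega)).2 h.symm
    · exact (hv _ (by omega) (by omega)).2 h.symm
  · by_contra! hv
    rcases P.claw u (p 1) (p k) v ((hu 1 (by omega) (by omega)).2.2 (Or.inl rfl))
      ((hu k (by omega) (by omega)).2.2 (Or.inr rfl)) huv
      (P.path.ne _ _ (by omega) (by omega) (by omega)) (hv _ (by omega) (by omega)).1.symm
      (hv _ (by omega) (by omega)).1.symm with h | h | h
    · exact P.not_adj (by omega) (by omega) (by omega) (by omega) (by omega) h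
    · exact (hv _ (by omega) (by omega)).2 h.symm
    · exact (hv _ (by omega) (by omega)).2 h.symm

theorem adj_of_same (P : IsLongestPath G k p) {u v : V} {i : ℕ} (h1 : 1 ≤ i) (h2 : i ≤ k)
    (hu : InClass G p k u i) (hv : InClass G p k v i) (hne : u ≠ v) : G.Adj u v := by
  have h5 := P.five
  by_contra hno
  rcases Nat.lt_or_ge k (i + 2) with hi | hi
  · obtain ⟨i, rfl⟩ := Nat.exists_eq_add_of_le' (show 2 ≤ i by omega)
    rcases P.claw (p (i + 1)) u v (p i)
      (P.adj_of_inClass hu (by omega) (by omega) (by omega) (by omega) (by omega)).symm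
      (P.adj_of_inClass hv (by omega) (by omega) (by omega) (by omega) (by omega)).symm
      (P.adj (by omega) (by omega)).symm hne (hu.ne (by omega) (by omega) (by omega))
      (hv.ne (by omega) (by omega) (by omega)) with h | h | h
    · exact hno h
    · exact hu.not_adj (by omega) (by omega) (by omega) h
    · exact hv.not_adj (by omega) (by omega) (by omega) h
  · rcases P.claw (p (i + 1)) u v (p (i + 2))
      (P.adj_of_inClass hu (by omega) (by omega) (by omega) (by omega) (by omega)).symm
      (P.adj_of_inClass hv (by omega) (by omega) (by omega) (by omega) (by omega)).symm
      (P.adj (by omega) (by omega)) hne (hu.ne (by omega) (by omega) (by omega))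
      (hv.ne (by omega) (by omega) (by omega)) with h | h | h
    · exact hno h
    · exact hu.not_adj (by omega) (by omega) (by omega) h
    · exact hv.not_adj (by omega) (by omega) (by omega) h

theorem adj_of_ring (P : IsLongestPath G k p) {u v : V} (hu : InRing G p k u)
    (hv : InRing G p k v) (hne : u ≠ v) : G.Adj u v := by
  have h5 := P.five
  rcases P.claw (p 1) u v (p 2) ((hu 1 (by omega) (by omega)).2.2 (Or.inl rfl)).symm
    ((hv 1 (by omega) (by omega)).2.2 (Or.inl rfl)).symm (P.adj (by omega) (by omega)) hne
    (hu 2 (by omega) (by omega)).1 (hv 2 (by omega) (by omega)).1 with h | h | h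
  · exact h
  · exact absurd h (hu.not_adj (by omega) (by omega))
  · exact absurd h (hv.not_adj (by omega) (by omega))

theorem adj_succ_aux (P : IsLongestPath G k p) {u v : V} {i : ℕ} (h1 : 1 ≤ i) (h2 : i + 3 ≤ k)
    (hu : InClass G p k u i) (hv : InClass G p k v (i + 1)) : G.Adj u v := by
  have hu' := P.adj_of_inClass hu h1 (by omega) (j := i + 1) (by omega) (by omega) (by omega)
  rcases hv.eq_or_adj (by omega) (by omega) with rfl | hv1
  · exact hu'
  rcases P.bull (p (i + 1)) (p (i + 2)) v u (p (i + 3)) (P.adj (by omega) (by omega)) hv1.symm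
    (P.adj_of_inClass hv (by omega) (by omega) (by omega) (by omega) (by omega)).symm hu'.symm
    (P.adj (by omega) (by omega)) with h | h | h | h | h
  · exact absurd h (hu.not_adj (by omega) (by omega) (by omega))
  · exact h
  · exact absurd h (P.not_adj (by omega) (by omega) (by omega) (by omega) (by omega))
  · exact absurd h.symm (hv.not_adj (by omega) (by omega) (by omega))
  · exact absurd h (hu.not_adj (by omega) (by omega) (by omega))

theorem adj_of_succ (P : IsLongestPath G k p) {u v : V} {i : ℕ} (h1 : 1 ≤ i) (h2 : i + 1 ≤ k)
    (hu : InClass G p k u i) (hv : InClass G p k v (i + 1)) : G.Adj u v := by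
  have h5 := P.five
  rcases Nat.lt_or_ge k (i + 3) with h | h
  · have hu' := hu.reverse (by omega)
    have hv' := hv.reverse h2
    rw [show k + 1 - i = k + 1 - (i + 1) + 1 by omega] at hu'
    exact (P.reverse.adj_succ_aux (by omega) (by omega) hv' hu').symm
  · exact P.adj_succ_aux h1 h hu hv

theorem adj_ring_first (P : IsLongestPath G k p) {u v : V} (hu : InRing G p k u)
    (hv : InClass G p k v 1) : G.Adj u v := by
  have h5 := P.five
  have hu1 := (hu 1 (by omega) (by omega)).2.2 (Or.inl rfl)
  rcases hv.eq_or_adj le_rfl (by omega) with rfl | hv1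
  · exact hu1
  rcases P.bull (p 1) (p 2) v u (p 3) (P.adj (by omega) (by omega)) hv1.symm
    (P.adj_of_inClass hv (by omega) (by omega) (by omega) (by omega) (by omega)).symm hu1.symm
    (P.adj (by omega) (by omega)) with h | h | h | h | h
  · exact absurd h (hu.not_adj (by omega) (by omega))
  · exact h
  · exact absurd h (P.not_adj (by omega) (by omega) (by omega) (by omega) (by omega))
  · exact absurd h.symm (hv.not_adj (by omega) (by omega) (by omega))
  · exact absurd h (hu.not_adj (by omega) (by omega))

theorem adj_ring_last (P : IsLongestPath G k p) {u v : V} (hu : InRing G p k u)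
    (hv : InClass G p k v k) : G.Adj u v := by
  have h5 := P.five
  have hv' := hv.reverse le_rfl
  rw [show k + 1 - k = 1 by omega] at hv'
  exact P.reverse.adj_ring_first hu.reverse hv'

theorem not_adj_aux (P : IsLongestPath G k p) {u v : V} {i j : ℕ} (h1 : 1 ≤ i) (hij : i + 2 ≤ j)
    (hjk : j < k) (hu : InClass G p k u i) (hv : InClass G p k v j) : ¬ G.Adj u v := by
  have h5 := P.five
  intro huv
  have hvj : G.Adj v (p j) := by
    rcases hv.eq_or_adj (by omega) hjk.le with rfl | h
    · exact absurd huv (hu.not_adj (by omega) (by omega) (by omega))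
    · exact h
  obtain ⟨j, rfl⟩ := Nat.exists_eq_add_of_le' (show 1 ≤ j by omega)
  have hv0 := P.adj_of_inClass hv (by omega) (by omega) (j := j) (by omega) (by omega) (by omega)
  have hv2 := P.adj_of_inClass hv (by omega) (by omega) (j := j + 2) (by omega) (by omega)
    (by omega)
  rcases Nat.lt_or_ge (i + 2) (j + 1) with h | h
  · rcases P.claw v u (p j) (p (j + 2)) huv.symm hv0 hv2 (hu.ne (by omega) (by omega) (by omega))
      (hu.ne (by omega) (by omega) (by omega)) (P.path.ne _ _ (by omega) (by omega) (by omega))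
      with h | h | h
    · exact hu.not_adj (by omega) (by omega) (by omega) h
    · exact hu.not_adj (by omega) (by omega) (by omega) h
    · exact P.not_adj (by omega) (by omega) (by omega) (by omega) (by omega) h
  obtain rfl : j = i + 1 := by omega
  rcases Nat.lt_or_ge k (i + 4) with hk | hk
  · obtain ⟨i, rfl⟩ := Nat.exists_eq_add_of_le' (show 1 ≤ i by omega)
    have hu0 := P.adj_of_inClass hu (by omega) (by omega) (j := i) (by omega) (by omega) (by omega)
    have hu2 := P.adj_of_inClass hu (by omega) (by omega) (j := i + 1 + 1) (by omega) (by omega)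
      (by omega)
    rcases P.bull u v (p (i + 1 + 1)) (p i) (p (i + 1 + 1 + 2)) huv hu2 hv0 hu0 hv2 with
      h | h | h | h | h
    · exact hv.not_adj (by omega) (by omega) (by omega) h.symm
    · exact P.not_adj (by omega) (by omega) (by omega) (by omega) (by omega) h
    · exact hu.not_adj (by omega) (by omega) (by omega) h.symm
    · exact P.not_adj (by omega) (by omega) (by omega) (by omega) (by omega) h
    · exact P.not_adj (by omega) (by omega) (by omega) (by omega) (by omega) h
  · rcases P.bull v (p (i + 1 + 2)) (p (i + 1 + 1)) u (p (i + 4)) hv2 hvj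
      (P.adj (by omega) (by omega)).symm huv.symm (P.adj (by omega) (by omega)) with
      h | h | h | h | h
    · exact hu.not_adj (by omega) (by omega) (by omega) h
    · exact hu.not_adj (by omega) (by omega) (by omega) h
    · exact hv.not_adj (by omega) (by omega) (by omega) h.symm
    · exact P.not_adj (by omega) (by omega) (by omega) (by omega) (by omega) h
    · exact hu.not_adj (by omega) (by omega) (by omega) h

theorem not_adj_of_inClass (P : IsLongestPath G k p) {u v : V} {i j : ℕ} (h1 : 1 ≤ i)
    (hij : i + 2 ≤ j) (hjk : j ≤ k) (hu : InClass G p k u i) (hv : InClass G p k v j) :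
    ¬ G.Adj u v := by
  have h5 := P.five
  rcases hjk.lt_or_eq with hjk | rfl
  · exact P.not_adj_aux h1 hij hjk hu hv
  rcases h1.lt_or_eq with h1 | rfl
  · exact fun h => P.reverse.not_adj_aux (by omega) (by omega) (by omega)
      (hv.reverse (by omega)) (hu.reverse (by omega)) h.symm
  intro huv
  have hu1 : G.Adj u (p 1) := by
    rcases hu.eq_or_adj (by omega) (by omega) with rfl | h
    · exact absurd huv.symm (hv.not_adj (by omega) (by omega) (by omega))
    · exact h
  have hu2 := P.adj_of_inClass hu (by omega) (by omega) (j := 2) (by omega) (by omega) (by omega)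
  rcases P.bull u (p 2) (p 1) v (p 3) hu2 hu1 (P.adj (by omega) (by omega)).symm huv
    (P.adj (by omega) (by omega)) with h | h | h | h | h
  · exact hv.not_adj (by omega) (by omega) (by omega) h
  · exact hv.not_adj (by omega) (by omega) (by omega) h
  · exact hu.not_adj (by omega) (by omega) (by omega) h.symm
  · exact P.not_adj (by omega) (by omega) (by omega) (by omega) (by omega) h
  · exact hv.not_adj (by omega) (by omega) (by omega) h

theorem not_adj_ring_aux (P : IsLongestPath G k p) {u v : V} {i : ℕ} (h1 : 2 ≤ i) (hik : i + 2 ≤ k)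
    (hu : InRing G p k u) (hv : InClass G p k v i) : ¬ G.Adj u v := by
  have h5 := P.five
  intro huv
  obtain ⟨i, rfl⟩ := Nat.exists_eq_add_of_le' (show 1 ≤ i by omega)
  have hv0 := P.adj_of_inClass hv (by omega) (by omega) (j := i) (by omega) (by omega) (by omega)
  have hv2 := P.adj_of_inClass hv (by omega) (by omega) (j := i + 2) (by omega) (by omega)
    (by omega)
  have hu2 := hu.not_adj (j := i + 2) (by omega) (by omega)
  by_cases hi : i = 1
  · subst hi
    have huk := (hu k (by omega) le_rfl).2.2 (Or.inr rfl)
    rcases P.bull u v (p 1) (p k) (p (1 + 2)) huv ((hu 1 (by omega) (by omega)).2.2 (Or.inl rfl))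
      hv0 huk hv2 with h | h | h | h | h
    · exact hv.not_adj (by omega) (by omega) (by omega) h.symm
    · exact P.not_adj (by omega) (by omega) (by omega) (by omega) (by omega) h
    · exact hu2 h.symm
    · exact P.not_adj (by omega) (by omega) (by omega) (by omega) (by omega) h
    · exact P.not_adj (by omega) (by omega) (by omega) (by omega) (by omega) h
  · rcases P.claw v u (p i) (p (i + 2)) huv.symm hv0 hv2 (hu _ (by omega) (by omega)).1
      (hu _ (by omega) (by omega)).1 (P.path.ne _ _ (by omega) (by omega) (by omega))
      with h | h | h
    · exact hu.not_adj (by omega) (by omega) h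
    · exact hu2 h
    · exact P.not_adj (by omega) (by omega) (by omega) (by omega) (by omega) h

theorem not_adj_ring (P : IsLongestPath G k p) {u v : V} {i : ℕ} (h1 : 2 ≤ i) (hik : i + 1 ≤ k)
    (hu : InRing G p k u) (hv : InClass G p k v i) : ¬ G.Adj u v := by
  have h5 := P.five
  rcases Nat.lt_or_ge k (i + 2) with h | h
  · exact P.reverse.not_adj_ring_aux (by omega) (by omega) hu.reverse
      (hv.reverse (by omega))
  · exact P.not_adj_ring_aux h1 h hu hv

end IsLongestPath

end

/-! ### Graphs with an independent triple -/

section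

variable {V : Type*} {G : SimpleGraph V}

theorem IsKConnected.exists_adj [Fintype V] (hG : IsKConnected 3 G) (A : Set V) {a b : V}
    (ha : a ∈ A) (hb : b ∉ A) : ∃ u v, u ∈ A ∧ v ∉ A ∧ G.Adj u v := by
  classical
  obtain ⟨d, hd⟩ : ∃ d, d ∉ ({a, b} : Finset V) := by
    by_contra! h
    have h1 : (Finset.univ : Finset V).card ≤ ({a, b} : Finset V).card :=
      Finset.card_le_card fun v _ => h v
    have h2 := hG.1
    have h3 : ({a, b} : Finset V).card ≤ 2 := Finset.card_le_two
    rw [Finset.card_univ] at h1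
    omega
  simp at hd
  obtain ⟨u, v, hu, hv, -, -, -, -, h⟩ := hG.exists_adj_across A ha (Ne.symm hd.1) (Ne.symm hd.1)
    hb (Ne.symm hd.2) (Ne.symm hd.2)
  exact ⟨u, v, hu, hv, h⟩

/-- An independent triple can be chosen so that two of its members have a common neighbour. -/
theorem exists_indep_triple_common [Fintype V] (hG : IsKConnected 3 G) (hα : ¬ NoIndepTriple G) :
    ∃ a b c w, a ≠ b ∧ a ≠ c ∧ b ≠ c ∧ ¬ G.Adj a b ∧ ¬ G.Adj a c ∧ ¬ G.Adj b c ∧ G.Adj a w ∧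
      G.Adj b w := by
  simp only [NoIndepTriple] at hα
  push Not at hα
  obtain ⟨a, b, c, hab, hac, hbc, nab, nac, nbc⟩ := hα
  obtain ⟨u, v, hu, hv, huv⟩ := hG.exists_adj {v | v = a ∨ G.Adj a v} (a := a) (b := b) (Or.inl rfl)
    (by rintro (h | h); exacts [hab h.symm, nab h])
  simp only [Set.mem_ofPred_eq, not_or] at hu hv
  have hau : G.Adj a u := by
    rcases hu with rfl | h
    · exact absurd huv hv.2
    · exact h
  by_cases hvb : v = b
  · subst hvb
    exact ⟨a, v, c, u, hab, hac, hbc, nab, nac, nbc, hau, huv.symm⟩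
  by_cases hvc : v = c
  · subst hvc
    exact ⟨a, v, b, u, hac, hab, hbc.symm, nac, nab, fun h => nbc h.symm, hau, huv.symm⟩
  by_cases nvb : G.Adj v b
  · by_cases nvc : G.Adj v c
    · exact ⟨b, c, a, v, hbc, hab.symm, hac.symm, nbc, fun h => nab h.symm, fun h => nac h.symm,
        nvb.symm, nvc.symm⟩
    · exact ⟨a, v, c, u, Ne.symm hv.1, hac, hvc, hv.2, nac, nvc, hau, huv.symm⟩
  · exact ⟨a, v, b, u, Ne.symm hv.1, hab, hvb, hv.2, nab, nvb, hau, huv.symm⟩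

theorem isInducedPath_five {a b c d e : V} (ab : G.Adj a b) (bc : G.Adj b c) (cd : G.Adj c d)
    (de : G.Adj d e) (ac : ¬ G.Adj a c) (ad : ¬ G.Adj a d) (ae : ¬ G.Adj a e) (bd : ¬ G.Adj b d)
    (be : ¬ G.Adj b e) (ce : ¬ G.Adj c e) (hac : a ≠ c) (had : a ≠ d) (hae : a ≠ e) (hbd : b ≠ d)
    (hbe : b ≠ e) (hce : c ≠ e) :
    IsInducedPath G 5 fun j => if j = 1 then a else if j = 2 then b else if j = 3 then c else
      if j = 4 then d else e := by
  have h1 := ab.ne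
  have h2 := bc.ne
  have h3 := cd.ne
  have h4 := de.ne
  have ab' := ab.symm
  have bc' := bc.symm
  have cd' := cd.symm
  have de' := de.symm
  have ac' : ¬ G.Adj c a := fun h => ac h.symm
  have ad' : ¬ G.Adj d a := fun h => ad h.symm
  have ae' : ¬ G.Adj e a := fun h => ae h.symm
  have bd' : ¬ G.Adj d b := fun h => bd h.symm
  have be' : ¬ G.Adj e b := fun h => be h.symm
  have ce' : ¬ G.Adj e c := fun h => ce h.symm
  constructor
  · intro i j hi hi' hj hj'
    interval_cases i <;> interval_cases j <;> simp [*]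
  · intro i j hi hij hj
    interval_cases j <;> interval_cases i <;> simp [*]

/-- The path is `z, u, a, w, b` or `z, u, b, w, a`, where `w` is a common neighbour of `a` and `b`,
and `u` is adjacent to only one vertex of the path `a, w, b`, which is an end. -/
theorem exists_isInducedPath_five [Fintype V] (hG : IsKConnected 3 G) (hα : ¬ NoIndepTriple G)
    (hclaw : ClawRule G) (hbull : BullRule G) : ∃ p, IsInducedPath G 5 p := by
  obtain ⟨a, b, c, w, hab, hac, hbc, nab, nac, nbc, haw, hbw⟩ := exists_indep_triple_common hG hα
  have ncw : ¬ G.Adj c w := by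
    intro h
    rcases hclaw w a b c haw.symm hbw.symm h.symm hab hac hbc with h | h | h
    · exact nab h
    · exact nac h
    · exact nbc h
  -- Some edge `z u` leaves the set of vertices without neighbours in `a, w, b`, which contains `c`.
  obtain ⟨z, u, hz, hu, hzu⟩ := hG.exists_adj
    {v | ¬ G.Adj v a ∧ ¬ G.Adj v b ∧ ¬ G.Adj v w} (a := c) (b := a)
    ⟨fun h => nac h.symm, fun h => nbc h.symm, ncw⟩ (fun h => h.2.2 haw)
  simp only [Set.mem_ofPred_eq] at hz hu
  obtain ⟨nza, nzb, nzw⟩ := hz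
  have hza : z ≠ a := by rintro rfl; exact nzw haw
  have hzb : z ≠ b := by rintro rfl; exact nzw hbw
  have hzw : z ≠ w := by rintro rfl; exact nza haw.symm
  have hua : u ≠ a := by rintro rfl; exact nza hzu
  have hub : u ≠ b := by rintro rfl; exact nzb hzu
  have huw : u ≠ w := by rintro rfl; exact nzw hzu
  have hnot : ¬ (G.Adj u a ∧ G.Adj u b) := by
    rintro ⟨h1, h2⟩
    rcases hclaw u z a b hzu.symm h1 h2 hza hzb hab with h | h | h
    · exact nza h
    · exact nzb h
    · exact nab h
  have tri : ∀ a b, G.Adj a w → G.Adj b w → ¬ G.Adj a b → ¬ G.Adj z a → ¬ G.Adj z b →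
      ¬ G.Adj u b → G.Adj u a → ¬ G.Adj u w := by
    intro a b haw hbw nab nza nzb nub hua huw
    rcases hbull u w a z b huw hua haw.symm hzu.symm hbw.symm with h | h | h | h | h
    · exact nzw h
    · exact nza h
    · exact nub h.symm
    · exact nab h.symm
    · exact nzb h
  have nuw : ¬ G.Adj u w := by
    intro h
    rcases hclaw w a b u haw.symm hbw.symm h.symm hab hua.symm hub.symm with h' | h' | h'
    · exact nab h'
    · exact tri a b haw hbw nab nza nzb (fun h'' => hnot ⟨h'.symm, h''⟩) h'.symm h
    · exact tri b a hbw haw (fun h => nab h.symm) nzb nza (fun h'' => hnot ⟨h'', h'.symm⟩) h'.symm h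
  by_cases h : G.Adj u a
  · exact ⟨_, isInducedPath_five hzu h haw hbw.symm nza nzw nzb nuw (fun h' => hnot ⟨h, h'⟩) nab
      hza hzw hzb huw hub hab⟩
  · have h' : G.Adj u b := by
      by_contra h'
      exact hu ⟨h, h', nuw⟩
    exact ⟨_, isInducedPath_five hzu h' hbw haw.symm nzb nzw nza nuw h (fun h => nab h.symm)
      hzb hzw hza huw hua hab.symm⟩

theorem exists_isLongestPath [Fintype V] (hG : IsKConnected 3 G) (hα : ¬ NoIndepTriple G)
    (hclaw : ClawRule G) (hbull : BullRule G) : ∃ k p, IsLongestPath G k p := by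
  classical
  have h5 := exists_isInducedPath_five hG hα hclaw hbull
  have hbound : ∀ k, (∃ p, IsInducedPath G k p) → k ≤ Fintype.card V := by
    rintro k ⟨p, hp⟩
    have hinj : Function.Injective fun i : Fin k => p (i + 1) := by
      intro i j hij
      by_contra hne
      have hne' : (i : ℕ) ≠ j := fun h => hne (Fin.ext h)
      rcases Nat.lt_or_gt_of_ne hne' with h | h
      · exact hp.ne (i + 1) (j + 1) (by omega) (by omega) (by omega) hij
      · exact hp.ne (j + 1) (i + 1) (by omega) (by omega) (by omega) hij.symm
    simpa using Fintype.card_le_of_injective _ hinj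
  obtain ⟨p, hp⟩ := Nat.findGreatest_spec (P := fun k => ∃ p, IsInducedPath G k p)
    (hbound 5 h5) h5
  refine ⟨_, p, hclaw, hbull, Nat.le_findGreatest (hbound 5 h5) h5, hp, fun p' hp' => ?_⟩
  have := Nat.le_findGreatest (P := fun k => ∃ p, IsInducedPath G k p) (hbound _ ⟨p', hp'⟩)
    ⟨p', hp'⟩
  omega

variable {k : ℕ} {p : ℕ → V}

namespace IsLongestPath

/-- The vertices fall into the classes `1, …, k` along the path and the class `0` of vertices
adjacent to its ends only; each class is a clique, and classes are completely joined or not joined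
at all, according to whether they are consecutive in the cyclic order. -/
theorem exists_classes [Fintype V] (P : IsLongestPath G k p) (hG : IsKConnected 3 G) :
    ∃ f : V → ℕ, (∀ v, f v ≤ k) ∧ (∀ i, 1 ≤ i → i ≤ k → f (p i) = i) ∧
      (∀ u v, u ≠ v → f u ≤ f v + 1 → f v ≤ f u + 1 → G.Adj u v) ∧
      (∀ u v, f u = 0 → f v = k → G.Adj u v) ∧
      (∀ u v, f u + 2 ≤ f v → 1 ≤ f u ∨ f v < k → ¬ G.Adj u v) := by
  have h5 := P.five
  have hall : ∀ v, ∃ j, 1 ≤ j ∧ j ≤ k ∧ (v = p j ∨ G.Adj v (p j)) := by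
    by_contra! hcon
    obtain ⟨w, hw⟩ := hcon
    obtain ⟨u, v, hu, hv, huv⟩ := hG.exists_adj
      {v | ∃ j, 1 ≤ j ∧ j ≤ k ∧ (v = p j ∨ G.Adj v (p j))} (a := p 1) (b := w)
      ⟨1, le_rfl, by omega, Or.inl rfl⟩ (by
        rintro ⟨j, h1, h2, h | h⟩
        · exact (hw j h1 h2).1 h
        · exact (hw j h1 h2).2 h)
    exact hv (P.exists_adj_of_adj hu huv)
  have hex : ∀ v, ∃ i, i ≤ k ∧ ((1 ≤ i ∧ InClass G p k v i) ∨ (i = 0 ∧ InRing G p k v)) := by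
    intro v
    rcases P.classify_of_adj (hall v) with ⟨i, h1, h2, h⟩ | h
    · exact ⟨i, h2, Or.inl ⟨h1, h⟩⟩
    · exact ⟨0, by omega, Or.inr ⟨rfl, h⟩⟩
  choose f hfk hf using hex
  have hcl : ∀ v, 1 ≤ f v → InClass G p k v (f v) := by
    intro v h
    rcases hf v with h' | h'
    · exact h'.2
    · omega
  have hrg : ∀ v, f v = 0 → InRing G p k v := by
    intro v h
    rcases hf v with h' | h'
    · omega
    · exact h'.2
  have hle : ∀ u v, u ≠ v → f u ≤ f v → f v ≤ f u + 1 → G.Adj u v := by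
    intro u v hne h1 h2
    rcases Nat.eq_zero_or_pos (f u) with hu | hu
    · rcases Nat.eq_zero_or_pos (f v) with hv | hv
      · exact P.adj_of_ring (hrg u hu) (hrg v hv) hne
      · have hv1 : f v = 1 := by omega
        exact P.adj_ring_first (hrg u hu) (hv1 ▸ hcl v hv)
    · rcases h1.eq_or_lt with h | h
      · exact P.adj_of_same hu (hfk u) (hcl u hu) (h ▸ hcl v (by omega)) hne
      · have hv : f v = f u + 1 := by omega
        exact P.adj_of_succ hu (hv ▸ hfk v) (hcl u hu) (hv ▸ hcl v (by omega))
  refine ⟨f, hfk, ?_, ?_, ?_, ?_⟩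
  · intro i h1 h2
    rcases hf (p i) with h | h
    · exact P.eq_of_inClass h.1 (hfk _) h1 h2 h.2 (P.inClass_self h1 h2)
    · exact absurd rfl (h.2 i h1 h2).1
  · intro u v hne h1 h2
    rcases Nat.le_total (f u) (f v) with h | h
    · exact hle u v hne h h2
    · exact (hle v u hne.symm h h1).symm
  · intro u v hu hv
    exact P.adj_ring_last (hrg u hu) (hv ▸ hcl v (by omega))
  · intro u v h1 h2
    rcases Nat.eq_zero_or_pos (f u) with hu | hu
    · exact P.not_adj_ring (by omega) (by omega) (hrg u hu) (hcl v (by omega))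
    · exact P.not_adj_of_inClass hu h1 (hfk v) (hcl u hu) (hcl v (by omega))

theorem hasSpanningHalinSubgraph [Fintype V] (P : IsLongestPath G k p) (hG : IsKConnected 3 G) :
    HasSpanningHalinSubgraph G := by
  classical
  have h5 := P.five
  obtain ⟨f, hfk, hfp, hadj, hclose, hnot⟩ := P.exists_classes hG
  by_cases h0 : ∃ z, f z = 0
  · have hne : ∀ i, i ≤ k → ∃ v, f v = i := by
      intro i hi
      rcases Nat.eq_zero_or_pos i with rfl | h
      · exact h0
      · exact ⟨p i, hfp i h hi⟩
    -- Two classes which are not consecutive separate the graph, so one of them is large.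
    have hcut : ∀ i j, i + 2 ≤ j → j ≤ k → 1 ≤ i ∨ j < k →
        (∃ s t, f s = i ∧ f t = i ∧ s ≠ t) ∨ ∃ s t, f s = j ∧ f t = j ∧ s ≠ t := by
      intro i j hij hjk hends
      by_contra! hcon
      obtain ⟨hi, hj⟩ := hcon
      obtain ⟨y, hy⟩ := hne i (by omega)
      obtain ⟨z, hz⟩ := hne j hjk
      obtain ⟨a, ha⟩ := hne (i + 1) (by omega)
      obtain ⟨b, hb⟩ : ∃ b, f b < i ∨ j < f b := by
        rcases Nat.lt_or_ge j k with h | h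
        · obtain ⟨b, hb⟩ := hne (j + 1) h
          exact ⟨b, by omega⟩
        · obtain ⟨b, hb⟩ := h0
          exact ⟨b, by omega⟩
      obtain ⟨u, v, hu, hv, huy, huz, hvy, hvz, huv⟩ := hG.exists_adj_across
        {v | i < f v ∧ f v < j} (y := y) (z := z) (a := a) (b := b)
        (by simp only [Set.mem_ofPred_eq]; omega)
        (by rintro rfl; omega) (by rintro rfl; omega) (by simp only [Set.mem_ofPred_eq]; omega)
        (by rintro rfl; omega) (by rintro rfl; omega)
      simp only [Set.mem_ofPred_eq] at hu hv
      have hvi : f v ≠ i := fun h => hvy (hi v y h hy)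
      have hvj : f v ≠ j := fun h => hvz (hj v z h hz)
      rcases Nat.lt_or_ge (f v) i with h | h
      · exact hnot v u (by omega) (by omega) huv.symm
      · exact hnot u v (by omega) (by omega) huv
    -- Hence all classes are large except possibly for some `s` and its cyclic successor.
    obtain ⟨s, hsk, hs⟩ : ∃ s, s ≤ k ∧ ∀ i, i ≤ k → i ≠ s → (i ≠ s + 1 ∧ ¬ (s = k ∧ i = 0)) →
        ∃ u v, f u = i ∧ f v = i ∧ u ≠ v := by
      by_cases hsmall : ∃ i, i ≤ k ∧ ¬ ∃ u v, f u = i ∧ f v = i ∧ u ≠ v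
      · obtain ⟨hmk, hm⟩ := Nat.find_spec hsmall
        have hleast := fun j (h : j < Nat.find hsmall) => Nat.find_min hsmall h
        generalize Nat.find hsmall = m at hmk hm hleast
        have hlarge : ∀ i, i < m → ∃ u v, f u = i ∧ f v = i ∧ u ≠ v := by
          intro i hi
          by_contra h
          exact hleast i hi ⟨by omega, h⟩
        by_cases hm0 : m = 0 ∧ ¬ ∃ u v, f u = k ∧ f v = k ∧ u ≠ v
        · obtain ⟨rfl, hk⟩ := hm0
          refine ⟨k, le_rfl, fun i hik hi hi' => ?_⟩
          by_cases h1 : i = 1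
          · exact (hcut i k (by omega) le_rfl (by omega)).resolve_right hk
          · exact (hcut 0 i (by omega) hik (by omega)).resolve_left hm
        · refine ⟨m, hmk, fun i hik hi hi' => ?_⟩
          rcases Nat.lt_or_ge i m with h | h
          · exact hlarge i h
          · by_cases hends : m = 0 ∧ i = k
            · by_contra h'
              exact hm0 ⟨hends.1, hends.2 ▸ h'⟩
            · exact (hcut m i (by omega) hik (by omega)).resolve_left hm
      · push Not at hsmall
        refine ⟨0, by omega, fun i hi _ _ => hsmall i hi⟩
    -- Rotate the classes, so that `s` becomes the last one and its successor the first.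
    let g : V → ℕ := fun v => if s + 1 ≤ f v then f v - (s + 1) else f v + k - s
    refine hasSpanningHalinSubgraph_of_thick_cycle g (k - 1) (by omega) ?_ ?_ ?_ ?_ ?_ ?_
    · intro v
      have := hfk v
      simp only [g]; split_ifs <;> omega
    · intro u v huv h1 h2
      have := hfk u
      have := hfk v
      simp only [g] at h1 h2
      by_cases huv' : f u ≤ f v + 1 ∧ f v ≤ f u + 1
      · exact hadj u v huv huv'.1 huv'.2
      · by_cases hu : f u = 0 ∧ f v = k
        · exact hclose u v hu.1 hu.2
        · by_cases hv : f v = 0 ∧ f u = k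
          · exact (hclose v u hv.1 hv.2).symm
          · exfalso
            split_ifs at h1 h2 <;> omega
    · intro u v h1 h2
      have hu := hfk u
      have hv := hfk v
      have hne' : u ≠ v := by rintro rfl; omega
      simp only [g] at h1 h2
      by_cases hsk' : s = k
      · exact hclose u v (by split_ifs at h1 <;> omega) (by split_ifs at h2 <;> omega)
      · exact hadj u v hne' (by split_ifs at h1 h2 <;> omega) (by split_ifs at h1 h2 <;> omega)
    · by_cases hsk' : s = k
      · obtain ⟨z, hz⟩ := h0
        refine ⟨z, ?_⟩
        simp only [g]; split_ifs <;> omega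
      · obtain ⟨z, hz⟩ := hne (s + 1) (by omega)
        refine ⟨z, ?_⟩
        simp only [g]; split_ifs <;> omega
    · obtain ⟨z, hz⟩ := hne s hsk
      refine ⟨z, ?_⟩
      simp only [g]; split_ifs <;> omega
    · intro i h1 h2
      rcases Nat.lt_or_ge k (i + (s + 1)) with h | h
      · obtain ⟨u, v, hu, hv, huv⟩ := hs (i + s - k) (by omega) (by omega) (by omega)
        refine ⟨u, v, ?_, ?_, huv⟩ <;> simp only [g] <;> split_ifs <;> omega
      · obtain ⟨u, v, hu, hv, huv⟩ := hs (i + (s + 1)) (by omega) (by omega) (by omega)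
        refine ⟨u, v, ?_, ?_, huv⟩ <;> simp only [g] <;> split_ifs <;> omega
  · -- The inner classes separate the ends of the path.
    have hpos : ∀ v, 1 ≤ f v := fun v => Nat.pos_of_ne_zero fun h => h0 ⟨v, h⟩
    have h3 : ∀ i y z, 2 ≤ i → i + 1 ≤ k → f y = i → f z = i → ∃ w, f w = i ∧ w ≠ y ∧ w ≠ z := by
      intro i y z h1 h2 hy hz
      have ha := hfp 1 le_rfl (by omega)
      have hb := hfp k (by omega) le_rfl
      obtain ⟨u, v, hu, hv, huy, huz, hvy, hvz, huv⟩ := hG.exists_adj_across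
        {v | f v < i} (y := y) (z := z) (a := p 1) (b := p k)
        (by simp only [Set.mem_ofPred_eq]; omega)
        (by rintro rfl; omega) (by rintro rfl; omega) (by simp only [Set.mem_ofPred_eq]; omega)
        (by rintro rfl; omega) (by rintro rfl; omega)
      simp only [Set.mem_ofPred_eq] at hu hv
      refine ⟨v, ?_, hvy, hvz⟩
      by_contra hvi
      exact hnot u v (by omega) (Or.inl (hpos u)) huv
    refine hasSpanningHalinSubgraph_of_thick_path (fun v => f v - 1) (k - 2) (by omega) ?_ ?_ ?_ ?_
      ?_
    · intro v
      have := hfk v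
      omega
    · intro u v huv h1 h2
      have := hpos u
      have := hpos v
      exact hadj u v huv (by omega) (by omega)
    · exact ⟨p 1, by rw [hfp 1 le_rfl (by omega)]⟩
    · exact ⟨p k, by rw [hfp k (by omega) le_rfl]; omega⟩
    · intro i h1 h2
      have hs := hfp (i + 1) (by omega) (by omega)
      obtain ⟨t, ht, hts, -⟩ := h3 (i + 1) (p (i + 1)) (p (i + 1)) (by omega) (by omega) hs hs
      obtain ⟨b, hb, hbs, hbt⟩ := h3 (i + 1) (p (i + 1)) t (by omega) (by omega) hs ht
      exact ⟨p (i + 1), t, b, by omega, by omega, by omega, hts.symm, hbs.symm, hbt.symm⟩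

end IsLongestPath

end

end HalinSpanning

theorem theorem1p5 {V : Type*} [Fintype V] (G : SimpleGraph V)
    (hconn : HalinSpanning.IsKConnected 3 G)
    (hclaw : HalinSpanning.IsInducedFree HalinSpanning.claw G)
    (hbull : HalinSpanning.IsInducedFree HalinSpanning.bull G) :
    HalinSpanning.HasSpanningHalinSubgraph G := by
  by_cases hα : HalinSpanning.NoIndepTriple G
  · exact HalinSpanning.hasSpanningHalinSubgraph_of_noIndepTriple hconn hα
  · obtain ⟨k, p, P⟩ := HalinSpanning.exists_isLongestPath hconn hα
      (HalinSpanning.clawRule_of_isInducedFree hclaw)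
      (HalinSpanning.bullRule_of_isInducedFree hbull)
    exact P.hasSpanningHalinSubgraph hconn
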